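/- Let $\mathfrak A$ be a countably infinite alphabet and $\mathfrak A^*$ the free monoid of words over $\mathfrak A$, and let $a,b,t,s\in\mathfrak A$ be distinct letters. For a congruence $\tau$ on $\mathfrak A^*$ let $[w]_\tau$ be the $\tau$-class of $w$. For a set of words $W$ let $M_{synt}(W)=\mathfrak A^*/{\sim_W}$, where $u\sim_W v$ iff $pus\in W\Leftrightarrow pvs\in W$ for all $p,s\in\mathfrak A^*$. For a union $W$ of $\tau$-classes let $M_\tau(W)$ be the Rees quotient of $\mathfrak A^*/\tau$ over the ideal of all classes of words that are not contiguous subwords of words in $W$ (and $\mathfrak A^*/\tau$ itself if there are none). Let $\mathbb M_{synt}(W)$ and $\mathbb M_\tau(W)$ be the varieties of monoids generated by $M_{synt}(W)$ and $M_\tau(W)$. Let $\tau_1$ be the congruence on $\mathfrak A^*$ induced by the relations $x=x^2$, $x\in\mathfrak A$; let $\gamma$ and $\zeta$ be the fully invariant congruences of the varieties of monoids defined by $\{xy\approx yx,\ x^2\approx x^3\}$ and by $\{xtxs\approx xtxsx\}$, respectively; $\wedge$ denotes intersection of congruences. Let $A_0=\langle a,b\mid a^2=a,\ b^2=b,\ ab=0\rangle=\{a,b,ba,0\}$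 and $A=\langle a,b,c\mid a^2=a,\ b^2=b,\ ab=ca=0,\ ac=cb=c\rangle=\{a,b,c,ba,bc,0\}$, and let $\mathbb A_0^1$ and $\mathbb A^1$ be the varieties of monoids generated by $A_0^1$ and $A^1$, where $S^1$ is $S$ with a new identity element adjoined. Let $\mathbb J$ be the variety of monoids defined by the identities $$xyx\approx xyx^2,\quad xyxztx\approx xyxzxtx,\quad xzxyxty\approx xzx^2yty,\quad xyzxy\approx yxzxy,\quad xzytxy\approx xzytyx$$ together with $$\Bigl(\prod_{i=1}^n z_it_i\Bigr)x\Bigl(\prod_{i=1}^n z_{\pi(i)}z_{n+\rho(i)}\Bigr)x\Bigl(\prod_{i=1}^{n} t_{n+i}z_{n+i}\Bigr)\approx\Bigl(\prod_{i=1}^n z_it_i\Bigr)x^2\Bigl(\prod_{i=1}^n z_{\pi(i)}z_{n+\rho(i)}\Bigr)\Bigl(\prod_{i=1}^{n} t_{n+i}z_{n+i}\Bigr)$$ for all $n\ge 0$ and all permutations $\pi,\rho$ of $\{1,\dots,n\}$. Let $\mathbb K$ be the variety of monoids defined by the identities $$xyx\approx xyx^2,\quad xyxztx\approx xyxzxtx,\quad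 xyzxty\approx yxzxty,\quad xzytyxy\approx xzytxy^2$$ together with $p\,x\,q\,y\,r\,xy\,u\approx p\,x\,q\,y\,r\,yx\,u$ for all letters $x,y$ and all words $p,q,r,u$ such that each letter of $q$ occurs at least twice in the word $p\,x\,q\,y\,r\,xy\,u$. Then: (i) $\mathbb A_0^1=\mathbb M_{\tau_1}([ab]_{\tau_1})=\mathbb M_{synt}(a^+b^+)$; (ii) $\mathbb A^1=\mathbb M_{\tau_1\wedge\gamma}([ab^2ta]_{\tau_1\wedge\gamma})=\mathbb M_{synt}(a^+bb^+ta^+)$; (iii) $\mathbb J=\mathbb M_{\tau_1\wedge\zeta}([atbasb]_{\tau_1\wedge\zeta})=\mathbb M_{synt}(atba^+sb^+)$; (iv) $\mathbb K=\mathbb M_{\tau_1\wedge\zeta}([atb^2a]_{\tau_1\wedge\zeta})=\mathbb M_{synt}(atbb^+a^+)$. -/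

import Mathlib

open scoped Pointwise

/-- Words over a fixed countably infinite alphabet, whose letters are indexed by `ℕ`. -/
abbrev Word : Type := FreeMonoid ℕ

/-- The one-letter word. -/
abbrev letter (i : ℕ) : Word := FreeMonoid.of i

/-! ### Identities and varieties of monoids -/

/-- The monoid `M` satisfies the identity `e.1 ≈ e.2`. -/
def Satisfies (M : Type*) [Monoid M] (e : Word × Word) : Prop :=
  ∀ φ : Word →* M, φ e.1 = φ e.2

/-- The variety of monoids defined by a set of identities. -/
def varOf.{w} (S : Set (Word × Word)) : Set MonCat.{w} :=
  {N | ∀ e ∈ S, Satisfies N e}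

/-- A class of monoids is a variety if some set of identities defines it. -/
def IsMonoidVariety.{w} (V : Set MonCat.{w}) : Prop :=
  ∃ S : Set (Word × Word), V = varOf S

/-- The variety generated by the monoid `M`: all monoids that satisfy every identity of `M`.
By the next theorem it is the smallest variety that contains `M`. -/
def generatedVariety.{w, v} (M : Type v) [Monoid M] : Set MonCat.{w} :=
  varOf {e | Satisfies M e}

theorem generatedVariety_isLeast.{w} (M : Type w) [Monoid M] :
    IsLeast {V : Set MonCat.{w} | IsMonoidVariety V ∧ MonCat.of M ∈ V} (generatedVariety M) := by
  refine ⟨⟨⟨_, rfl⟩, fun e he => he⟩, ?_⟩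
  rintro V ⟨⟨S, rfl⟩, hM⟩ N hN e he
  exact hN e (hM e he)

/-- The fully invariant congruence of a class of monoids: `u` and `v` are related
when every member of the class satisfies `u ≈ v`. -/
def fullyInvariantCon (V : Set MonCat.{0}) : Con Word where
  r u v := ∀ N ∈ V, Satisfies N (u, v)
  iseqv :=
    { refl := fun _ _ _ _ => rfl
      symm := fun h N hN φ => (h N hN φ).symm
      trans := fun h k N hN φ => (h N hN φ).trans (k N hN φ) }
  mul' := by
    intro u v u' v' h k N hN φ
    have h1 : φ u = φ v := h N hN φ
    have h2 : φ u' = φ v' := k N hN φ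
    simp only [map_mul, h1, h2]

/-! ### Syntactic monoids and the monoids `M_τ(W)` -/

/-- The syntactic congruence of a set of words. -/
def syntacticCon (W : Set Word) : Con Word where
  r u v := ∀ p s : Word, p * u * s ∈ W ↔ p * v * s ∈ W
  iseqv :=
    { refl := fun _ _ _ => Iff.rfl
      symm := fun h p s => (h p s).symm
      trans := fun h k p s => (h p s).trans (k p s) }
  mul' := by
    intro u v u' v' h k p s
    have h1 := h p (u' * s)
    have h2 := k (p * v) s
    simp only [mul_assoc] at h1 h2 ⊢
    exact h1.trans h2

/-- The syntactic monoid of a set of words. -/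
abbrev SyntacticMonoid (W : Set Word) : Type := (syntacticCon W).Quotient

/-- The words whose `τ`-class divides the `τ`-class of some word in `W`.  When `W` is a union of
`τ`-classes, these are exactly the (contiguous) subwords of words in `W`. -/
def divisorClosure (τ : Con Word) (W : Set Word) : Set Word :=
  {v | ∃ p s : Word, ∃ w ∈ W, τ (p * v * s) w}

/-- The congruence that identifies `τ`-related words and collapses to one class all words outside
`divisorClosure τ W`. -/
def reesCon (τ : Con Word) (W : Set Word) : Con Word where
  r u v := τ u v ∨ (u ∉ divisorClosure τ W ∧ v ∉ divisorClosure τ W)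
  iseqv := by
    have key : ∀ {u v : Word}, τ u v → u ∈ divisorClosure τ W → v ∈ divisorClosure τ W := by
      rintro u v h ⟨p, s, w, hw, hpw⟩
      exact ⟨p, s, w, hw,
        τ.trans (τ.mul (τ.mul (τ.refl p) (τ.symm h)) (τ.refl s)) hpw⟩
    refine ⟨fun u => Or.inl (τ.refl u), ?_, ?_⟩
    · rintro u v (h | ⟨h, k⟩)
      · exact Or.inl (τ.symm h)
      · exact Or.inr ⟨k, h⟩
    · rintro u v w (h | ⟨h, k⟩) (h' | ⟨h', k'⟩)
      · exact Or.inl (τ.trans h h')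
      · exact Or.inr ⟨fun hu => h' (key h hu), k'⟩
      · exact Or.inr ⟨h, fun hw => k (key (τ.symm h') hw)⟩
      · exact Or.inr ⟨h, k'⟩
  mul' := by
    have left : ∀ {u x : Word}, u * x ∈ divisorClosure τ W → u ∈ divisorClosure τ W := by
      rintro u x ⟨p, s, w, hw, hpw⟩
      exact ⟨p, x * s, w, hw, by simpa only [mul_assoc] using hpw⟩
    have right : ∀ {u x : Word}, x * u ∈ divisorClosure τ W → u ∈ divisorClosure τ W := by
      rintro u x ⟨p, s, w, hw, hpw⟩
      exact ⟨p * x, s, w, hw, by simpa only [mul_assoc] using hpw⟩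
    rintro u v u' v' (h | ⟨h, k⟩) (h' | ⟨h', k'⟩)
    · exact Or.inl (τ.mul h h')
    · exact Or.inr ⟨fun hu => h' (right hu), fun hv => k' (right hv)⟩
    · exact Or.inr ⟨fun hu => h (left hu), fun hv => k (left hv)⟩
    · exact Or.inr ⟨fun hu => h (left hu), fun hv => k (left hv)⟩

/-- The monoid `M_τ(W)`: the Rees quotient of `Word / τ` over the ideal of all `τ`-classes that do
not divide a class in `W` (and `Word / τ` itself if there are no such classes). -/
abbrev MTau (τ : Con Word) (W : Set Word) : Type := (reesCon τ W).Quotient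

/-- The class of the word `w` under the congruence `τ`. -/
def conClass (τ : Con Word) (w : Word) : Set Word := {v | τ v w}

/-- The language `a⁺`. -/
def plus (a : ℕ) : Set Word := {w | ∃ n : ℕ, 1 ≤ n ∧ w = letter a ^ n}

/-! ### The congruences `τ₁`, `γ` and `ζ` -/

/-- The congruence on words induced by the relations `a = a²` for all letters `a`. -/
def tauOne : Con Word := conGen fun u v => ∃ i : ℕ, u = letter i ∧ v = letter i * letter i

/-- The fully invariant congruence of the variety defined by `xy ≈ yx` and `x² ≈ x³`. -/
def gammaCon : Con Word :=
  let x := letter 0; let y := letter 1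
  fullyInvariantCon (varOf {(x * y, y * x), (x ^ 2, x ^ 3)})

/-- The fully invariant congruence of the variety defined by `xtxs ≈ xtxsx`. -/
def zetaCon : Con Word :=
  let x := letter 0; let t := letter 1; let s := letter 2
  fullyInvariantCon (varOf {(x * t * x * s, x * t * x * s * x)})

/-! ### The semigroups `A₀` and `A`

Adjoining a new identity element is Mathlib's `WithOne`. -/

/-- `A₀ = ⟨a, b ∣ a² = a, b² = b, ab = 0⟩ = {a, b, ba, 0}`. -/
inductive SemigroupA0 : Type
  | a | b | ba | zero

namespace SemigroupA0

/-- The multiplication table of `A₀`. -/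
def mul : SemigroupA0 → SemigroupA0 → SemigroupA0
  | a, a => a
  | b, b => b
  | b, a => ba
  | b, ba => ba
  | ba, a => ba
  | _, _ => zero

instance : Semigroup SemigroupA0 where
  mul := mul
  mul_assoc := by rintro ⟨⟩ ⟨⟩ ⟨⟩ <;> rfl

theorem relations :
    a * a = a ∧ b * b = b ∧ a * b = zero ∧ b * a = ba ∧
      ∀ x : SemigroupA0, x * zero = zero ∧ zero * x = zero := by
  refine ⟨rfl, rfl, rfl, rfl, ?_⟩
  rintro ⟨⟩ <;> exact ⟨rfl, rfl⟩

end SemigroupA0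

/-- `A = ⟨a, b, c ∣ a² = a, b² = b, ab = ca = 0, ac = cb = c⟩ = {a, b, c, ba, bc, 0}`. -/
inductive SemigroupA : Type
  | a | b | c | ba | bc | zero

namespace SemigroupA

/-- The multiplication table of `A`. -/
def mul : SemigroupA → SemigroupA → SemigroupA
  | a, a => a
  | a, c => c
  | b, a => ba
  | b, b => b
  | b, c => bc
  | b, ba => ba
  | b, bc => bc
  | c, b => c
  | ba, a => ba
  | ba, c => bc
  | bc, b => bc
  | _, _ => zero

instance : Semigroup SemigroupA where
  mul := mul
  mul_assoc := by rintro ⟨⟩ ⟨⟩ ⟨⟩ <;> rfl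

theorem relations :
    a * a = a ∧ b * b = b ∧ a * b = zero ∧ c * a = zero ∧ a * c = c ∧ c * b = c ∧
      b * a = ba ∧ b * c = bc ∧ ∀ x : SemigroupA, x * zero = zero ∧ zero * x = zero := by
  refine ⟨rfl, rfl, rfl, rfl, rfl, rfl, rfl, rfl, ?_⟩
  rintro ⟨⟩ <;> exact ⟨rfl, rfl⟩

end SemigroupA

/-! ### The limit varieties `J` and `K` -/

/-- The left side of the identity `w_n(π, ρ)`:
`(z₁t₁ ⋯ zₙtₙ) x (z_{π1} z_{n+ρ1} ⋯ z_{πn} z_{n+ρn}) x (t_{n+1}z_{n+1} ⋯ t_{2n}z_{2n})`.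
The letter `x` is `0`, and `zᵢ`, `tᵢ` are the letters `2i - 1` and `2i`. -/
def jLeft (n : ℕ) (π ρ : Equiv.Perm (Fin n)) : Word :=
  let x := letter 0
  let z : ℕ → Word := fun i => letter (2 * i + 1)
  let t : ℕ → Word := fun i => letter (2 * i + 2)
  (List.ofFn fun i : Fin n => z i * t i).prod * x *
    (List.ofFn fun i : Fin n => z (π i) * z (n + ρ i)).prod * x *
    (List.ofFn fun i : Fin n => t (n + i) * z (n + i)).prod

/-- The right side of the identity `w_n(π, ρ)`:
`(z₁t₁ ⋯ zₙtₙ) x² (z_{π1} z_{n+ρ1} ⋯ z_{πn} z_{n+ρn}) (t_{n+1}z_{n+1} ⋯ t_{2n}z_{2n})`. -/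
def jRight (n : ℕ) (π ρ : Equiv.Perm (Fin n)) : Word :=
  let x := letter 0
  let z : ℕ → Word := fun i => letter (2 * i + 1)
  let t : ℕ → Word := fun i => letter (2 * i + 2)
  (List.ofFn fun i : Fin n => z i * t i).prod * x ^ 2 *
    (List.ofFn fun i : Fin n => z (π i) * z (n + ρ i)).prod *
    (List.ofFn fun i : Fin n => t (n + i) * z (n + i)).prod

/-- The identities `xyx ≈ xyx²`, `xyxztx ≈ xyxzxtx`, `xzxyxty ≈ xzx²yty`, `xyzxy ≈ yxzxy`,
`xzytxy ≈ xzytyx`, and `w_n(π, ρ)` for all `n` and all permutations `π`, `ρ`. -/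
def identitiesJ : Set (Word × Word) :=
  let x := letter 0; let y := letter 1; let z := letter 2; let t := letter 3
  {(x * y * x, x * y * x ^ 2),
   (x * y * x * z * t * x, x * y * x * z * x * t * x),
   (x * z * x * y * x * t * y, x * z * x ^ 2 * y * t * y),
   (x * y * z * x * y, y * x * z * x * y),
   (x * z * y * t * x * y, x * z * y * t * y * x)} ∪
  {e | ∃ (n : ℕ) (π ρ : Equiv.Perm (Fin n)), e = (jLeft n π ρ, jRight n π ρ)}

/-- The variety `J`. -/
def varietyJ.{w} : Set MonCat.{w} := varOf identitiesJ

/-- The identities `xyx ≈ xyx²`, `xyxztx ≈ xyxzxtx`, `xyzxty ≈ yxzxty`, `xzytyxy ≈ xzytxy²`, and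
`p x q y r xy s ≈ p x q y r yx s` for all letters `x`, `y` and all words `p`, `q`, `r`, `s`
such that every letter of `q` occurs at least twice in the word `p x q y r xy s`. -/
def identitiesK : Set (Word × Word) :=
  let x := letter 0; let y := letter 1; let z := letter 2; let t := letter 3
  {(x * y * x, x * y * x ^ 2),
   (x * y * x * z * t * x, x * y * x * z * x * t * x),
   (x * y * z * x * t * y, y * x * z * x * t * y),
   (x * z * y * t * y * x * y, x * z * y * t * x * y ^ 2)} ∪
  {e | ∃ (p q r s : Word) (i j : ℕ),
    (∀ k ∈ q.toList,
      2 ≤ (p * letter i * q * letter j * r * letter i * letter j * s).toList.count k) ∧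
    e = (p * letter i * q * letter j * r * letter i * letter j * s,
      p * letter i * q * letter j * r * letter j * letter i * s)}

/-- The variety `K`. -/
def varietyK.{w} : Set MonCat.{w} := varOf identitiesK

universe w

/-!
If `W` is a `τ`-class, a word that divides no word of `W` has no context in `W`, so `M_synt(W)` is a
quotient of `M_τ(W)`. Hence each of the four chains reduces to two inclusions: the identities of the
first variety hold in `M_τ(W)`, and the identities of `M_synt(W)` hold in the first variety.

`A₀¹` and `A¹` are images of the free monoid in which some singleton is disjunctive, and a
substitution translates the preimage of this singleton into `W`. This makes every identity of
`M_synt(W)` hold there. Conversely, `A₀¹` and `A¹` see enough of a factor of a word in `W` to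
determine its `τ`-class.

For `J` and `K`, the identities `xyx ≈ xyx²` and `xyxztx ≈ xyxzxtx` bring each word to a form where
every letter occurs once or three times. If two such words are not separated by `W`, their linear
letters cut the other letters in the same way, and the first word is sorted into the second, letter
by letter, by swaps of adjacent letters. Where a swap is not derivable, linear letters separate the
occurrences of the two letters in such a pattern that a substitution into `W` distinguishes the
words. For `J` this needs the first two occurrences of a letter to be separated by a linear letter;
the infinite family of identities serves to pull together two occurrences that are not.
-/

/-! ### Identities of quotients of the free monoid -/

theorem generatedVariety_congr.{v, v'} {M : Type v} {M' : Type v'} [Monoid M] [Monoid M']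
    (h : ∀ e, Satisfies M e ↔ Satisfies M' e) :
    generatedVariety.{w} M = generatedVariety.{w} M' :=
  congrArg varOf (Set.ext h)

theorem exists_lift_of_surjective {M N : Type*} [Monoid M] [Monoid N] {f : M →* N}
    (hf : Function.Surjective f) (φ : Word →* N) : ∃ χ : Word →* M, f.comp χ = φ := by
  choose g hg using hf
  exact ⟨FreeMonoid.lift fun i => g (φ (letter i)), FreeMonoid.hom_eq fun i => by
    simp only [MonoidHom.comp_apply, FreeMonoid.lift_eval_of, hg]⟩

theorem satisfies_quotient_iff (C : Con Word) (e : Word × Word) :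
    Satisfies C.Quotient e ↔ ∀ φ : Word →* Word, C (φ e.1) (φ e.2) := by
  refine ⟨fun h φ => (Con.eq C).1 (h (C.mk'.comp φ)), fun h φ => ?_⟩
  obtain ⟨χ, rfl⟩ := exists_lift_of_surjective C.mk'_surjective φ
  exact (Con.eq C).2 (h χ)

theorem Satisfies.quotient_mono {C D : Con Word} (hCD : C ≤ D) {e : Word × Word}
    (h : Satisfies C.Quotient e) : Satisfies D.Quotient e :=
  (satisfies_quotient_iff D e).2 fun φ => hCD ((satisfies_quotient_iff C e).1 h φ)

theorem reesCon_le_syntacticCon (τ : Con Word) (w : Word) :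
    reesCon τ (conClass τ w) ≤ syntacticCon (conClass τ w) := by
  rintro u v (h | ⟨hu, hv⟩) p s
  · have h' : τ (p * u * s) (p * v * s) := τ.mul (τ.mul (τ.refl p) h) (τ.refl s)
    exact ⟨τ.trans (τ.symm h'), τ.trans h'⟩
  · exact ⟨fun k => (hu ⟨p, s, w, τ.refl w, k⟩).elim, fun k => (hv ⟨p, s, w, τ.refl w, k⟩).elim⟩

theorem satisfies_MTau_of {τ : Con Word} {w : Word} {e : Word × Word}
    (h : ∀ (φ : Word →* Word) (p s : Word),
      (p * φ e.1 * s ∈ conClass τ w ∨ p * φ e.2 * s ∈ conClass τ w) → τ (φ e.1) (φ e.2)) :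
    Satisfies (MTau τ (conClass τ w)) e := by
  rw [satisfies_quotient_iff]
  intro φ
  by_cases h₁ : φ e.1 ∈ divisorClosure τ (conClass τ w)
  · obtain ⟨p, s, x, hx, hpx⟩ := h₁
    exact Or.inl (h φ p s (Or.inl (τ.trans hpx hx)))
  by_cases h₂ : φ e.2 ∈ divisorClosure τ (conClass τ w)
  · obtain ⟨p, s, x, hx, hpx⟩ := h₂
    exact Or.inl (h φ p s (Or.inr (τ.trans hpx hx)))
  exact Or.inr ⟨h₁, h₂⟩

theorem satisfies_MTau_of_satisfies {M : Type*} [Monoid M] {τ : Con Word} {w : Word}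
    (hM : ∀ u v p s, Satisfies M (u, v) → p * u * s ∈ conClass τ w → τ u v) {e : Word × Word}
    (h : Satisfies M e) : Satisfies (MTau τ (conClass τ w)) e := by
  refine satisfies_MTau_of fun φ p s hps => ?_
  have hφ : Satisfies M (φ e.1, φ e.2) := fun χ => h (χ.comp φ)
  rcases hps with hu | hv
  · exact hM _ _ p s hφ hu
  · exact τ.symm (hM _ _ p s (fun χ => (hφ χ).symm) hv)

theorem generatedVariety_eq_MTau_and_syntacticMonoid {M : Type*} [Monoid M] {τ : Con Word}
    {w : Word} (hM : ∀ e, Satisfies M e → Satisfies (MTau τ (conClass τ w)) e)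
    (hW : ∀ e, Satisfies (SyntacticMonoid (conClass τ w)) e → Satisfies M e) :
    generatedVariety.{w} M = generatedVariety.{w} (MTau τ (conClass τ w)) ∧
      generatedVariety.{w} (MTau τ (conClass τ w)) =
        generatedVariety.{w} (SyntacticMonoid (conClass τ w)) :=
  have hmono {e : Word × Word} (h : Satisfies (MTau τ (conClass τ w)) e) :
      Satisfies (SyntacticMonoid (conClass τ w)) e :=
    h.quotient_mono (reesCon_le_syntacticCon τ w)
  ⟨generatedVariety_congr fun e => ⟨hM e, fun h => hW e (hmono h)⟩,
    generatedVariety_congr fun e => ⟨hmono, fun h => hM e (hW e h)⟩⟩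

/-- A subset of a monoid is disjunctive if its syntactic congruence is trivial. -/
def IsDisjunctive {M : Type*} [Monoid M] (T : Set M) : Prop :=
  ∀ m m' : M, (∀ p q, p * m * q ∈ T ↔ p * m' * q ∈ T) → m = m'

theorem IsDisjunctive.satisfies {M : Type*} [Monoid M] {T : Set M} (hT : IsDisjunctive T)
    {f : Word →* M} (hf : Function.Surjective f) {W : Set Word} {ψ : Word →* Word}
    (hW : ∀ w, ψ w ∈ W ↔ f w ∈ T) {e : Word × Word} (h : Satisfies (SyntacticMonoid W) e) :
    Satisfies M e := by
  rw [satisfies_quotient_iff] at h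
  intro φ
  obtain ⟨χ, rfl⟩ := exists_lift_of_surjective hf φ
  refine hT _ _ fun p q => ?_
  obtain ⟨p, rfl⟩ := hf p
  obtain ⟨q, rfl⟩ := hf q
  have := h (ψ.comp χ) (ψ p) (ψ q)
  simpa only [MonoidHom.comp_apply, ← map_mul, hW] using this

/-! ### Derivable identities -/

/-- The identities derivable from `S`: the congruence on words generated by all substitution
instances of the identities in `S`. -/
def derivCon (S : Set (Word × Word)) : Con Word :=
  conGen fun u v => ∃ e ∈ S, ∃ φ : Word →* Word, u = φ e.1 ∧ v = φ e.2

theorem derivCon_map {S : Set (Word × Word)} {e : Word × Word} (h : e ∈ S) (φ : Word →* Word) :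
    derivCon S (φ e.1) (φ e.2) :=
  ConGen.Rel.of _ _ ⟨e, h, φ, rfl, rfl⟩

theorem satisfies_of_derivCon {S : Set (Word × Word)} {M : Type*} [Monoid M]
    (hM : ∀ e ∈ S, Satisfies M e) {u v : Word} (h : derivCon S u v) : Satisfies M (u, v) := by
  intro χ
  have hle : derivCon S ≤ Con.ker χ := by
    refine Con.conGen_le.2 ?_
    rintro _ _ ⟨e, he, φ, rfl, rfl⟩
    exact hM e he (χ.comp φ)
  exact hle h

theorem varOf_eq_generatedVariety {S : Set (Word × Word)} {M : Type*} [Monoid M]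
    (hsound : ∀ e ∈ S, Satisfies M e) (hcomplete : ∀ u v, Satisfies M (u, v) → derivCon S u v) :
    varOf.{w} S = generatedVariety.{w} M :=
  Set.ext fun _ => ⟨fun hN _ he => satisfies_of_derivCon hN (hcomplete _ _ he),
    fun hN e he => hN e (hsound e he)⟩

theorem varOf_eq_MTau_and_syntacticMonoid {S : Set (Word × Word)} {τ : Con Word} {w : Word}
    (hsound : ∀ e ∈ S, Satisfies (MTau τ (conClass τ w)) e)
    (hcomplete : ∀ u v, Satisfies (SyntacticMonoid (conClass τ w)) (u, v) → derivCon S u v) :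
    varOf.{w} S = generatedVariety.{w} (MTau τ (conClass τ w)) ∧
      generatedVariety.{w} (MTau τ (conClass τ w)) =
        generatedVariety.{w} (SyntacticMonoid (conClass τ w)) := by
  have h := generatedVariety_eq_MTau_and_syntacticMonoid.{w} (τ := τ) (w := w) (fun _ => id)
    fun e he => satisfies_of_derivCon hsound (hcomplete e.1 e.2 he)
  refine ⟨varOf_eq_generatedVariety hsound fun u v huv => hcomplete u v ?_, h.2⟩
  exact huv.quotient_mono (reesCon_le_syntacticCon τ w)

/-! ### The congruences `τ₁`, `γ` and `ζ` -/

theorem tauOne_letter_pow (i : ℕ) {n : ℕ} (hn : 1 ≤ n) : tauOne (letter i ^ n) (letter i) := by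
  induction n, hn using Nat.le_induction with
  | base => simpa only [pow_one] using tauOne.refl _
  | succ n _ ih =>
    rw [pow_succ]
    exact tauOne.trans (tauOne.mul ih (tauOne.refl _))
      (tauOne.symm (ConGen.Rel.of _ _ ⟨i, rfl, rfl⟩))

theorem destutter'_append_dup {α : Type*} [DecidableEq α] (p : List α) (x : α) (s : List α)
    (y : α) : (p ++ x :: x :: s).destutter' (· ≠ ·) y = (p ++ x :: s).destutter' (· ≠ ·) y := by
  induction p generalizing y with
  | nil => by_cases hyx : y = x <;> simp [hyx]
  | cons z p ih => simp only [List.cons_append, List.destutter'_cons, ih]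

theorem destutter_append_dup {α : Type*} [DecidableEq α] (p : List α) (x : α) (s : List α) :
    (p ++ x :: x :: s).destutter (· ≠ ·) = (p ++ x :: s).destutter (· ≠ ·) := by
  cases p with
  | nil => simp [List.destutter_cons']
  | cons y p => exact destutter'_append_dup p x s y

theorem destutter_eq_of_tauOne {u v : Word} (h : tauOne u v) :
    u.toList.destutter (· ≠ ·) = v.toList.destutter (· ≠ ·) := by
  have hle : tauOne ≤
      syntacticCon {w | w.toList.destutter (· ≠ ·) = v.toList.destutter (· ≠ ·)} := by
    refine Con.conGen_le.2 ?_
    rintro _ _ ⟨i, rfl, rfl⟩ p s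
    simp only [Set.mem_ofPred_eq, FreeMonoid.toList_mul, FreeMonoid.toList_of, List.append_assoc,
      List.cons_append, List.nil_append, destutter_append_dup]
  simpa using hle h 1 1

theorem exists_replicate_of_destutter_eq_cons {α : Type*} [DecidableEq α] {w l : List α} {c : α}
    (h : w.destutter (· ≠ ·) = c :: l) :
    ∃ n w', w = List.replicate (n + 1) c ++ w' ∧ w'.destutter (· ≠ ·) = l := by
  cases w with
  | nil => simp at h
  | cons x w =>
    rw [List.destutter_cons'] at h
    induction w with
    | nil =>
      obtain ⟨rfl, rfl⟩ := List.cons.inj h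
      exact ⟨0, [], rfl, rfl⟩
    | cons y w ih =>
      rw [List.destutter'_cons] at h
      split_ifs at h with hxy
      · obtain ⟨rfl, rfl⟩ := List.cons.inj h
        exact ⟨0, y :: w, rfl, rfl⟩
      · obtain rfl : x = y := not_not.1 hxy
        obtain ⟨n, w', hw, hl⟩ := ih h
        obtain rfl : x = c := by simpa [List.replicate_succ] using congrArg List.head? hw
        exact ⟨n + 1, w', by rw [hw, List.replicate_succ (n := n + 1), List.cons_append], hl⟩

/-- The words whose projection to the letters satisfying `p` starts with `l`, where only the first
two letters of the projection are compared. -/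
def prefixLanguage (p : ℕ → Bool) (l : List ℕ) : Set Word :=
  {w | (w.toList.filter p).take 2 = l}

theorem take_two_filter_of_fullyInvariantCon {S : Set (Word × Word)} {p : ℕ → Bool}
    (hS : ∀ l, ∀ e ∈ S, Satisfies (SyntacticMonoid (prefixLanguage p l)) e)
    {u v : Word} (h : fullyInvariantCon (varOf S) u v) :
    (u.toList.filter p).take 2 = (v.toList.filter p).take 2 := by
  have hsat := h (MonCat.of (SyntacticMonoid (prefixLanguage p ((v.toList.filter p).take 2))))
    fun e he => hS _ e he
  simpa [prefixLanguage] using (satisfies_quotient_iff _ _).1 hsat (MonoidHom.id _) 1 1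

theorem take_two_append_repeat {α : Type*} (Q X T A : List α) :
    (Q ++ (X ++ (T ++ (X ++ A)))).take 2 =
      if X = [] then (Q ++ (T ++ A)).take 2 else (Q ++ (X ++ (T ++ X))).take 2 := by
  split_ifs with hX
  · simp only [hX, List.nil_append]
  · have hlen : 2 ≤ (Q ++ (X ++ (T ++ X))).length := by
      have := List.length_pos_of_ne_nil hX
      simp only [List.length_append]
      omega
    rw [← List.take_append_of_le_length hlen (l₂ := A)]
    simp only [List.append_assoc]

theorem take_two_filter_of_zetaCon {u v : Word} (p : ℕ → Bool) (h : zetaCon u v) :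
    (u.toList.filter p).take 2 = (v.toList.filter p).take 2 := by
  refine take_two_filter_of_fullyInvariantCon ?_ h
  rintro l _ rfl
  rw [satisfies_quotient_iff]
  intro φ q r
  simp only [map_mul, prefixLanguage, Set.mem_ofPred_eq, FreeMonoid.toList_mul, List.filter_append,
    List.append_assoc, take_two_append_repeat]
  split_ifs with hX
  · rw [hX, List.nil_append]
  · rfl

theorem take_two_filter_beq (l : List ℕ) (x : ℕ) :
    (l.filter (· == x)).take 2 = List.replicate (min (l.count x) 2) x := by
  rw [List.filter_beq, List.take_replicate, min_comm]

theorem min_count_two_of_take_two_filter {u v : List ℕ} {x : ℕ}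
    (h : (u.filter (· == x)).take 2 = (v.filter (· == x)).take 2) :
    min (u.count x) 2 = min (v.count x) 2 := by
  simpa only [take_two_filter_beq, List.length_replicate] using congrArg List.length h

theorem min_count_two_of_zetaCon {u v : Word} (h : zetaCon u v) (x : ℕ) :
    min (u.toList.count x) 2 = min (v.toList.count x) 2 :=
  min_count_two_of_take_two_filter (take_two_filter_of_zetaCon _ h)

theorem min_count_two_of_gammaCon {u v : Word} (h : gammaCon u v) (x : ℕ) :
    min (u.toList.count x) 2 = min (v.toList.count x) 2 := by
  refine min_count_two_of_take_two_filter (take_two_filter_of_fullyInvariantCon ?_ h)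
  rintro l _ (rfl | rfl) <;>
  · rw [satisfies_quotient_iff]
    intro φ q r
    simp only [map_mul, prefixLanguage, Set.mem_ofPred_eq, FreeMonoid.toList_mul,
      take_two_filter_beq, pow_succ, pow_zero, one_mul, List.count_append]
    refine Eq.congr_left (congrArg (List.replicate · x) ?_)
    omega

theorem pow_eq_pow_min_two {M : Type*} [Monoid M] {m : M} (hm : m ^ 2 = m ^ 3) (k : ℕ) :
    m ^ k = m ^ min k 2 := by
  induction k with
  | zero => rfl
  | succ k ih =>
    rcases le_or_gt 2 k with hk | hk
    · rw [pow_succ, ih, min_eq_right hk, min_eq_right (by omega), ← pow_succ, hm]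
    · rw [min_eq_left (by omega)]

theorem map_eq_map_of_min_count_two {M : Type*} [CommMonoid M] (hM : ∀ m : M, m ^ 2 = m ^ 3)
    {u v : Word} (h : ∀ x, min (u.toList.count x) 2 = min (v.toList.count x) 2) (φ : Word →* M) :
    φ u = φ v := by
  have hprod (w : Word) : φ w = (w.toList.map (φ ∘ letter)).prod := by
    rw [← FreeMonoid.lift_apply]
    exact DFunLike.congr_fun (FreeMonoid.lift_restrict φ).symm w
  have hsupp : u.toList.toFinset = v.toList.toFinset := by
    ext x
    have := h x
    simp only [List.mem_toFinset, ← List.count_pos_iff]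
    omega
  rw [hprod u, hprod v, Finset.prod_list_map_count, Finset.prod_list_map_count, hsupp]
  refine Finset.prod_congr rfl fun x _ => ?_
  rw [pow_eq_pow_min_two (hM _), h x, ← pow_eq_pow_min_two (hM _)]

theorem gammaCon_of_min_count_two {u v : Word}
    (h : ∀ x, min (u.toList.count x) 2 = min (v.toList.count x) 2) : gammaCon u v := by
  intro N hN φ
  have hcomm (m n : N) : m * n = n * m := by
    simpa using hN _ (Or.inl rfl) (FreeMonoid.lift fun i => if i = 0 then m else n)
  have hpow (m : N) : m ^ 2 = m ^ 3 := by
    simpa using hN _ (Or.inr rfl) (FreeMonoid.lift fun _ => m)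
  let _ : CommMonoid N := { (inferInstance : Monoid N) with mul_comm := hcomm }
  exact map_eq_map_of_min_count_two hpow h φ

theorem zetaCon_append_occurrence (X T Y : Word) :
    zetaCon (X * T * X * Y) (X * T * X * Y * X) := by
  intro N hN φ
  simpa using hN _ rfl (FreeMonoid.lift fun i => if i = 0 then φ X else if i = 1 then φ T else φ Y)

theorem zetaCon_last_pow (X T : Word) {n : ℕ} (hn : 1 ≤ n) :
    zetaCon (X * T * X ^ n) (X * T * X) := by
  induction n, hn using Nat.le_induction with
  | base => simpa only [pow_one] using zetaCon.refl _
  | succ n _ ih =>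
    have hdouble : zetaCon (X * T * X * X) (X * T * X) := by
      simpa only [mul_one] using zetaCon.symm (zetaCon_append_occurrence X T 1)
    rw [pow_succ, ← mul_assoc]
    exact zetaCon.trans (zetaCon.mul ih (zetaCon.refl X)) hdouble

/-! ### The languages of the theorem as congruence classes -/

theorem toList_letter_pow (i n : ℕ) : (letter i ^ n).toList = List.replicate n i := by
  induction n with
  | zero => rfl
  | succ n ih =>
    rw [pow_succ, FreeMonoid.toList_mul, ih, FreeMonoid.toList_of, List.replicate_succ']

theorem tauOne_iff_mem_prod_plus {l : List ℕ} (hl : l.IsChain (· ≠ ·)) {w : Word} :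
    tauOne w (FreeMonoid.ofList l) ↔ w ∈ (l.map plus).prod := by
  constructor
  · intro h
    have hw : w.toList.destutter (· ≠ ·) = l := by
      rw [destutter_eq_of_tauOne h, FreeMonoid.toList_ofList, List.destutter_of_isChain _ l hl]
    clear h hl
    induction l generalizing w with
    | nil => exact FreeMonoid.toList.injective (by simpa using hw)
    | cons c l ih =>
      obtain ⟨n, w', hw', hl⟩ := exists_replicate_of_destutter_eq_cons hw
      have hmul : w = letter c ^ (n + 1) * FreeMonoid.ofList w' :=
        FreeMonoid.toList.injective <| by
          rw [hw', FreeMonoid.toList_mul, toList_letter_pow, FreeMonoid.toList_ofList]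
      rw [hmul, List.map_cons, List.prod_cons]
      exact Set.mul_mem_mul ⟨n + 1, by omega, rfl⟩ (ih hl)
  · clear hl
    intro h
    induction l generalizing w with
    | nil =>
      obtain rfl : w = 1 := by simpa using h
      exact tauOne.refl _
    | cons c l ih =>
      rw [List.map_cons, List.prod_cons] at h
      obtain ⟨_, ⟨n, hn, rfl⟩, w', hw', rfl⟩ := h
      exact tauOne.mul (tauOne_letter_pow c hn) (ih hw')

theorem conClass_tauOne_ab {a b : ℕ} (hab : a ≠ b) :
    conClass tauOne (letter a * letter b) = plus a * plus b := by
  have hmem (w : Word) := tauOne_iff_mem_prod_plus (l := [a, b]) (w := w) (by simpa using hab)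
  exact Set.ext (by simpa [conClass] using hmem)

theorem letter_mul_plus (x : ℕ) :
    ({letter x} * plus x : Set Word) = {w | ∃ n, 2 ≤ n ∧ w = letter x ^ n} := by
  ext w
  simp only [plus, Set.mem_mul, Set.mem_ofPred_eq, Set.mem_singleton_iff]
  constructor
  · rintro ⟨_, rfl, _, ⟨n, hn, rfl⟩, rfl⟩
    exact ⟨n + 1, by omega, (pow_succ' _ n).symm⟩
  · rintro ⟨n, hn, rfl⟩
    obtain ⟨m, rfl⟩ := Nat.exists_eq_add_of_le' hn
    exact ⟨_, rfl, _, ⟨m + 1, by omega, rfl⟩, (pow_succ' _ (m + 1)).symm⟩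

theorem mem_languageA_iff {a b t : ℕ} {w : Word} :
    w ∈ (plus a * {letter b} * plus b * {letter t} * plus a : Set Word) ↔
      ∃ i j k, 1 ≤ i ∧ 2 ≤ j ∧ 1 ≤ k ∧
        w = letter a ^ i * (letter b ^ j * (letter t * letter a ^ k)) := by
  simp only [mul_assoc]
  rw [← mul_assoc {letter b}, letter_mul_plus]
  simp only [plus, Set.mem_mul, Set.mem_ofPred_eq, Set.mem_singleton_iff]
  constructor
  · rintro ⟨_, ⟨i, hi, rfl⟩, _, ⟨_, ⟨j, hj, rfl⟩, _, ⟨_, rfl, _, ⟨k, hk, rfl⟩, rfl⟩, rfl⟩, rfl⟩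
    exact ⟨i, j, k, hi, hj, hk, rfl⟩
  · rintro ⟨i, j, k, hi, hj, hk, rfl⟩
    exact ⟨_, ⟨i, hi, rfl⟩, _, ⟨_, ⟨j, hj, rfl⟩, _, ⟨_, rfl, _, ⟨k, hk, rfl⟩, rfl⟩, rfl⟩, rfl⟩

/-- The words `atbaⁱsbʲ` with `i, j ≥ 1`. -/
def LangJ (a b t s : ℕ) (l : List ℕ) : Prop :=
  ∃ i j, l = a :: t :: b :: (List.replicate (i + 1) a ++ s :: List.replicate (j + 1) b)

/-- The words `atbⁱaʲ` with `i ≥ 2` and `j ≥ 1`. -/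
def LangK (a b t : ℕ) (l : List ℕ) : Prop :=
  ∃ i j, l = a :: t :: (List.replicate (i + 2) b ++ List.replicate (j + 1) a)

theorem mem_languageJ_iff {a b t s : ℕ} {w : Word} :
    w ∈ ({letter a} * {letter t} * {letter b} * plus a * {letter s} * plus b : Set Word) ↔
      LangJ a b t s w.toList := by
  simp only [mul_assoc, plus, Set.mem_mul, Set.mem_ofPred_eq, Set.mem_singleton_iff]
  constructor
  · rintro ⟨_, rfl, _, ⟨_, rfl, _, ⟨_, rfl, _, ⟨_, ⟨i, hi, rfl⟩, _, ⟨_, rfl, _, ⟨j, hj, rfl⟩,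
      rfl⟩, rfl⟩, rfl⟩, rfl⟩, rfl⟩
    obtain ⟨i, rfl⟩ := Nat.exists_eq_add_of_le' hi
    obtain ⟨j, rfl⟩ := Nat.exists_eq_add_of_le' hj
    exact ⟨i, j, by simp [toList_letter_pow]⟩
  · rintro ⟨i, j, h⟩
    exact ⟨_, rfl, _, ⟨_, rfl, _, ⟨_, rfl, _, ⟨_, ⟨i + 1, by omega, rfl⟩, _, ⟨_, rfl, _,
      ⟨j + 1, by omega, rfl⟩, rfl⟩, rfl⟩, rfl⟩, rfl⟩,
      FreeMonoid.toList.injective (by simp [h, toList_letter_pow])⟩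

theorem mem_languageK_iff {a b t : ℕ} {w : Word} :
    w ∈ ({letter a} * {letter t} * {letter b} * plus b * plus a : Set Word) ↔
      LangK a b t w.toList := by
  simp only [mul_assoc]
  rw [← mul_assoc {letter b}, letter_mul_plus]
  simp only [plus, Set.mem_mul, Set.mem_ofPred_eq, Set.mem_singleton_iff]
  constructor
  · rintro ⟨_, rfl, _, ⟨_, rfl, _, ⟨_, ⟨i, hi, rfl⟩, _, ⟨j, hj, rfl⟩, rfl⟩, rfl⟩, rfl⟩
    obtain ⟨i, rfl⟩ := Nat.exists_eq_add_of_le' hi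
    obtain ⟨j, rfl⟩ := Nat.exists_eq_add_of_le' hj
    exact ⟨i, j, by simp [toList_letter_pow]⟩
  · rintro ⟨i, j, h⟩
    exact ⟨_, rfl, _, ⟨_, rfl, _, ⟨_, ⟨i + 2, by omega, rfl⟩, _, ⟨j + 1, by omega, rfl⟩, rfl⟩,
      rfl⟩, FreeMonoid.toList.injective (by simp [h, toList_letter_pow])⟩

theorem conClass_languageA {a b t : ℕ} (hd : [a, b, t].Nodup) :
    conClass (tauOne ⊓ gammaCon) (letter a * letter b ^ 2 * letter t * letter a) =
      plus a * {letter b} * plus b * {letter t} * plus a := by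
  obtain ⟨⟨hab, hat⟩, hbt⟩ : (a ≠ b ∧ a ≠ t) ∧ b ≠ t := by simpa using hd
  have hchain : [a, b, t, a].IsChain (· ≠ ·) := by simp [hab, hbt, hat.symm]
  have hbase : tauOne (letter a * letter b ^ 2 * letter t * letter a)
      (FreeMonoid.ofList [a, b, t, a]) :=
    tauOne.mul (tauOne.mul (tauOne.mul (tauOne.refl _) (tauOne_letter_pow b one_le_two))
      (tauOne.refl _)) (tauOne.refl _)
  ext w
  rw [mem_languageA_iff]
  constructor
  · rintro ⟨hτ, hγ⟩
    obtain ⟨_, ⟨i, hi, rfl⟩, _, ⟨_, ⟨j, -, rfl⟩, _, ⟨_, ⟨n, hn, rfl⟩, _, ⟨_, ⟨k, hk, rfl⟩, _, rfl,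
      rfl⟩, rfl⟩, rfl⟩, rfl⟩ := (tauOne_iff_mem_prod_plus hchain).1 (tauOne.trans hτ hbase)
    have hb := min_count_two_of_gammaCon hγ b
    have ht := min_count_two_of_gammaCon hγ t
    simp [toList_letter_pow, List.count_replicate, hab, hat, hbt, hab.symm, hat.symm, hbt.symm]
      at hb ht
    obtain rfl : n = 1 := by omega
    exact ⟨i, j, k, hi, by omega, hk, by simp⟩
  · rintro ⟨i, j, k, hi, hj, hk, rfl⟩
    refine ⟨tauOne.trans ((tauOne_iff_mem_prod_plus hchain).2 ?_) (tauOne.symm hbase),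
      gammaCon_of_min_count_two fun x => ?_⟩
    · exact Set.mul_mem_mul ⟨i, hi, rfl⟩ (Set.mul_mem_mul ⟨j, one_le_two.trans hj, rfl⟩
        (Set.mul_mem_mul ⟨1, le_rfl, (pow_one _).symm⟩ ⟨_, ⟨k, hk, rfl⟩, 1, rfl, mul_one _⟩))
    · simp only [FreeMonoid.toList_mul, toList_letter_pow, FreeMonoid.toList_of,
        List.count_append, List.count_replicate, List.count_singleton]
      split_ifs <;> omega

theorem eq_one_of_take_two_replicate_append {α : Type*} {x y : α} (hxy : x ≠ y) {n : ℕ}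
    {l : List α} (hn : 1 ≤ n) (h : (List.replicate n x ++ l).take 2 = [x, y]) : n = 1 := by
  obtain ⟨n, rfl⟩ := Nat.exists_eq_add_of_le' hn
  cases n with
  | zero => rfl
  | succ n => simp [List.replicate_succ, hxy] at h

theorem langJ_of_zetaCon {a b t s : ℕ} (hd : [a, b, t, s].Nodup) {w : Word}
    (hw : w ∈ ([a, t, b, a, s, b].map plus).prod)
    (h : zetaCon w (letter a * letter t * letter b * letter a * letter s * letter b)) :
    LangJ a b t s w.toList := by
  obtain ⟨⟨hab, hat, has⟩, ⟨hbt, hbs⟩, hts⟩ :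
      (a ≠ b ∧ a ≠ t ∧ a ≠ s) ∧ (b ≠ t ∧ b ≠ s) ∧ t ≠ s := by simpa using hd
  obtain ⟨_, ⟨i, hi, rfl⟩, _, ⟨_, ⟨n, hn, rfl⟩, _, ⟨_, ⟨j, hj, rfl⟩, _, ⟨_, ⟨k, hk, rfl⟩, _, ⟨_,
    ⟨m, hm, rfl⟩, _, ⟨_, ⟨l, hl, rfl⟩, _, rfl, rfl⟩, rfl⟩, rfl⟩, rfl⟩, rfl⟩, rfl⟩ := hw
  have ht := min_count_two_of_zetaCon h t
  have hs := min_count_two_of_zetaCon h s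
  have hfa : (List.replicate i a ++ (List.replicate n t ++ List.replicate k a)).take 2 =
      [a, t] := by
    simpa [toList_letter_pow, hab, hab.symm, hat, has.symm, hbt, hts.symm] using
      take_two_filter_of_zetaCon (fun x => x == a || x == t) h
  have hfb : (List.replicate j b ++ (List.replicate m s ++ List.replicate l b)).take 2 =
      [b, s] := by
    simpa [toList_letter_pow, hab, hab.symm, has, hbt, hbt.symm, hbs, hts] using
      take_two_filter_of_zetaCon (fun x => x == b || x == s) h
  simp [toList_letter_pow, List.count_replicate, hat, has, hbt, hbs, hts, hts.symm] at ht hs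
  obtain rfl : i = 1 := eq_one_of_take_two_replicate_append hat hi hfa
  obtain rfl : j = 1 := eq_one_of_take_two_replicate_append hbs hj hfb
  obtain rfl : n = 1 := by omega
  obtain rfl : m = 1 := by omega
  obtain ⟨k, rfl⟩ := Nat.exists_eq_add_of_le' hk
  obtain ⟨l, rfl⟩ := Nat.exists_eq_add_of_le' hl
  exact ⟨k, l, by simp [toList_letter_pow]⟩

theorem langK_of_zetaCon {a b t : ℕ} (hd : [a, b, t].Nodup) {w : Word}
    (hw : w ∈ ([a, t, b, a].map plus).prod)
    (h : zetaCon w (letter a * letter t * letter b ^ 2 * letter a)) : LangK a b t w.toList := by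
  obtain ⟨⟨hab, hat⟩, hbt⟩ : (a ≠ b ∧ a ≠ t) ∧ b ≠ t := by simpa using hd
  obtain ⟨_, ⟨i, hi, rfl⟩, _, ⟨_, ⟨n, hn, rfl⟩, _, ⟨_, ⟨j, hj, rfl⟩, _, ⟨_, ⟨k, hk, rfl⟩, _, rfl,
    rfl⟩, rfl⟩, rfl⟩, rfl⟩ := hw
  have ht := min_count_two_of_zetaCon h t
  have hb := min_count_two_of_zetaCon h b
  have hfa : (List.replicate i a ++ (List.replicate n t ++ List.replicate k a)).take 2 =
      [a, t] := by
    simpa [toList_letter_pow, hab, hab.symm, hat, hbt] using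
      take_two_filter_of_zetaCon (fun x => x == a || x == t) h
  simp [toList_letter_pow, List.count_replicate, hab, hat, hbt, hbt.symm] at ht hb
  obtain rfl : i = 1 := eq_one_of_take_two_replicate_append hat hi hfa
  obtain rfl : n = 1 := by omega
  obtain ⟨j, rfl⟩ := Nat.exists_eq_add_of_le' (show 2 ≤ j by omega)
  obtain ⟨k, rfl⟩ := Nat.exists_eq_add_of_le' hk
  exact ⟨j, k, by simp [toList_letter_pow]⟩

theorem conClass_languageJ {a b t s : ℕ} (hd : [a, b, t, s].Nodup) :
    conClass (tauOne ⊓ zetaCon)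
        (letter a * letter t * letter b * letter a * letter s * letter b) =
      {letter a} * {letter t} * {letter b} * plus a * {letter s} * plus b := by
  have hchain : [a, t, b, a, s, b].IsChain (· ≠ ·) := by
    simp only [List.nodup_cons, List.mem_cons] at hd
    simp
    grind
  ext w
  constructor
  · rintro ⟨hτ, hζ⟩
    exact mem_languageJ_iff.2 (langJ_of_zetaCon hd ((tauOne_iff_mem_prod_plus hchain).1 hτ) hζ)
  · simp only [plus, Set.mem_mul, Set.mem_singleton_iff]
    rintro ⟨_, ⟨_, ⟨_, ⟨_, ⟨_, rfl, _, rfl, rfl⟩, _, rfl, rfl⟩, _, ⟨i, hi, rfl⟩, rfl⟩, _, rfl,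
      rfl⟩, _, ⟨j, hj, rfl⟩, rfl⟩
    refine ⟨?_, ?_⟩
    · exact tauOne.mul (tauOne.mul (tauOne.mul (tauOne.refl _) (tauOne_letter_pow a hi))
        (tauOne.refl _)) (tauOne_letter_pow b hj)
    · have hb := zetaCon.mul (zetaCon.refl (letter a * letter t))
        (zetaCon_last_pow (letter b) (letter a ^ i * letter s) hj)
      have ha := zetaCon.mul (zetaCon_last_pow (letter a) (letter t * letter b) hi)
        (zetaCon.refl (letter s * letter b))
      simp only [mul_assoc] at ha hb ⊢
      exact zetaCon.trans hb ha

theorem conClass_languageK {a b t : ℕ} (hd : [a, b, t].Nodup) :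
    conClass (tauOne ⊓ zetaCon) (letter a * letter t * letter b ^ 2 * letter a) =
      {letter a} * {letter t} * {letter b} * plus b * plus a := by
  have hbase : tauOne (letter a * letter t * letter b ^ 2 * letter a)
      (FreeMonoid.ofList [a, t, b, a]) :=
    tauOne.mul (tauOne.mul (tauOne.refl _) (tauOne_letter_pow b one_le_two)) (tauOne.refl _)
  have hchain : [a, t, b, a].IsChain (· ≠ ·) := by
    simp only [List.nodup_cons, List.mem_cons] at hd
    simp
    grind
  ext w
  constructor
  · rintro ⟨hτ, hζ⟩
    exact mem_languageK_iff.2 (langK_of_zetaCon hd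
      ((tauOne_iff_mem_prod_plus hchain).1 (tauOne.trans hτ hbase)) hζ)
  · simp only [plus, Set.mem_mul, Set.mem_singleton_iff]
    rintro ⟨_, ⟨_, ⟨_, ⟨_, rfl, _, rfl, rfl⟩, _, rfl, rfl⟩, _, ⟨i, hi, rfl⟩, rfl⟩, _,
      ⟨j, hj, rfl⟩, rfl⟩
    refine ⟨tauOne.trans ?_ (tauOne.symm hbase), ?_⟩
    · have hb : tauOne (letter b * letter b ^ i) (letter b) := by
        simpa only [pow_succ'] using tauOne_letter_pow b (Nat.le_add_left 1 i)
      have hw := tauOne.mul (tauOne.mul (tauOne.refl (letter a * letter t)) hb)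
        (tauOne_letter_pow a hj)
      simp only [mul_assoc] at hw ⊢
      exact hw
    · have ha := zetaCon_last_pow (letter a) (letter t * letter b * letter b ^ i) hj
      have hb := zetaCon.mul (zetaCon.mul (zetaCon.refl (letter a * letter t))
        (zetaCon_last_pow (letter b) 1 hi)) (zetaCon.refl (letter a))
      simp only [mul_assoc, mul_one, pow_two] at ha hb ⊢
      exact zetaCon.trans ha hb

/-! ### The monoids `A₀¹` and `A¹` -/

theorem tauOne_pow_congr (x : ℕ) {k l : ℕ} (h : k = 0 ↔ l = 0) :
    tauOne (letter x ^ k) (letter x ^ l) := by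
  rcases k.eq_zero_or_pos with rfl | hk
  · rw [h.1 rfl]
    exact tauOne.refl _
  · have hl : 1 ≤ l := by omega
    exact tauOne.trans (tauOne_letter_pow x hk) (tauOne.symm (tauOne_letter_pow x hl))

theorem mem_iff_of_satisfies {M : Type*} [Monoid M] {m : M} (hm : IsIdempotentElem m)
    (hm1 : m ≠ 1) {u v : Word} (h : Satisfies M (u, v)) (x : ℕ) :
    x ∈ u.toList ↔ x ∈ v.toList := by
  have hval (w : Word) : FreeMonoid.lift (fun i => if i = x then m else 1) w =
      if x ∈ w.toList then m else 1 := by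
    induction w using FreeMonoid.inductionOn' with
    | one => rfl
    | of_mul y w ih =>
      rw [map_mul, ih, FreeMonoid.lift_eval_of, FreeMonoid.toList_of_mul]
      by_cases hy : y = x <;> by_cases hw : x ∈ w.toList <;> simp [hy, hw, hm.eq, eq_comm (a := x)]
  have hxm := h (FreeMonoid.lift fun i => if i = x then m else 1)
  rw [hval, hval] at hxm
  split_ifs at hxm <;> simp_all

theorem eq_zero_iff_of_pow_mul_eq {M : Type*} [Monoid M] {e c : M} (he : IsIdempotentElem e)
    (hec : e * c ≠ c) {i j : ℕ} (h : e ^ i * c = e ^ j * c) : i = 0 ↔ j = 0 := by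
  cases i <;> cases j <;> simp_all [he.pow_succ_eq, eq_comm (a := c)]

theorem eq_zero_iff_of_mul_pow_eq {M : Type*} [Monoid M] {e c : M} (he : IsIdempotentElem e)
    (hce : c * e ≠ c) {i j : ℕ} (h : c * e ^ i = c * e ^ j) : i = 0 ↔ j = 0 := by
  cases i <;> cases j <;> simp_all [he.pow_succ_eq, eq_comm (a := c)]

namespace SemigroupA0

instance : DecidableEq SemigroupA0 := fun x y => by
  cases x <;> cases y <;> first | exact isTrue rfl | exact isFalse nofun

instance : Fintype SemigroupA0 := ⟨{a, b, ba, zero}, by rintro ⟨⟩ <;> decide⟩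

end SemigroupA0

namespace SemigroupA

instance : DecidableEq SemigroupA := fun x y => by
  cases x <;> cases y <;> first | exact isTrue rfl | exact isFalse nofun

instance : Fintype SemigroupA := ⟨{a, b, c, ba, bc, zero}, by rintro ⟨⟩ <;> decide⟩

end SemigroupA

instance (S : Type) [DecidableEq S] : DecidableEq (WithOne S) :=
  inferInstanceAs (DecidableEq (Option S))

instance (S : Type) [Fintype S] : Fintype (WithOne S) := inferInstanceAs (Fintype (Option S))

theorem isDisjunctive_singleton_ba :
    IsDisjunctive ({↑SemigroupA0.ba} : Set (WithOne SemigroupA0)) := by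
  simp only [IsDisjunctive, Set.mem_singleton_iff]
  decide

set_option maxRecDepth 10000 in
theorem isDisjunctive_singleton_bc :
    IsDisjunctive ({↑SemigroupA.bc} : Set (WithOne SemigroupA)) := by
  simp only [IsDisjunctive, Set.mem_singleton_iff]
  decide

/-- The homomorphism onto `A₀¹` that sends `a` and `b` to the generators `b` and `a`, in this order
since `ba` is the nonzero product of the generators. -/
def evalA0 (a b : ℕ) : Word →* WithOne SemigroupA0 :=
  FreeMonoid.lift fun i =>
    if i = a then ↑SemigroupA0.b else if i = b then ↑SemigroupA0.a else ↑SemigroupA0.zero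

section EvalA0

variable {a b : ℕ}

theorem evalA0_letter_left : evalA0 a b (letter a) = ↑SemigroupA0.b := by simp [evalA0]

theorem evalA0_letter_right (hab : a ≠ b) : evalA0 a b (letter b) = ↑SemigroupA0.a := by
  simp [evalA0, hab.symm]

theorem surjective_evalA0 (hab : a ≠ b) : Function.Surjective (evalA0 a b) := by
  have ha := evalA0_letter_left (a := a) (b := b)
  have hb := evalA0_letter_right hab
  intro m
  induction m using WithOne.recOneCoe with
  | one => exact ⟨1, map_one _⟩
  | coe m =>
    cases m with
    | a => exact ⟨_, hb⟩
    | b => exact ⟨_, ha⟩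
    | ba => exact ⟨letter a * letter b, by rw [map_mul, ha, hb]; rfl⟩
    | zero => exact ⟨letter b * letter a, by rw [map_mul, ha, hb]; rfl⟩

theorem evalA0_ne_zero_of_mul {p u s : Word} (h : evalA0 a b (p * u * s) ≠ ↑SemigroupA0.zero) :
    evalA0 a b u ≠ ↑SemigroupA0.zero := by
  have habsorb : ∀ m n : WithOne SemigroupA0, m * ↑SemigroupA0.zero * n = ↑SemigroupA0.zero := by
    decide
  intro hu
  exact h (by rw [map_mul, map_mul, hu, habsorb])

theorem exists_pow_mul_pow_of_evalA0_ne_zero (hab : a ≠ b) {w : Word}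
    (hw : evalA0 a b w ≠ ↑SemigroupA0.zero) : ∃ i j : ℕ, w = letter a ^ i * letter b ^ j := by
  have hzero : ∀ m : WithOne SemigroupA0, ↑SemigroupA0.zero * m = ↑SemigroupA0.zero := by decide
  have hba : ∀ m : WithOne SemigroupA0,
      ↑SemigroupA0.a * (↑SemigroupA0.b * m) = ↑SemigroupA0.zero := by decide
  induction w using FreeMonoid.inductionOn' with
  | one => exact ⟨0, 0, rfl⟩
  | of_mul x w ih =>
    obtain ⟨i, j, rfl⟩ := ih (evalA0_ne_zero_of_mul (p := letter x) (s := 1) (by rwa [mul_one]))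
    by_cases hxa : x = a
    · exact ⟨i + 1, j, by rw [hxa, pow_succ', mul_assoc]⟩
    by_cases hxb : x = b
    · cases i with
      | zero => exact ⟨0, j + 1, by simp [hxb, pow_succ']⟩
      | succ i =>
        refine (hw ?_).elim
        simp only [hxb, pow_succ' _ i, map_mul, mul_assoc, evalA0_letter_left,
          evalA0_letter_right hab, hba]
    · refine (hw ?_).elim
      rw [map_mul, evalA0, FreeMonoid.lift_eval_of, if_neg hxa, if_neg hxb, hzero]

theorem evalA0_eq_ba_iff (hab : a ≠ b) {w : Word} :
    evalA0 a b w = ↑SemigroupA0.ba ↔ w ∈ plus a * plus b := by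
  have ha : IsIdempotentElem (SemigroupA0.a : WithOne SemigroupA0) := rfl
  have hb : IsIdempotentElem (SemigroupA0.b : WithOne SemigroupA0) := rfl
  have hval (i j : ℕ) : evalA0 a b (letter a ^ i * letter b ^ j) =
      ↑SemigroupA0.b ^ i * ↑SemigroupA0.a ^ j := by
    rw [map_mul, map_pow, map_pow, evalA0_letter_left, evalA0_letter_right hab]
  constructor
  · intro h
    obtain ⟨i, j, rfl⟩ := exists_pow_mul_pow_of_evalA0_ne_zero hab (w := w) (by rw [h]; decide)
    rw [hval] at h
    refine Set.mul_mem_mul ⟨i, Nat.one_le_iff_ne_zero.2 ?_, rfl⟩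
      ⟨j, Nat.one_le_iff_ne_zero.2 ?_, rfl⟩ <;> rintro rfl
    · cases j <;> simp only [ha.pow_succ_eq, pow_zero] at h <;> exact absurd h (by decide)
    · cases i <;> simp only [hb.pow_succ_eq, pow_zero] at h <;> exact absurd h (by decide)
  · rintro ⟨_, ⟨i, hi, rfl⟩, _, ⟨j, hj, rfl⟩, rfl⟩
    obtain ⟨i, rfl⟩ := Nat.exists_eq_add_of_le' hi
    obtain ⟨j, rfl⟩ := Nat.exists_eq_add_of_le' hj
    exact (hval _ _).trans (by rw [ha.pow_succ_eq, hb.pow_succ_eq]; rfl)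

theorem tauOne_of_satisfies_A0 (hab : a ≠ b) {u v p s : Word}
    (h : Satisfies (WithOne SemigroupA0) (u, v)) (hu : p * u * s ∈ plus a * plus b) :
    tauOne u v := by
  have hu0 : evalA0 a b u ≠ ↑SemigroupA0.zero :=
    evalA0_ne_zero_of_mul (by rw [(evalA0_eq_ba_iff hab).2 hu]; decide)
  have hv0 : evalA0 a b v ≠ ↑SemigroupA0.zero := fun hv => hu0 ((h _).trans hv)
  have hcontent := mem_iff_of_satisfies (m := (SemigroupA0.a : WithOne SemigroupA0)) rfl
    (by decide) h
  obtain ⟨i, j, rfl⟩ := exists_pow_mul_pow_of_evalA0_ne_zero hab hu0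
  obtain ⟨i', j', rfl⟩ := exists_pow_mul_pow_of_evalA0_ne_zero hab hv0
  have ha := hcontent a
  have hb := hcontent b
  simp [toList_letter_pow, hab, hab.symm] at ha hb
  exact tauOne.mul (tauOne_pow_congr a (by tauto)) (tauOne_pow_congr b (by tauto))

end EvalA0

theorem generatedVariety_A0_eq {a b : ℕ} (hab : a ≠ b) :
    generatedVariety.{w} (WithOne SemigroupA0) =
        generatedVariety.{w} (MTau tauOne (conClass tauOne (letter a * letter b))) ∧
      generatedVariety.{w} (MTau tauOne (conClass tauOne (letter a * letter b))) =
        generatedVariety.{w} (SyntacticMonoid (plus a * plus b)) := by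
  rw [← conClass_tauOne_ab hab]
  refine generatedVariety_eq_MTau_and_syntacticMonoid
    (fun _ => satisfies_MTau_of_satisfies fun u v p s h hu => ?_)
    (fun _ => isDisjunctive_singleton_ba.satisfies (surjective_evalA0 hab) (ψ := MonoidHom.id _)
      fun w => ?_)
  · rw [conClass_tauOne_ab hab] at hu
    exact tauOne_of_satisfies_A0 hab h hu
  · rw [conClass_tauOne_ab hab]
    exact (evalA0_eq_ba_iff hab).symm

/-- The homomorphism onto `A¹` that sends `a`, `b` and `t` to the generators `b`, `a` and `c`, so
that `at` is sent to the nonzero product `bc`. -/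
def evalA (a b t : ℕ) : Word →* WithOne SemigroupA :=
  FreeMonoid.lift fun i =>
    if i = a then ↑SemigroupA.b else if i = b then ↑SemigroupA.a else
      if i = t then ↑SemigroupA.c else ↑SemigroupA.zero

theorem min_count_two_of_satisfies_A {u v : Word} (h : Satisfies (WithOne SemigroupA) (u, v))
    (x : ℕ) : min (u.toList.count x) 2 = min (v.toList.count x) 2 := by
  let c : WithOne SemigroupA := ↑SemigroupA.c
  have hval (w : Word) : FreeMonoid.lift (fun i => if i = x then c else 1) w =
      c ^ w.toList.count x := by
    induction w using FreeMonoid.inductionOn' with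
    | one => rfl
    | of_mul y w ih =>
      rw [map_mul, ih, FreeMonoid.lift_eval_of, FreeMonoid.toList_of_mul, List.count_cons]
      by_cases hy : y = x <;> simp [hy, pow_succ']
  have hinj : ∀ m ∈ Finset.range 3, ∀ n ∈ Finset.range 3, c ^ m = c ^ n → m = n := by decide
  have huv := h (FreeMonoid.lift fun i => if i = x then c else 1)
  rw [hval, hval, pow_eq_pow_min_two rfl, pow_eq_pow_min_two rfl (v.toList.count x)] at huv
  exact hinj _ (by simp) _ (by simp) huv

section EvalA

variable {a b t : ℕ}

theorem evalA_letter_first : evalA a b t (letter a) = ↑SemigroupA.b := by simp [evalA]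

theorem evalA_letter_second (hab : a ≠ b) : evalA a b t (letter b) = ↑SemigroupA.a := by
  simp [evalA, hab.symm]

theorem evalA_letter_third (hat : a ≠ t) (hbt : b ≠ t) :
    evalA a b t (letter t) = ↑SemigroupA.c := by
  simp [evalA, hat.symm, hbt.symm]

theorem surjective_evalA (hab : a ≠ b) (hat : a ≠ t) (hbt : b ≠ t) :
    Function.Surjective (evalA a b t) := by
  have ha := evalA_letter_first (a := a) (b := b) (t := t)
  have hb := evalA_letter_second (t := t) hab
  have ht := evalA_letter_third hat hbt
  intro m
  induction m using WithOne.recOneCoe with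
  | one => exact ⟨1, map_one _⟩
  | coe m =>
    cases m with
    | a => exact ⟨_, hb⟩
    | b => exact ⟨_, ha⟩
    | c => exact ⟨_, ht⟩
    | ba => exact ⟨letter a * letter b, by rw [map_mul, ha, hb]; rfl⟩
    | bc => exact ⟨letter a * letter t, by rw [map_mul, ha, ht]; rfl⟩
    | zero => exact ⟨letter b * letter a, by rw [map_mul, ha, hb]; rfl⟩

theorem evalA_ne_zero_of_mul {p u s : Word} (h : evalA a b t (p * u * s) ≠ ↑SemigroupA.zero) :
    evalA a b t u ≠ ↑SemigroupA.zero := by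
  have habsorb : ∀ m n : WithOne SemigroupA, m * ↑SemigroupA.zero * n = ↑SemigroupA.zero := by
    decide
  intro hu
  exact h (by rw [map_mul, map_mul, hu, habsorb])

theorem exists_pow_of_evalA_eq_one_or_b {w : Word}
    (hw : evalA a b t w = 1 ∨ evalA a b t w = ↑SemigroupA.b) : ∃ k : ℕ, w = letter a ^ k := by
  have hfactor : ∀ m n : WithOne SemigroupA, m * n = 1 ∨ m * n = ↑SemigroupA.b →
      (m = 1 ∨ m = ↑SemigroupA.b) ∧ (n = 1 ∨ n = ↑SemigroupA.b) := by decide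
  induction w using FreeMonoid.inductionOn' with
  | one => exact ⟨0, rfl⟩
  | of_mul x w ih =>
    rw [map_mul] at hw
    obtain ⟨hx, hw⟩ := hfactor _ _ hw
    obtain ⟨k, rfl⟩ := ih hw
    obtain rfl : x = a := by
      by_contra hxa
      rw [evalA, FreeMonoid.lift_eval_of, if_neg hxa] at hx
      split_ifs at hx <;> revert hx <;> decide
    exact ⟨k + 1, (pow_succ' _ k).symm⟩

theorem exists_pow_of_evalA_ne_zero (hab : a ≠ b) (hat : a ≠ t) (hbt : b ≠ t) {w : Word}
    (hw : evalA a b t w ≠ ↑SemigroupA.zero) :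
    (∃ i j : ℕ, w = letter a ^ i * letter b ^ j) ∨
      ∃ i j k : ℕ, w = letter a ^ i * (letter b ^ j * (letter t * letter a ^ k)) := by
  have hzero : ∀ m : WithOne SemigroupA, ↑SemigroupA.zero * m = ↑SemigroupA.zero := by decide
  have hba : ∀ m : WithOne SemigroupA,
      ↑SemigroupA.a * (↑SemigroupA.b * m) = ↑SemigroupA.zero := by decide
  have hc : ∀ m : WithOne SemigroupA, ↑SemigroupA.c * m ≠ ↑SemigroupA.zero →
      m = 1 ∨ m = ↑SemigroupA.b := by decide
  induction w using FreeMonoid.inductionOn' with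
  | one => exact Or.inl ⟨0, 0, rfl⟩
  | of_mul x w ih =>
    by_cases hxt : x = t
    · rw [hxt, map_mul, evalA_letter_third hat hbt] at hw
      obtain ⟨k, rfl⟩ := exists_pow_of_evalA_eq_one_or_b (hc _ hw)
      exact Or.inr ⟨0, 0, k, by rw [hxt, pow_zero, pow_zero, one_mul, one_mul]⟩
    replace ih := ih (evalA_ne_zero_of_mul (p := letter x) (s := 1) (by rwa [mul_one]))
    by_cases hxa : x = a
    · rcases ih with ⟨i, j, rfl⟩ | ⟨i, j, k, rfl⟩
      · exact Or.inl ⟨i + 1, j, by rw [hxa, pow_succ', mul_assoc]⟩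
      · exact Or.inr ⟨i + 1, j, k, by rw [hxa, pow_succ', mul_assoc]⟩
    by_cases hxb : x = b
    · rw [hxb, map_mul, evalA_letter_second hab] at hw
      rcases ih with ⟨i, j, rfl⟩ | ⟨i, j, k, rfl⟩ <;> cases i with
      | zero =>
        simp only [hxb, pow_zero, one_mul, ← mul_assoc, ← pow_succ']
        simp only [mul_assoc]
        first | exact Or.inl ⟨0, j + 1, rfl⟩ | exact Or.inr ⟨0, j + 1, k, rfl⟩
      | succ i =>
        refine (hw ?_).elim
        simp only [pow_succ' _ i, map_mul, mul_assoc, evalA_letter_first, hba]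
    · refine (hw ?_).elim
      rw [map_mul, evalA, FreeMonoid.lift_eval_of, if_neg hxa, if_neg hxb, if_neg hxt, hzero]

theorem evalA_pow_mul_pow (hab : a ≠ b) (i j : ℕ) :
    evalA a b t (letter a ^ i * letter b ^ j) = ↑SemigroupA.b ^ i * ↑SemigroupA.a ^ j := by
  rw [map_mul, map_pow, map_pow, evalA_letter_first, evalA_letter_second hab]

theorem a_pow_mul_c (j : ℕ) :
    (SemigroupA.a : WithOne SemigroupA) ^ j * ↑SemigroupA.c = ↑SemigroupA.c := by
  induction j with
  | zero => rfl
  | succ j ih => rw [pow_succ', mul_assoc, ih]; rfl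

theorem c_mul_b_pow (k : ℕ) :
    (SemigroupA.c : WithOne SemigroupA) * ↑SemigroupA.b ^ k = ↑SemigroupA.c := by
  induction k with
  | zero => rfl
  | succ k ih => rw [pow_succ, ← mul_assoc, ih]; rfl

theorem evalA_pow_mul_pow_mul_letter_mul_pow (hab : a ≠ b) (hat : a ≠ t) (hbt : b ≠ t)
    (i j k : ℕ) : evalA a b t (letter a ^ i * (letter b ^ j * (letter t * letter a ^ k))) =
      ↑SemigroupA.b ^ i * ↑SemigroupA.c := by
  simp only [map_mul, map_pow, evalA_letter_first, evalA_letter_second hab,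
    evalA_letter_third hat hbt, c_mul_b_pow, a_pow_mul_c]

theorem evalA_eq_bc_iff (hab : a ≠ b) (hat : a ≠ t) (hbt : b ≠ t) {w : Word} :
    evalA a b t w = ↑SemigroupA.bc ↔ ∃ i j k : ℕ,
      w = letter a ^ (i + 1) * (letter b ^ j * (letter t * letter a ^ k)) := by
  have ha : IsIdempotentElem (SemigroupA.a : WithOne SemigroupA) := rfl
  have hb : IsIdempotentElem (SemigroupA.b : WithOne SemigroupA) := rfl
  constructor
  · intro h
    rcases exists_pow_of_evalA_ne_zero hab hat hbt (w := w) (by rw [h]; decide) with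
      ⟨i, j, rfl⟩ | ⟨_ | i, j, k, rfl⟩
    · rw [evalA_pow_mul_pow hab] at h
      cases i <;> cases j <;> simp only [ha.pow_succ_eq, hb.pow_succ_eq, pow_zero] at h <;>
        exact absurd h (by decide)
    · rw [evalA_pow_mul_pow_mul_letter_mul_pow hab hat hbt, pow_zero] at h
      exact absurd h (by decide)
    · exact ⟨i, j, k, rfl⟩
  · rintro ⟨i, j, k, rfl⟩
    rw [evalA_pow_mul_pow_mul_letter_mul_pow hab hat hbt, hb.pow_succ_eq]
    rfl

theorem tauOne_of_satisfies_A (hab : a ≠ b) (hat : a ≠ t) (hbt : b ≠ t) {i j k i' j' k' : ℕ}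
    (h : Satisfies (WithOne SemigroupA)
      (letter a ^ i * (letter b ^ j * (letter t * letter a ^ k)),
        letter a ^ i' * (letter b ^ j' * (letter t * letter a ^ k')))) :
    tauOne (letter a ^ i * (letter b ^ j * (letter t * letter a ^ k)))
      (letter a ^ i' * (letter b ^ j' * (letter t * letter a ^ k'))) := by
  have hi : i = 0 ↔ i' = 0 := by
    have hval := h (evalA a b t)
    simp only [evalA_pow_mul_pow_mul_letter_mul_pow hab hat hbt] at hval
    exact eq_zero_iff_of_pow_mul_eq (by rfl) (by decide) hval
  have hj : j = 0 ↔ j' = 0 := by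
    have hb := mem_iff_of_satisfies (m := (SemigroupA.a : WithOne SemigroupA)) rfl (by decide) h b
    simpa [toList_letter_pow, hab.symm, hbt, not_iff_not] using hb
  have hk : k = 0 ↔ k' = 0 := by
    have hval := h (FreeMonoid.lift fun x =>
      if x = a then (SemigroupA.a : WithOne SemigroupA) else if x = t then ↑SemigroupA.c else 1)
    simp only [map_mul, map_pow, FreeMonoid.lift_eval_of, if_true, hat.symm, hab.symm, hbt,
      if_false, one_pow, mul_one, ← mul_assoc, a_pow_mul_c] at hval
    exact eq_zero_iff_of_mul_pow_eq (by rfl) (by decide) hval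
  exact tauOne.mul (tauOne_pow_congr a hi) (tauOne.mul (tauOne_pow_congr b hj)
    (tauOne.mul (tauOne.refl _) (tauOne_pow_congr a hk)))

theorem tauOne_inf_gammaCon_of_satisfies_A (hab : a ≠ b) (hat : a ≠ t) (hbt : b ≠ t)
    {u v p s : Word} (h : Satisfies (WithOne SemigroupA) (u, v))
    (hu : p * u * s ∈ plus a * {letter b} * plus b * {letter t} * plus a) :
    (tauOne ⊓ gammaCon) u v := by
  have hcount := min_count_two_of_satisfies_A h
  refine ⟨?_, gammaCon_of_min_count_two hcount⟩
  have hu0 : evalA a b t u ≠ ↑SemigroupA.zero := by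
    obtain ⟨i, j, k, hi, -, -, hpus⟩ := mem_languageA_iff.1 hu
    obtain ⟨i, rfl⟩ := Nat.exists_eq_add_of_le' hi
    refine evalA_ne_zero_of_mul (p := p) (s := s) ?_
    rw [(evalA_eq_bc_iff hab hat hbt).2 ⟨i, j, k, hpus⟩]
    decide
  have hv0 : evalA a b t v ≠ ↑SemigroupA.zero := fun hv => hu0 ((h _).trans hv)
  have ht := hcount t
  rcases exists_pow_of_evalA_ne_zero hab hat hbt hu0 with ⟨i, j, rfl⟩ | ⟨i, j, k, rfl⟩ <;>
  rcases exists_pow_of_evalA_ne_zero hab hat hbt hv0 with ⟨i', j', rfl⟩ | ⟨i', j', k', rfl⟩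
  · have ha := hcount a
    have hb := hcount b
    simp [toList_letter_pow, List.count_replicate, hab, hab.symm] at ha hb
    exact tauOne.mul (tauOne_pow_congr a (by omega)) (tauOne_pow_congr b (by omega))
  · simp [toList_letter_pow, List.count_replicate, hat, hbt] at ht
  · simp [toList_letter_pow, List.count_replicate, hat, hbt] at ht
  · exact tauOne_of_satisfies_A hab hat hbt h

/-- The substitution `b ↦ b²`, `t ↦ b²ta`. It translates `a⁺b*ta*`, the preimage of `bc` under
`evalA`, into the language `a⁺bb⁺ta⁺`. -/
def substA (a b t : ℕ) : Word →* Word :=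
  FreeMonoid.lift fun i => if i = b then letter b ^ 2 else
    if i = t then letter b ^ 2 * letter t * letter a else letter i

theorem evalA_substA (hab : a ≠ b) (hat : a ≠ t) (hbt : b ≠ t) (w : Word) :
    evalA a b t (substA a b t w) = evalA a b t w := by
  suffices h : (evalA a b t).comp (substA a b t) = evalA a b t from DFunLike.congr_fun h w
  refine FreeMonoid.hom_eq fun x => ?_
  rw [MonoidHom.comp_apply, substA, FreeMonoid.lift_eval_of]
  split_ifs with hxb hxt
  · rw [hxb, map_pow, evalA_letter_second hab]
    rfl
  · rw [hxt, map_mul, map_mul, map_pow, evalA_letter_first, evalA_letter_second hab,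
      evalA_letter_third hat hbt]
    rfl
  · rfl

theorem substA_mem_languageA_iff (hab : a ≠ b) (hat : a ≠ t) (hbt : b ≠ t) {w : Word} :
    substA a b t w ∈ plus a * {letter b} * plus b * {letter t} * plus a ↔
      evalA a b t w = ↑SemigroupA.bc := by
  rw [mem_languageA_iff]
  constructor
  · rintro ⟨i, j, k, hi, -, -, hw⟩
    obtain ⟨i, rfl⟩ := Nat.exists_eq_add_of_le' hi
    rw [← evalA_substA hab hat hbt]
    exact (evalA_eq_bc_iff hab hat hbt).2 ⟨i, j, k, hw⟩
  · intro h
    obtain ⟨i, j, k, rfl⟩ := (evalA_eq_bc_iff hab hat hbt).1 h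
    refine ⟨i + 1, 2 * j + 2, k + 1, by omega, by omega, by omega, ?_⟩
    simp [substA, hab, hat, hbt.symm, pow_add, pow_mul, mul_assoc, (Commute.self_pow _ k).eq]

end EvalA

theorem generatedVariety_A_eq {a b t : ℕ} (hd : [a, b, t].Nodup) :
    generatedVariety.{w} (WithOne SemigroupA) =
        generatedVariety.{w} (MTau (tauOne ⊓ gammaCon)
          (conClass (tauOne ⊓ gammaCon) (letter a * letter b ^ 2 * letter t * letter a))) ∧
      generatedVariety.{w} (MTau (tauOne ⊓ gammaCon)
          (conClass (tauOne ⊓ gammaCon) (letter a * letter b ^ 2 * letter t * letter a))) =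
        generatedVariety.{w}
          (SyntacticMonoid (plus a * {letter b} * plus b * {letter t} * plus a)) := by
  obtain ⟨⟨hab, hat⟩, hbt⟩ : (a ≠ b ∧ a ≠ t) ∧ b ≠ t := by simpa using hd
  rw [← conClass_languageA hd]
  refine generatedVariety_eq_MTau_and_syntacticMonoid
    (fun _ => satisfies_MTau_of_satisfies fun u v p s h hu => ?_)
    (fun _ => isDisjunctive_singleton_bc.satisfies (surjective_evalA hab hat hbt)
      (ψ := substA a b t) fun w => ?_)
  · rw [conClass_languageA hd] at hu
    exact tauOne_inf_gammaCon_of_satisfies_A hab hat hbt h hu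
  · rw [conClass_languageA hd]
    exact substA_mem_languageA_iff hab hat hbt

/-! ### Factors of the languages `atba⁺sb⁺` and `atbb⁺a⁺` -/

theorem exists_split_first_two_of_two_le_count {α : Type*} [DecidableEq α] {k : α} {l : List α}
    (h : 2 ≤ l.count k) : ∃ l₁ l₂ l₃, l = l₁ ++ k :: (l₂ ++ k :: l₃) ∧ k ∉ l₁ ∧ k ∉ l₂ := by
  obtain ⟨l₁, m, rfl, h₁⟩ :=
    List.eq_append_cons_of_mem (List.count_pos_iff.1 (two_pos.trans_le h))
  have hm : k ∈ m := by
    rw [List.count_append, List.count_cons_self, List.count_eq_zero_of_not_mem h₁] at h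
    exact List.count_pos_iff.1 (by omega)
  obtain ⟨l₂, l₃, rfl, h₂⟩ := List.eq_append_cons_of_mem hm
  exact ⟨l₁, l₂, l₃, rfl, h₁, h₂⟩

theorem forall_eq_or_exists_first_change {α : Type*} (x : α) (l : List α) :
    (∀ z ∈ l, z = x) ∨ ∃ l₁ y l₂, x :: l = l₁ ++ x :: y :: l₂ ∧ y ≠ x := by
  induction l with
  | nil => simp
  | cons y l ih =>
    by_cases hy : y = x
    · subst hy
      rcases ih with ih | ⟨l₁, z, l₂, h, hz⟩
      · exact Or.inl (by simpa using ih)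
      · exact Or.inr ⟨y :: l₁, z, l₂, by rw [h]; rfl, hz⟩
    · exact Or.inr ⟨[], y, l, rfl, hy⟩

/-- The word `l` is a power of one of the letters `a` and `b`.  In the languages `atba⁺sb⁺` and
`atbb⁺a⁺` these are the only factors that occur twice without overlap. -/
def IsPower (a b : ℕ) (l : List ℕ) : Prop :=
  ∃ x n, (x = a ∨ x = b) ∧ l = List.replicate n x

theorem isPower_of_forall_adjacent_eq {a b : ℕ} {l : List ℕ} (h : ∀ z ∈ l, z = a ∨ z = b)
    (hl : ∀ l₁ x y l₂, l = l₁ ++ x :: y :: l₂ → x = y) : IsPower a b l := by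
  cases l with
  | nil => exact ⟨a, 0, Or.inl rfl, rfl⟩
  | cons x l =>
    refine ⟨x, l.length + 1, h x List.mem_cons_self, ?_⟩
    rcases forall_eq_or_exists_first_change x l with hx | ⟨l₁, y, l₂, hy, hyx⟩
    · rw [List.replicate_succ, ← List.eq_replicate_of_mem hx]
    · exact absurd (hl _ _ _ _ hy).symm hyx

theorem IsPower.of_append_left {a b : ℕ} {X Y : List ℕ} (h : IsPower a b (X ++ Y)) :
    IsPower a b X := by
  obtain ⟨x, n, hx, h⟩ := h
  exact ⟨x, X.length, hx, (List.append_eq_replicate_iff.1 h).2.1⟩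

theorem IsPower.append_comm {a b : ℕ} {X Y : List ℕ} (h : IsPower a b (X ++ Y)) :
    X ++ Y = Y ++ X := by
  obtain ⟨x, n, -, h⟩ := h
  obtain ⟨-, hX, hY⟩ := List.append_eq_replicate_iff.1 h
  rw [hX, hY, List.replicate_append_replicate, List.replicate_append_replicate, add_comm]

theorem forall_eq_or_eq_of_repeated {a b : ℕ} {p X q r : List ℕ}
    (h : ∀ z, z ≠ a → z ≠ b → (p ++ X ++ q ++ X ++ r).count z ≤ 1) :
    ∀ z ∈ X, z = a ∨ z = b := by
  intro z hz
  by_contra! hzab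
  have hcount := h z hzab.1 hzab.2
  have hpos := List.count_pos_iff.2 hz
  simp only [List.count_append] at hcount
  omega

section LangJ

variable {a b t s : ℕ} {p q r : List ℕ}

theorem LangJ.eq_of_ne_of_adjacent (hd : [a, b, t, s].Nodup) {x y : ℕ}
    (h : LangJ a b t s (p ++ x :: y :: q)) (hx : x = a ∨ x = b) (hy : y = a ∨ y = b)
    (hxy : x ≠ y) : x = b ∧ y = a ∧ p = [a, t] := by
  obtain ⟨⟨-, hat, has⟩, ⟨hbt, hbs⟩, -⟩ :
      (a ≠ b ∧ a ≠ t ∧ a ≠ s) ∧ (b ≠ t ∧ b ≠ s) ∧ t ≠ s := by simpa using hd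
  obtain ⟨i, j, h⟩ := h
  have hchain : List.IsChain (fun x y => x = y ∨ x = s ∨ y = s)
      (List.replicate (i + 1) a ++ s :: List.replicate (j + 1) b) := by
    rw [List.isChain_append, List.isChain_cons]
    refine ⟨List.isChain_replicate_of_rel _ (Or.inl rfl), ⟨fun _ _ => by simp,
      List.isChain_replicate_of_rel _ (Or.inl rfl)⟩, fun x _ y hy => ?_⟩
    exact Or.inr (Or.inr (by simpa using hy.symm))
  rcases p with _ | ⟨p₁, _ | ⟨p₂, _ | ⟨p₃, p⟩⟩⟩
  · grind
  · grind
  · simp_all [List.replicate_succ]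
  · simp only [List.cons_append, List.cons.injEq] at h
    rw [← h.2.2.2, List.isChain_append_cons_cons] at hchain
    grind

theorem LangJ.isPower_or_eq (hd : [a, b, t, s].Nodup) {X : List ℕ} (hX : ∀ z ∈ X, z = a ∨ z = b)
    (h : LangJ a b t s (p ++ X ++ q)) :
    IsPower a b X ∨ p = [a, t] ∧ ∃ n, X = b :: List.replicate n a := by
  rw [or_iff_not_imp_left]
  intro hpow
  obtain ⟨l₁, x, y, l₂, rfl, hxy⟩ : ∃ l₁ x y l₂, X = l₁ ++ x :: y :: l₂ ∧ x ≠ y := by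
    by_contra! hadj
    exact hpow (isPower_of_forall_adjacent_eq hX fun l₁ x y l₂ => hadj l₁ x y l₂)
  obtain ⟨rfl, rfl, hp⟩ := LangJ.eq_of_ne_of_adjacent hd (p := p ++ l₁) (q := l₂ ++ q)
    (by simpa using h) (hX x (by simp)) (hX y (by simp)) hxy
  obtain rfl : l₁ = [] := by
    rcases List.eq_nil_or_concat l₁ with rfl | ⟨l, z, rfl⟩
    · rfl
    · have hz : z = t := by simpa using congrArg List.getLast? hp
      have := hX z (by simp)
      grind
  refine ⟨by simpa using hp, l₂.length + 1, ?_⟩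
  rcases forall_eq_or_exists_first_change y l₂ with hy | ⟨l₃, z, l₄, hz, hzy⟩
  · rw [List.nil_append, List.replicate_succ, ← List.eq_replicate_of_mem hy]
  · have := LangJ.eq_of_ne_of_adjacent hd (p := p ++ x :: l₃) (q := l₄ ++ q) (x := y) (y := z)
      (by simpa [hz] using h) (Or.inl rfl) (hX z (by rw [hz]; simp)) hzy.symm
    exact absurd this.1.symm hxy

theorem LangJ.count_le_one {l : List ℕ} (h : LangJ a b t s l) (hd : [a, b, t, s].Nodup) {z : ℕ}
    (hza : z ≠ a) (hzb : z ≠ b) : l.count z ≤ 1 := by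
  obtain ⟨i, j, rfl⟩ := h
  simp only [List.count_cons, List.count_append, List.count_replicate]
  grind

theorem LangJ.isPower (hd : [a, b, t, s].Nodup) {X : List ℕ}
    (h : LangJ a b t s (p ++ X ++ q ++ X ++ r)) : IsPower a b X := by
  have hX := forall_eq_or_eq_of_repeated fun z hza hzb => h.count_le_one hd hza hzb
  rcases LangJ.isPower_or_eq hd hX h with hpow | ⟨hp, n, rfl⟩
  · exact hpow
  · have hb : b ∈ [a, t] := hp ▸ (by simp)
    grind

theorem LangJ.forall_eq_of_between (hd : [a, b, t, s].Nodup) {x : ℕ} (hx : x = a ∨ x = b)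
    (hp : x ∈ p) (h : LangJ a b t s (p ++ x :: (q ++ x :: r))) : ∀ z ∈ q, z = x := by
  obtain ⟨⟨hab, hat, has⟩, ⟨hbt, hbs⟩, -⟩ :
      (a ≠ b ∧ a ≠ t ∧ a ≠ s) ∧ (b ≠ t ∧ b ≠ s) ∧ t ≠ s := by simpa using hd
  obtain ⟨i, j, h⟩ := h
  have hpair : List.Pairwise (fun y z => (y = b → z = b) ∧ (z = a → y = a))
      (List.replicate (i + 1) a ++ s :: List.replicate (j + 1) b) := by
    simp [List.pairwise_append, List.pairwise_replicate, hab.symm, hbs.symm, has.symm]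
    grind
  rcases p with _ | ⟨p₁, _ | ⟨p₂, _ | ⟨p₃, p⟩⟩⟩
  · simp at hp
  · grind
  · grind
  · simp only [List.cons_append, List.cons.injEq] at h
    rw [← h.2.2.2] at hpair
    simp only [List.pairwise_append, List.pairwise_cons, List.mem_append, List.mem_cons] at hpair
    grind

theorem LangJ.append_comm (hd : [a, b, t, s].Nodup) {X Y : List ℕ} (hX : IsPower a b X)
    (hY : IsPower a b Y) (h : LangJ a b t s (p ++ X ++ q ++ X ++ Y ++ r)) :
    X ++ Y = Y ++ X := by
  obtain ⟨x, m, hx, rfl⟩ := hX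
  obtain ⟨y, n, hy, rfl⟩ := hY
  have hXY : ∀ z ∈ List.replicate m x ++ List.replicate n y, z = a ∨ z = b := by grind
  rcases LangJ.isPower_or_eq hd hXY (p := p ++ List.replicate m x ++ q) (q := r)
    (by simpa using h) with hpow | ⟨hp, k, hk⟩
  · exact hpow.append_comm
  · rcases m with _ | m
    · simp
    · grind

theorem LangJ.append_comm_of_sandwich (hd : [a, b, t, s].Nodup) {X M : List ℕ}
    (hX : IsPower a b X) (hM : ∀ z ∈ M, z = a ∨ z = b)
    (h : LangJ a b t s (p ++ X ++ M ++ X ++ q) ∨ LangJ a b t s (p ++ X ++ X ++ M ++ q)) :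
    X ++ M = M ++ X := by
  obtain ⟨x, _ | n, hx, rfl⟩ := hX
  · simp
  have hXM : ∀ z ∈ List.replicate (n + 1) x ++ M, z = a ∨ z = b := by grind
  rcases h with h | h
  · rcases LangJ.isPower_or_eq hd (X := List.replicate (n + 1) x ++ M ++ List.replicate (n + 1) x)
      (by grind) (by simpa using h) with hpow | ⟨-, k, hk⟩
    · exact hpow.of_append_left.append_comm
    · have hlast := congrArg List.getLast? hk
      grind
  · rcases LangJ.isPower_or_eq hd hXM (p := p ++ List.replicate (n + 1) x) (q := q)
      (by simpa only [List.append_assoc] using h)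
      with hpow | ⟨hp, k, hk⟩
    · exact hpow.append_comm
    · have hmem : x ∈ [a, t] := hp ▸ (by simp)
      grind

end LangJ

section LangK

variable {a b t : ℕ} {p q r : List ℕ}

theorem eq_of_ne_of_adjacent_replicate_append {α : Type*} {a b x y : α} (hxy : x ≠ y) {m n : ℕ}
    {p q : List α} (h : List.replicate m b ++ List.replicate n a = p ++ x :: y :: q) :
    x = b ∧ y = a ∧ (∀ z ∈ q, z = a) ∧ ∃ k, p = List.replicate k b := by
  induction m generalizing p with
  | zero =>
    have ha : ∀ z ∈ p ++ x :: y :: q, z = a := by simp [← h]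
    exact absurd ((ha x (by simp)).trans (ha y (by simp)).symm) hxy
  | succ m ih =>
    rw [List.replicate_succ, List.cons_append] at h
    rcases p with _ | ⟨c, p⟩
    · obtain ⟨hbx, h⟩ := List.cons.inj h
      rcases m with _ | m
      · rw [List.replicate_zero, List.nil_append] at h
        have ha : ∀ z ∈ y :: q, z = a := by simp [← h]
        exact ⟨hbx.symm, ha y (by simp), fun z hz => ha z (by simp [hz]), 0, rfl⟩
      · exact absurd (hbx.symm.trans (List.cons.inj h).1) hxy
    · rw [List.cons_append, List.cons.injEq] at h
      obtain ⟨rfl, h⟩ := h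
      obtain ⟨hx, hy, hq, k, rfl⟩ := ih h
      exact ⟨hx, hy, hq, k + 1, rfl⟩

theorem LangK.eq_of_ne_of_adjacent (hd : [a, b, t].Nodup) {x y : ℕ}
    (h : LangK a b t (p ++ x :: y :: q)) (hx : x = a ∨ x = b) (hy : y = a ∨ y = b)
    (hxy : x ≠ y) : x = b ∧ y = a ∧ b ∉ q ∧ ∃ n, p = a :: t :: List.replicate n b := by
  obtain ⟨i, j, h⟩ := h
  rcases p with _ | ⟨p₁, _ | ⟨p₂, p⟩⟩
  · grind
  · grind
  · simp only [List.cons_append, List.cons.injEq] at h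
    obtain ⟨rfl, rfl, hq, k, rfl⟩ := eq_of_ne_of_adjacent_replicate_append hxy h.2.2.symm
    exact ⟨rfl, rfl, fun hb => hxy (hq x hb), k, by rw [h.1, h.2.1]⟩

theorem LangK.count_le_one {l : List ℕ} (h : LangK a b t l) {z : ℕ}
    (hza : z ≠ a) (hzb : z ≠ b) : l.count z ≤ 1 := by
  obtain ⟨i, j, rfl⟩ := h
  simp only [List.count_cons, List.count_append, List.count_replicate]
  grind

theorem LangK.isPower (hd : [a, b, t].Nodup) {X : List ℕ}
    (h : LangK a b t (p ++ X ++ q ++ X ++ r)) : IsPower a b X := by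
  have hX := forall_eq_or_eq_of_repeated fun z hza hzb => h.count_le_one hza hzb
  refine isPower_of_forall_adjacent_eq hX ?_
  rintro l₁ x y l₂ rfl
  by_contra hxy
  obtain ⟨rfl, -, hx, -⟩ := LangK.eq_of_ne_of_adjacent hd (p := p ++ l₁)
    (q := l₂ ++ q ++ (l₁ ++ x :: y :: l₂) ++ r) (by simpa using h) (hX x (by simp))
    (hX y (by simp)) hxy
  simp at hx

theorem LangK.forall_eq_of_between (hd : [a, b, t].Nodup) {x : ℕ} (hx : x = a ∨ x = b)
    (hp : x ∈ p) (h : LangK a b t (p ++ x :: (q ++ x :: r))) : ∀ z ∈ q, z = x := by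
  obtain ⟨hab, -⟩ : a ≠ b ∧ a ∉ [t] := by grind
  obtain ⟨i, j, h⟩ := h
  have hpair : List.Pairwise (fun y z => (y = a → z = a) ∧ (z = b → y = b))
      (List.replicate (i + 2) b ++ List.replicate (j + 1) a) := by
    simp [List.pairwise_append, List.pairwise_replicate, hab, hab.symm]
  rcases p with _ | ⟨p₁, _ | ⟨p₂, p⟩⟩
  · simp at hp
  · grind
  · simp only [List.cons_append, List.cons.injEq] at h
    rw [← h.2.2] at hpair
    simp only [List.pairwise_append, List.pairwise_cons, List.mem_append, List.mem_cons] at hpair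
    grind

theorem LangK.append_comm (hd : [a, b, t].Nodup) {X Y : List ℕ}
    (hX : IsPower a b X) (hY : IsPower a b Y) (h : LangK a b t (p ++ X ++ Y ++ q))
    (hpq : (∃ q₁ q₂, q = q₁ ++ X ++ q₂) ∨ (∃ p₁ p₂ p₃, p = p₁ ++ X ++ p₂ ++ Y ++ p₃) ∨
      ∃ p₁ p₂ p₃, (∀ z ∈ p₂, z = a ∨ z = b) ∧ p = p₁ ++ Y ++ p₂ ++ X ++ p₃) :
    X ++ Y = Y ++ X := by
  obtain ⟨x, _ | m, hx, rfl⟩ := hX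
  · simp
  obtain ⟨y, _ | n, hy, rfl⟩ := hY
  · simp
  by_cases hxy : x = y
  · rw [hxy, List.replicate_append_replicate, List.replicate_append_replicate, add_comm]
  obtain ⟨rfl, rfl, hbq, k, hk⟩ := LangK.eq_of_ne_of_adjacent hd
    (p := p ++ List.replicate m x) (q := List.replicate n y ++ q)
    (by simpa [List.replicate_succ' (n := m), List.replicate_succ (n := n)] using h) hx hy hxy
  exfalso
  rcases hpq with ⟨q₁, q₂, rfl⟩ | ⟨p₁, p₂, p₃, rfl⟩ | ⟨p₁, p₂, p₃, hp₂, rfl⟩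
  · simp at hbq
  · rcases p₁ with _ | ⟨c, p₁⟩
    · exact hxy (List.cons.inj hk).1
    · have hy : y ∈ t :: List.replicate k x := by
        rw [← (List.cons.inj hk).2]
        simp
      grind
  · rcases p₁ with _ | ⟨c, p₁⟩
    · have htail : List.replicate n y ++ p₂ ++ [x] ++ (List.replicate m x ++ p₃ ++
          List.replicate m x) = t :: List.replicate k x := by
        simpa [List.replicate_succ (n := m), List.replicate_succ (n := n)] using hk
      rcases hL : List.replicate n y ++ p₂ ++ [x] with _ | ⟨c, L⟩
      · simp at hL
      · rw [hL] at htail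
        have ht : t ∈ List.replicate n y ++ p₂ ++ [x] := by
          rw [hL, (List.cons.inj htail).1]
          simp
        grind
    · have hy : y ∈ t :: List.replicate k x := by
        rw [← (List.cons.inj hk).2]
        simp
      grind

end LangK

/-! ### The monoids `M_τ(W)` satisfy the identities of `J` and `K` -/

theorem IsPower.exists_eq_pow {a b : ℕ} {X : Word} (h : IsPower a b X.toList) :
    ∃ x n, (x = a ∨ x = b) ∧ X = letter x ^ n := by
  obtain ⟨x, n, hx, h⟩ := h
  exact ⟨x, n, hx, FreeMonoid.toList.injective (by rw [h, toList_letter_pow])⟩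

theorem eq_letter_pow_length {x : ℕ} {Z : Word} (h : ∀ z ∈ Z.toList, z = x) :
    Z = letter x ^ Z.toList.length :=
  FreeMonoid.toList.injective (by rw [toList_letter_pow, ← List.eq_replicate_of_mem h])

theorem tauOne_letter_pow_letter_pow (x : ℕ) {m n : ℕ} (hm : 1 ≤ m) (hn : 1 ≤ n) :
    tauOne (letter x ^ m) (letter x ^ n) :=
  tauOne.trans (tauOne_letter_pow x hm) (tauOne.symm (tauOne_letter_pow x hn))

theorem mul_comm_of_toList_append_comm {X Y : Word}
    (h : X.toList ++ Y.toList = Y.toList ++ X.toList) : X * Y = Y * X :=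
  FreeMonoid.toList.injective (by simpa using h)

theorem mem_toList_list_prod {k : ℕ} {l : List Word} :
    k ∈ l.prod.toList ↔ ∃ w ∈ l, k ∈ w.toList := by
  induction l with
  | nil => simp
  | cons => simp

theorem toList_map_eq_flatMap (φ : Word →* Word) (w : Word) :
    (φ w).toList = w.toList.flatMap fun k => (φ (letter k)).toList := by
  induction w using FreeMonoid.inductionOn' with
  | one => simp
  | of_mul x w ih => rw [map_mul, FreeMonoid.toList_mul, ih, FreeMonoid.toList_of_mul]; rfl

theorem forall_eq_or_eq_of_isPower_letters {a b : ℕ} {φ : Word →* Word} {w : Word}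
    (h : ∀ k ∈ w.toList, IsPower a b (φ (letter k)).toList) :
    ∀ z ∈ (φ w).toList, z = a ∨ z = b := by
  intro z hz
  rw [toList_map_eq_flatMap, List.mem_flatMap] at hz
  obtain ⟨k, hk, hz⟩ := hz
  obtain ⟨x, n, hx, h⟩ := h k hk
  rw [h] at hz
  rwa [List.eq_of_mem_replicate hz]

section RepeatedPowers

variable {a b : ℕ} {L : List ℕ → Prop}
  (hpow : ∀ {p X q r : List ℕ}, L (p ++ X ++ q ++ X ++ r) → IsPower a b X)

include hpow

theorem isPower_map_letter_of_two_le_count {φ : Word →* Word} {w p s : Word} {k : ℕ}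
    (hk : 2 ≤ w.toList.count k) (h : L (p * φ w * s).toList) :
    IsPower a b (φ (letter k)).toList := by
  obtain ⟨l₁, l₂, l₃, hl, -, -⟩ := exists_split_first_two_of_two_le_count hk
  rw [FreeMonoid.toList_mul, FreeMonoid.toList_mul, toList_map_eq_flatMap, hl] at h
  refine hpow (p := p.toList ++ l₁.flatMap fun k => (φ (letter k)).toList)
    (q := l₂.flatMap fun k => (φ (letter k)).toList)
    (r := (l₃.flatMap fun k => (φ (letter k)).toList) ++ s.toList) ?_
  simpa using h

theorem tauOne_inf_zetaCon_xyx {X Y p s : Word}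
    (h : L (p * (X * Y * X) * s).toList ∨ L (p * (X * Y * X ^ 2) * s).toList) :
    (tauOne ⊓ zetaCon) (X * Y * X) (X * Y * X ^ 2) := by
  have hX : IsPower a b X.toList := by
    rcases h with h | h
    · exact hpow (p := p.toList) (q := Y.toList) (r := s.toList) (by simpa using h)
    · exact hpow (p := p.toList) (q := Y.toList) (r := X.toList ++ s.toList)
        (by simpa [pow_two] using h)
  obtain ⟨x, n, -, rfl⟩ := hX.exists_eq_pow
  refine ⟨tauOne.mul (tauOne.refl _) ?_, ?_⟩
  · rcases n with _ | n
    · simpa using tauOne.refl _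
    · rw [← pow_mul]
      exact tauOne_letter_pow_letter_pow x (by omega) (by omega)
  · simpa [pow_two, mul_assoc] using zetaCon_append_occurrence (letter x ^ n) Y 1

theorem tauOne_xyxztx
    (hbetween : ∀ {p q r : List ℕ} {x : ℕ}, x = a ∨ x = b → x ∈ p →
      L (p ++ x :: (q ++ x :: r)) → ∀ z ∈ q, z = x) {X Y Z T p s : Word}
    (h : L (p * (X * Y * X * Z * T * X) * s).toList ∨
      L (p * (X * Y * X * Z * X * T * X) * s).toList) :
    tauOne (X * Y * X * Z * T * X) (X * Y * X * Z * X * T * X) := by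
  have hX : IsPower a b X.toList := by
    rcases h with h | h
    · exact hpow (p := p.toList) (q := Y.toList) (r := (Z * T * X * s).toList) (by simpa using h)
    · exact hpow (p := p.toList) (q := Y.toList) (r := (Z * X * T * X * s).toList)
        (by simpa using h)
  obtain ⟨x, _ | n, hx, rfl⟩ := hX.exists_eq_pow
  · simpa using tauOne.refl _
  have hZT : ∀ z, z ∈ Z.toList ∨ z ∈ T.toList → z = x := by
    intro z hz
    rcases h with h | h
    · refine hbetween hx (p := p.toList ++ x :: (List.replicate n x ++ Y.toList))
        (q := List.replicate n x ++ Z.toList ++ T.toList) (r := List.replicate n x ++ s.toList)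
        (by simp) ?_ z (by simp; tauto)
      simpa [toList_letter_pow, List.replicate_succ] using h
    · refine hbetween hx (p := p.toList ++ x :: (List.replicate n x ++ Y.toList))
        (q := List.replicate n x ++ Z.toList ++ x :: List.replicate n x ++ T.toList)
        (r := List.replicate n x ++ s.toList) (by simp) ?_ z (by simp; tauto)
      simpa [toList_letter_pow, List.replicate_succ] using h
  rw [eq_letter_pow_length fun z hz => hZT z (Or.inl hz),
    eq_letter_pow_length fun z hz => hZT z (Or.inr hz)]
  simp only [mul_assoc, ← pow_add]
  exact tauOne.mul (tauOne.refl _)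
    (tauOne.mul (tauOne.refl _) (tauOne_letter_pow_letter_pow x (by omega) (by omega)))

theorem tauOne_inf_zetaCon_xyxztx
    (hbetween : ∀ {p q r : List ℕ} {x : ℕ}, x = a ∨ x = b → x ∈ p →
      L (p ++ x :: (q ++ x :: r)) → ∀ z ∈ q, z = x) {X Y Z T p s : Word}
    (h : L (p * (X * Y * X * Z * T * X) * s).toList ∨
      L (p * (X * Y * X * Z * X * T * X) * s).toList) :
    (tauOne ⊓ zetaCon) (X * Y * X * Z * T * X) (X * Y * X * Z * X * T * X) :=
  have hzeta : zetaCon (X * Y * X * Z * T * X) (X * Y * X * Z * X * T * X) := by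
    simpa only [mul_assoc] using
      zetaCon.mul (zetaCon_append_occurrence X Y Z) (zetaCon.refl (T * X))
  ⟨tauOne_xyxztx hpow hbetween h, hzeta⟩

end RepeatedPowers

section LangJ

variable {a b t s : ℕ}

theorem LangJ.isPower_map_letter (hd : [a, b, t, s].Nodup) {φ : Word →* Word} {w p r : Word}
    {k : ℕ} (hk : 2 ≤ w.toList.count k) (h : LangJ a b t s (p * φ w * r).toList) :
    IsPower a b (φ (letter k)).toList :=
  isPower_map_letter_of_two_le_count (LangJ.isPower hd) hk h

theorem LangJ.mul_comm (hd : [a, b, t, s].Nodup) {P X Q Y R : Word} (hX : IsPower a b X.toList)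
    (hY : IsPower a b Y.toList) (h : LangJ a b t s (P * X * Q * X * Y * R).toList) :
    X * Y = Y * X :=
  mul_comm_of_toList_append_comm (LangJ.append_comm hd (p := P.toList) (q := Q.toList)
    (r := R.toList) hX hY (by simpa using h))

theorem LangJ.xzxyxty_eq (hd : [a, b, t, s].Nodup) {X Y Z T p r : Word}
    (hX : IsPower a b X.toList) (hY : IsPower a b Y.toList)
    (h : LangJ a b t s (p * (X * Z * X * Y * X * T * Y) * r).toList ∨
      LangJ a b t s (p * (X * Z * X ^ 2 * Y * T * Y) * r).toList) :
    X * Z * X * Y * X * T * Y = X * Z * X ^ 2 * Y * T * Y := by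
  have hcomm := h.elim
    (fun h => LangJ.mul_comm hd (P := p) (Q := Z) (R := X * T * Y * r) hX hY
      (by simpa only [mul_assoc] using h))
    (fun h => LangJ.mul_comm hd (P := p) (Q := Z * X) (R := T * Y * r) hX hY
      (by simpa only [pow_two, mul_assoc] using h))
  rw [pow_two, mul_assoc (X * Z * X) Y X, ← hcomm]
  simp only [mul_assoc]

theorem LangJ.xyzxy_eq (hd : [a, b, t, s].Nodup) {X Y Z p r : Word}
    (hX : IsPower a b X.toList) (hY : IsPower a b Y.toList)
    (h : LangJ a b t s (p * (X * Y * Z * X * Y) * r).toList ∨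
      LangJ a b t s (p * (Y * X * Z * X * Y) * r).toList) :
    X * Y * Z * X * Y = Y * X * Z * X * Y := by
  have hcomm := h.elim
    (fun h => LangJ.mul_comm hd (P := p) (Q := Y * Z) (R := r) hX hY
      (by simpa only [mul_assoc] using h))
    (fun h => LangJ.mul_comm hd (P := p * Y) (Q := Z) (R := r) hX hY
      (by simpa only [mul_assoc] using h))
  rw [hcomm]

theorem LangJ.xzytxy_eq (hd : [a, b, t, s].Nodup) {X Y Z T p r : Word}
    (hX : IsPower a b X.toList) (hY : IsPower a b Y.toList)
    (h : LangJ a b t s (p * (X * Z * Y * T * X * Y) * r).toList ∨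
      LangJ a b t s (p * (X * Z * Y * T * Y * X) * r).toList) :
    X * Z * Y * T * X * Y = X * Z * Y * T * Y * X := by
  have hcomm := h.elim
    (fun h => LangJ.mul_comm hd (P := p) (Q := Z * Y * T) (R := r) hX hY
      (by simpa only [mul_assoc] using h))
    (fun h => (LangJ.mul_comm hd (P := p * X * Z) (Q := T) (R := r) hY hX
      (by simpa only [mul_assoc] using h)).symm)
  rw [mul_assoc _ X Y, hcomm, ← mul_assoc]

theorem LangJ.map_sandwich_eq (hd : [a, b, t, s].Nodup) {φ : Word →* Word} {A M B p r : Word}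
    {i : ℕ} (hM : ∀ k ∈ M.toList, k ∈ A.toList ∨ k ∈ B.toList)
    (h : LangJ a b t s (p * φ (A * letter i * M * letter i * B) * r).toList ∨
      LangJ a b t s (p * φ (A * letter i ^ 2 * M * B) * r).toList) :
    φ (A * letter i * M * letter i * B) = φ (A * letter i ^ 2 * M * B) := by
  have hX : IsPower a b (φ (letter i)).toList :=
    h.elim (LangJ.isPower_map_letter hd (by simp; omega))
      (LangJ.isPower_map_letter hd (by simp [pow_two]; omega))
  have hφM : ∀ z ∈ (φ M).toList, z = a ∨ z = b := by
    refine forall_eq_or_eq_of_isPower_letters fun k hk => ?_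
    have hkM := List.count_pos_iff.2 hk
    have hkAB : 0 < A.toList.count k ∨ 0 < B.toList.count k := by
      simpa only [List.count_pos_iff] using hM k hk
    refine h.elim (LangJ.isPower_map_letter hd ?_) (LangJ.isPower_map_letter hd ?_) <;>
      · simp only [FreeMonoid.toList_mul, List.count_append]
        omega
  have hcomm := mul_comm_of_toList_append_comm (LangJ.append_comm_of_sandwich hd
    (p := (p * φ A).toList) (q := (φ B * r).toList) hX hφM (h.imp (fun h => by simpa using h)
      (fun h => by simpa [pow_two] using h)))
  simp only [map_mul, pow_two, mul_assoc]
  rw [← mul_assoc (φ M), ← hcomm, mul_assoc]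

theorem exists_factorization_jLeft_jRight (n : ℕ) (π ρ : Equiv.Perm (Fin n)) :
    ∃ A M B : Word, jLeft n π ρ = A * letter 0 * M * letter 0 * B ∧
      jRight n π ρ = A * letter 0 ^ 2 * M * B ∧ ∀ k ∈ M.toList, k ∈ A.toList ∨ k ∈ B.toList := by
  refine ⟨_, _, _, rfl, rfl, fun k hk => ?_⟩
  rw [mem_toList_list_prod] at hk
  obtain ⟨_, hw, hk⟩ := hk
  obtain ⟨i, rfl⟩ := List.mem_ofFn.1 hw
  simp only [FreeMonoid.toList_mul, FreeMonoid.toList_of, List.cons_append, List.nil_append,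
    List.mem_cons, List.not_mem_nil, or_false] at hk
  refine hk.imp ?_ ?_ <;> rintro rfl <;> rw [mem_toList_list_prod]
  · exact ⟨_, List.mem_ofFn.2 ⟨π i, rfl⟩, by simp⟩
  · exact ⟨_, List.mem_ofFn.2 ⟨ρ i, rfl⟩, by simp⟩

theorem identitiesJ_sound (hd : [a, b, t, s].Nodup) {e : Word × Word} (he : e ∈ identitiesJ) :
    Satisfies (MTau (tauOne ⊓ zetaCon) (conClass (tauOne ⊓ zetaCon)
      (letter a * letter t * letter b * letter a * letter s * letter b))) e := by
  apply satisfies_MTau_of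
  rw [conClass_languageJ hd]
  intro φ p r h
  rw [mem_languageJ_iff, mem_languageJ_iff] at h
  have hX (hcount : 2 ≤ e.1.toList.count 0 ∧ 2 ≤ e.2.toList.count 0) :
      IsPower a b (φ (letter 0)).toList :=
    h.elim (LangJ.isPower_map_letter hd hcount.1) (LangJ.isPower_map_letter hd hcount.2)
  have hY (hcount : 2 ≤ e.1.toList.count 1 ∧ 2 ≤ e.2.toList.count 1) :
      IsPower a b (φ (letter 1)).toList :=
    h.elim (LangJ.isPower_map_letter hd hcount.1) (LangJ.isPower_map_letter hd hcount.2)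
  have of_eq : φ e.1 = φ e.2 → (tauOne ⊓ zetaCon) (φ e.1) (φ e.2) := fun h =>
    h ▸ (tauOne ⊓ zetaCon).refl _
  rcases he with (rfl | rfl | rfl | rfl | rfl) | ⟨n, π, ρ, rfl⟩
  · simp only [map_mul, map_pow] at h ⊢
    exact tauOne_inf_zetaCon_xyx (LangJ.isPower hd) h
  · simp only [map_mul] at h ⊢
    exact tauOne_inf_zetaCon_xyxztx (LangJ.isPower hd) (LangJ.forall_eq_of_between hd) h
  · simp only [map_mul, map_pow] at h of_eq ⊢
    exact of_eq (LangJ.xzxyxty_eq hd (hX (by decide)) (hY (by decide)) h)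
  · simp only [map_mul] at h of_eq ⊢
    exact of_eq (LangJ.xyzxy_eq hd (hX (by decide)) (hY (by decide)) h)
  · simp only [map_mul] at h of_eq ⊢
    exact of_eq (LangJ.xzytxy_eq hd (hX (by decide)) (hY (by decide)) h)
  · obtain ⟨A, M, B, hl, hr, hM⟩ := exists_factorization_jLeft_jRight n π ρ
    exact of_eq (by simpa only [hl, hr] using LangJ.map_sandwich_eq hd hM (by rwa [hl, hr] at h))

end LangJ

section LangK

variable {a b t : ℕ}

theorem LangK.isPower_map_letter (hd : [a, b, t].Nodup) {φ : Word →* Word} {w p r : Word}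
    {k : ℕ} (hk : 2 ≤ w.toList.count k) (h : LangK a b t (p * φ w * r).toList) :
    IsPower a b (φ (letter k)).toList :=
  isPower_map_letter_of_two_le_count (LangK.isPower hd) hk h

theorem LangK.mul_comm (hd : [a, b, t].Nodup) {P X Y Q : Word} (hX : IsPower a b X.toList)
    (hY : IsPower a b Y.toList) (h : LangK a b t (P * X * Y * Q).toList)
    (hPQ : (∃ q₁ q₂, Q = q₁ * X * q₂) ∨ (∃ p₁ p₂ p₃, P = p₁ * X * p₂ * Y * p₃) ∨
      ∃ p₁ p₂ p₃, (∀ z ∈ p₂.toList, z = a ∨ z = b) ∧ P = p₁ * Y * p₂ * X * p₃) :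
    X * Y = Y * X := by
  refine mul_comm_of_toList_append_comm (LangK.append_comm hd (p := P.toList) (q := Q.toList)
    hX hY (by simpa using h) ?_)
  rcases hPQ with ⟨q₁, q₂, rfl⟩ | ⟨p₁, p₂, p₃, rfl⟩ | ⟨p₁, p₂, p₃, hp₂, rfl⟩
  · exact Or.inl ⟨q₁.toList, q₂.toList, by simp⟩
  · exact Or.inr (Or.inl ⟨p₁.toList, p₂.toList, p₃.toList, by simp⟩)
  · exact Or.inr (Or.inr ⟨p₁.toList, p₂.toList, p₃.toList, hp₂, by simp⟩)

theorem LangK.xyzxty_eq (hd : [a, b, t].Nodup) {X Y Z T p r : Word}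
    (hX : IsPower a b X.toList) (hY : IsPower a b Y.toList)
    (h : LangK a b t (p * (X * Y * Z * X * T * Y) * r).toList ∨
      LangK a b t (p * (Y * X * Z * X * T * Y) * r).toList) :
    X * Y * Z * X * T * Y = Y * X * Z * X * T * Y := by
  have hcomm := h.elim
    (fun h => LangK.mul_comm hd (P := p) (Q := Z * X * (T * Y * r)) hX hY
      (by simpa only [mul_assoc] using h) (Or.inl ⟨_, _, rfl⟩))
    (fun h => (LangK.mul_comm hd (P := p) (Q := Z * X * T * Y * r) hY hX
      (by simpa only [mul_assoc] using h) (Or.inl ⟨_, _, rfl⟩)).symm)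
  rw [hcomm]

theorem LangK.xzytyxy_eq (hd : [a, b, t].Nodup) {X Y Z T p r : Word}
    (hX : IsPower a b X.toList) (hY : IsPower a b Y.toList)
    (h : LangK a b t (p * (X * Z * Y * T * Y * X * Y) * r).toList ∨
      LangK a b t (p * (X * Z * Y * T * X * Y ^ 2) * r).toList) :
    X * Z * Y * T * Y * X * Y = X * Z * Y * T * X * Y ^ 2 := by
  have hcomm := h.elim
    (fun h => LangK.mul_comm hd (P := p * X * Z * Y * T) (Q := 1 * Y * r) hY hX
      (by simpa only [mul_assoc, one_mul] using h) (Or.inl ⟨_, _, rfl⟩))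
    (fun h => (LangK.mul_comm hd (P := p * X * Z * Y * T) (Q := Y * r) hX hY
      (by simpa only [pow_two, mul_assoc] using h) (Or.inr (Or.inl ⟨_, _, _, rfl⟩))).symm)
  rw [mul_assoc _ Y X, hcomm, pow_two]
  simp only [mul_assoc]

theorem LangK.map_swap_eq (hd : [a, b, t].Nodup) {φ : Word →* Word} {p q r s P R : Word}
    {i j : ℕ} (hq : ∀ k ∈ q.toList,
      2 ≤ (p * letter i * q * letter j * r * letter i * letter j * s).toList.count k)
    (h : LangK a b t
        (P * φ (p * letter i * q * letter j * r * letter i * letter j * s) * R).toList ∨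
      LangK a b t
        (P * φ (p * letter i * q * letter j * r * letter j * letter i * s) * R).toList) :
    φ (p * letter i * q * letter j * r * letter i * letter j * s) =
      φ (p * letter i * q * letter j * r * letter j * letter i * s) := by
  have hφq : ∀ z ∈ (φ q).toList, z = a ∨ z = b := by
    refine forall_eq_or_eq_of_isPower_letters fun k hk =>
      h.elim (LangK.isPower_map_letter hd (hq k hk)) (LangK.isPower_map_letter hd ?_)
    have := hq k hk
    simp only [FreeMonoid.toList_mul, List.count_append] at this ⊢
    omega
  have hX : IsPower a b (φ (letter i)).toList := by
    refine h.elim (LangK.isPower_map_letter hd ?_) (LangK.isPower_map_letter hd ?_) <;>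
      · simp [List.count_cons]; omega
  have hY : IsPower a b (φ (letter j)).toList := by
    refine h.elim (LangK.isPower_map_letter hd ?_) (LangK.isPower_map_letter hd ?_) <;>
      · simp [List.count_cons]; omega
  have hcomm := h.elim
    (fun h => LangK.mul_comm hd (P := P * φ p * φ (letter i) * φ q * φ (letter j) * φ r)
      (Q := φ s * R) hX hY (by simpa using h) (Or.inr (Or.inl ⟨_, _, _, rfl⟩)))
    (fun h => (LangK.mul_comm hd (P := P * φ p * φ (letter i) * φ q * φ (letter j) * φ r)
      (Q := φ s * R) hY hX (by simpa using h) (Or.inr (Or.inr ⟨_, _, _, hφq, rfl⟩))).symm)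
  simp only [map_mul, mul_assoc]
  rw [← mul_assoc (φ (letter i)) (φ (letter j)) (φ s), hcomm, mul_assoc]

theorem identitiesK_sound (hd : [a, b, t].Nodup) {e : Word × Word} (he : e ∈ identitiesK) :
    Satisfies (MTau (tauOne ⊓ zetaCon) (conClass (tauOne ⊓ zetaCon)
      (letter a * letter t * letter b ^ 2 * letter a))) e := by
  apply satisfies_MTau_of
  rw [conClass_languageK hd]
  intro φ P R h
  rw [mem_languageK_iff, mem_languageK_iff] at h
  have hX (hcount : 2 ≤ e.1.toList.count 0 ∧ 2 ≤ e.2.toList.count 0) :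
      IsPower a b (φ (letter 0)).toList :=
    h.elim (LangK.isPower_map_letter hd hcount.1) (LangK.isPower_map_letter hd hcount.2)
  have hY (hcount : 2 ≤ e.1.toList.count 1 ∧ 2 ≤ e.2.toList.count 1) :
      IsPower a b (φ (letter 1)).toList :=
    h.elim (LangK.isPower_map_letter hd hcount.1) (LangK.isPower_map_letter hd hcount.2)
  have of_eq : φ e.1 = φ e.2 → (tauOne ⊓ zetaCon) (φ e.1) (φ e.2) := fun h =>
    h ▸ (tauOne ⊓ zetaCon).refl _
  rcases he with (rfl | rfl | rfl | rfl) | ⟨p, q, r, s, i, j, hq, rfl⟩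
  · simp only [map_mul, map_pow] at h ⊢
    exact tauOne_inf_zetaCon_xyx (LangK.isPower hd) h
  · simp only [map_mul] at h ⊢
    exact tauOne_inf_zetaCon_xyxztx (LangK.isPower hd) (LangK.forall_eq_of_between hd) h
  · simp only [map_mul] at h of_eq ⊢
    exact of_eq (LangK.xyzxty_eq hd (hX (by decide)) (hY (by decide)) h)
  · simp only [map_mul, map_pow] at h of_eq ⊢
    exact of_eq (LangK.xzytyxy_eq hd (hX (by decide)) (hY (by decide)) h)
  · exact of_eq (LangK.map_swap_eq hd hq h)

end LangK

/-! ### Derivations and indistinguishability of lists of letters -/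

/-- The identity between the two words is derivable from `S`. -/
def Derivable (S : Set (Word × Word)) (u v : List ℕ) : Prop :=
  derivCon S (FreeMonoid.ofList u) (FreeMonoid.ofList v)

/-- No substitution and no context separates the two words with respect to the language `L`. -/
def Unseparated (L : List ℕ → Prop) (u v : List ℕ) : Prop :=
  ∀ (g : ℕ → List ℕ) (p q : List ℕ), L (p ++ u.flatMap g ++ q) ↔ L (p ++ v.flatMap g ++ q)

theorem Unseparated.symm {L : List ℕ → Prop} {u v : List ℕ} (h : Unseparated L u v) :
    Unseparated L v u := fun g p q => (h g p q).symm

theorem Unseparated.trans {L : List ℕ → Prop} {u v w : List ℕ} (h : Unseparated L u v)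
    (h' : Unseparated L v w) : Unseparated L u w := fun g p q => (h g p q).trans (h' g p q)

theorem unseparated_of_satisfies {W : Set Word} {L : List ℕ → Prop} (hL : ∀ w, w ∈ W ↔ L w.toList)
    {u v : Word} (h : Satisfies (SyntacticMonoid W) (u, v)) : Unseparated L u.toList v.toList := by
  intro g p q
  have hctx := (satisfies_quotient_iff _ _).1 h (FreeMonoid.lift fun k => FreeMonoid.ofList (g k))
    (FreeMonoid.ofList p) (FreeMonoid.ofList q)
  rw [hL, hL] at hctx
  simpa only [FreeMonoid.toList_mul, FreeMonoid.toList_ofList, toList_map_eq_flatMap,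
    FreeMonoid.lift_eval_of] using hctx

theorem Derivable.unseparated {S : Set (Word × Word)} {W : Set Word} {L : List ℕ → Prop}
    (hL : ∀ w, w ∈ W ↔ L w.toList) (hS : ∀ e ∈ S, Satisfies (SyntacticMonoid W) e)
    {u v : List ℕ} (h : Derivable S u v) : Unseparated L u v :=
  unseparated_of_satisfies hL (satisfies_of_derivCon hS h)

section Derivable

variable {S : Set (Word × Word)}

theorem Derivable.refl (u : List ℕ) : Derivable S u u := (derivCon S).refl _

theorem Derivable.symm {u v : List ℕ} (h : Derivable S u v) : Derivable S v u :=
  (derivCon S).symm h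

theorem Derivable.trans {u v w : List ℕ} (h : Derivable S u v) (h' : Derivable S v w) :
    Derivable S u w :=
  (derivCon S).trans h h'

theorem derivable_of_mem {e : Word × Word} (h : e ∈ S) (g : ℕ → List ℕ) (p q : List ℕ) :
    Derivable S (p ++ e.1.toList.flatMap g ++ q) (p ++ e.2.toList.flatMap g ++ q) := by
  have hmap := derivCon_map h (FreeMonoid.lift fun k => FreeMonoid.ofList (g k))
  have hlift : ∀ w : Word, FreeMonoid.lift (fun k => FreeMonoid.ofList (g k)) w =
      FreeMonoid.ofList (w.toList.flatMap g) := fun w => FreeMonoid.toList.injective (by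
    simp only [toList_map_eq_flatMap, FreeMonoid.lift_eval_of, FreeMonoid.toList_ofList])
  rw [hlift, hlift] at hmap
  exact (derivCon S).mul ((derivCon S).mul ((derivCon S).refl (FreeMonoid.ofList p)) hmap)
    ((derivCon S).refl (FreeMonoid.ofList q))

/-- The set contains the identities `xyx ≈ xyx²` and `xyxztx ≈ xyxzxtx`. -/
structure HasRepetitionIdentities (S : Set (Word × Word)) : Prop where
  xyx_mem : (letter 0 * letter 1 * letter 0, letter 0 * letter 1 * letter 0 ^ 2) ∈ S
  xyxztx_mem : (letter 0 * letter 1 * letter 0 * letter 2 * letter 3 * letter 0,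
    letter 0 * letter 1 * letter 0 * letter 2 * letter 0 * letter 3 * letter 0) ∈ S

/-- The substitution that sends the letters `0, 1, 2, 3` to the given words. -/
def subst4 (X Y Z T : List ℕ) : ℕ → List ℕ
  | 0 => X
  | 1 => Y
  | 2 => Z
  | 3 => T
  | _ => []

theorem HasRepetitionIdentities.derivable_append_dup (hS : HasRepetitionIdentities S)
    {x : ℕ} {A : List ℕ} (hx : x ∈ A) (B : List ℕ) :
    Derivable S (A ++ x :: B) (A ++ x :: x :: B) := by
  obtain ⟨A₁, A₂, rfl⟩ := List.append_of_mem hx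
  have := derivable_of_mem hS.xyx_mem (subst4 [x] A₂ [] []) A₁ B
  simpa [subst4, pow_two] using this

theorem HasRepetitionIdentities.derivable_insert (hS : HasRepetitionIdentities S) {x : ℕ}
    {A B : List ℕ} (hA : 2 ≤ A.count x)
    (hB : x ∈ B) : Derivable S (A ++ B) (A ++ x :: B) := by
  obtain ⟨A₁, A₂, A₃, rfl, -, -⟩ := exists_split_first_two_of_two_le_count hA
  obtain ⟨B₁, B₂, rfl⟩ := List.append_of_mem hB
  have := derivable_of_mem hS.xyxztx_mem (subst4 [x] A₂ A₃ B₁) A₁ B₂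
  simpa [subst4] using this

/-- Each letter of the word occurs once or exactly three times. -/
def Reduced (u : List ℕ) : Prop := ∀ x ∈ u, u.count x = 1 ∨ u.count x = 3

theorem HasRepetitionIdentities.exists_derivable_count_pred
    (hS : HasRepetitionIdentities S) {x : ℕ} {u : List ℕ} (hu : 4 ≤ u.count x) :
    ∃ v, Derivable S u v ∧ u.count x = v.count x + 1 ∧ ∀ y, y ≠ x → v.count y = u.count y := by
  obtain ⟨l₁, l₂, l₃, rfl, hl₁, hl₂⟩ :=
    exists_split_first_two_of_two_le_count (k := x) (l := u) (by omega)
  obtain ⟨B₁, B₂, B₃, rfl, -, -⟩ :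
      ∃ B₁ B₂ B₃, l₃ = B₁ ++ x :: (B₂ ++ x :: B₃) ∧ x ∉ B₁ ∧ x ∉ B₂ := by
    refine exists_split_first_two_of_two_le_count ?_
    simp only [List.count_append, List.count_cons_self, List.count_eq_zero_of_not_mem hl₁,
      List.count_eq_zero_of_not_mem hl₂] at hu
    omega
  refine ⟨l₁ ++ x :: (l₂ ++ x :: (B₁ ++ (B₂ ++ x :: B₃))), ?_, ?_, fun y hy => ?_⟩
  · simpa using (hS.derivable_insert (x := x) (A := l₁ ++ x :: (l₂ ++ x :: B₁))
      (B := B₂ ++ x :: B₃) (by simp; omega) (by simp)).symm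
  · simp only [List.count_append, List.count_cons_self]
    omega
  · simp [hy.symm]

theorem HasRepetitionIdentities.exists_derivable_count_of_two
    (hS : HasRepetitionIdentities S) {x : ℕ} {u : List ℕ} (hu : u.count x = 2) :
    ∃ v, Derivable S u v ∧ v.count x = 3 ∧ ∀ y, y ≠ x → v.count y = u.count y := by
  obtain ⟨l₁, l₂, l₃, rfl, -, -⟩ :=
    exists_split_first_two_of_two_le_count (k := x) (l := u) (by omega)
  refine ⟨l₁ ++ x :: (l₂ ++ x :: x :: l₃), ?_, ?_, fun y hy => ?_⟩
  · simpa using hS.derivable_append_dup (x := x) (A := l₁ ++ x :: l₂) (by simp) l₃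
  · simp only [List.count_append, List.count_cons_self] at hu ⊢
    omega
  · simp [hy.symm]

theorem HasRepetitionIdentities.exists_reduced_at
    (hS : HasRepetitionIdentities S) (x : ℕ) (u : List ℕ) :
    ∃ v, Derivable S u v ∧ (v.count x ≤ 1 ∨ v.count x = 3) ∧
      ∀ y, y ≠ x → v.count y = u.count y := by
  induction hn : u.count x using Nat.strong_induction_on generalizing u with
  | _ n ih =>
    rcases (by omega : (n ≤ 1 ∨ n = 3) ∨ n = 2 ∨ 4 ≤ n) with h | h | h
    · exact ⟨u, Derivable.refl u, hn ▸ h, fun _ _ => rfl⟩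
    · obtain ⟨v, huv, hv, hy⟩ := hS.exists_derivable_count_of_two (hn.trans h)
      exact ⟨v, huv, Or.inr hv, hy⟩
    · obtain ⟨v, huv, hv, hy⟩ := hS.exists_derivable_count_pred (hn ▸ h)
      obtain ⟨w, hvw, hw, hy'⟩ := ih (v.count x) (by omega) v rfl
      exact ⟨w, huv.trans hvw, hw, fun y hyx => (hy' y hyx).trans (hy y hyx)⟩

theorem HasRepetitionIdentities.exists_reduced (hS : HasRepetitionIdentities S)
    (u : List ℕ) : ∃ u', Derivable S u u' ∧ Reduced u' := by
  have reduce_letters : ∀ T : List ℕ, ∃ u', Derivable S u u' ∧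
      (∀ x ∈ T, u'.count x ≤ 1 ∨ u'.count x = 3) ∧ ∀ x, x ∉ T → u'.count x = u.count x := by
    intro T
    induction T with
    | nil => exact ⟨u, Derivable.refl u, by simp, fun _ _ => rfl⟩
    | cons x T ih =>
      obtain ⟨u', huu', hT, hnotT⟩ := ih
      obtain ⟨u'', hu'u'', hx, hne⟩ := hS.exists_reduced_at x u'
      refine ⟨u'', huu'.trans hu'u'', fun y hy => ?_, fun y hy => ?_⟩
      · by_cases hyx : y = x
        · rwa [hyx]
        · rw [hne y hyx]
          exact hT y ((List.mem_cons.1 hy).resolve_left hyx)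
      · rw [List.mem_cons, not_or] at hy
        rw [hne y hy.1, hnotT y hy.2]
  obtain ⟨u', huu', hcount, hnot⟩ := reduce_letters u
  refine ⟨u', huu', fun x hx => ?_⟩
  have hpos := List.count_pos_iff.2 hx
  have hxu : x ∈ u := by
    by_contra h
    rw [hnot x h, List.count_eq_zero_of_not_mem h] at hpos
    omega
  have := hcount x hxu
  omega

end Derivable

/-! ### Sorting one word into another -/

/-- The language `L` detects linear letters, and, for each linear letter `t` and each letter `y`,
whether all, none, or exactly one of the occurrences of `y` precede `t`. -/
structure DetectsLinearLetters (L : List ℕ → Prop) : Prop where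
  count_eq_one : ∀ {u v : List ℕ} {x : ℕ}, Unseparated L u v → u.count x = 1 → v.count x = 1
  mem : ∀ {u v : List ℕ} {x : ℕ}, Unseparated L u v → x ∈ u → x ∈ v
  not_mem_after : ∀ {u₁ u₂ v₁ v₂ : List ℕ} {t y : ℕ},
    Unseparated L (u₁ ++ t :: u₂) (v₁ ++ t :: v₂) →
    y ≠ t → t ∉ u₁ → t ∉ u₂ → t ∉ v₁ → t ∉ v₂ → y ∉ u₂ → y ∉ v₂
  not_mem_before : ∀ {u₁ u₂ v₁ v₂ : List ℕ} {t y : ℕ},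
    Unseparated L (u₁ ++ t :: u₂) (v₁ ++ t :: v₂) →
    y ≠ t → t ∉ u₁ → t ∉ u₂ → t ∉ v₁ → t ∉ v₂ → y ∉ u₁ → y ∉ v₁
  count_before : ∀ {u₁ u₂ v₁ v₂ : List ℕ} {t y : ℕ},
    Unseparated L (u₁ ++ t :: u₂) (v₁ ++ t :: v₂) →
    y ≠ t → t ∉ u₁ → t ∉ u₂ → t ∉ v₁ → t ∉ v₂ → u₁.count y = 1 → y ∈ u₂ → v₁.count y = 1

namespace DetectsLinearLetters

variable {L : List ℕ → Prop}

theorem count_eq (hL : DetectsLinearLetters L) {u v : List ℕ} (h : Unseparated L u v)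
    (hu : Reduced u) (hv : Reduced v) (x : ℕ) : u.count x = v.count x := by
  by_cases hx : x ∈ u
  · have hxv := hL.mem h hx
    rcases hu x hx with hu1 | hu3
    · rw [hu1, hL.count_eq_one h hu1]
    · rcases hv x hxv with hv1 | hv3
      · rw [hv1, hL.count_eq_one h.symm hv1]
      · rw [hu3, hv3]
  · rw [List.count_eq_zero_of_not_mem hx, List.count_eq_zero_of_not_mem fun hxv =>
      hx (hL.mem h.symm hxv)]

theorem count_prefix_eq (hL : DetectsLinearLetters L) {u₁ u₂ v₁ v₂ : List ℕ} {t : ℕ}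
    (h : Unseparated L (u₁ ++ t :: u₂) (v₁ ++ t :: v₂)) (hu : Reduced (u₁ ++ t :: u₂))
    (hv : Reduced (v₁ ++ t :: v₂)) (ht : (u₁ ++ t :: u₂).count t = 1) (y : ℕ) :
    u₁.count y = v₁.count y := by
  have ht' := hL.count_eq_one h ht
  simp only [List.count_append, List.count_cons_self] at ht ht'
  have htu₁ : t ∉ u₁ := List.count_eq_zero.1 (by omega)
  have htu₂ : t ∉ u₂ := List.count_eq_zero.1 (by omega)
  have htv₁ : t ∉ v₁ := List.count_eq_zero.1 (by omega)
  have htv₂ : t ∉ v₂ := List.count_eq_zero.1 (by omega)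
  by_cases hyt : y = t
  · rw [hyt, List.count_eq_zero_of_not_mem htu₁, List.count_eq_zero_of_not_mem htv₁]
  have hc := hL.count_eq h hu hv y
  have ha := hL.not_mem_after h hyt htu₁ htu₂ htv₁ htv₂
  have ha' := hL.not_mem_after h.symm hyt htv₁ htv₂ htu₁ htu₂
  have hb := hL.not_mem_before h hyt htu₁ htu₂ htv₁ htv₂
  have hb' := hL.not_mem_before h.symm hyt htv₁ htv₂ htu₁ htu₂
  have ho := hL.count_before h hyt htu₁ htu₂ htv₁ htv₂
  have ho' := hL.count_before h.symm hyt htv₁ htv₂ htu₁ htu₂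
  simp only [← List.count_pos_iff, not_lt, Nat.le_zero] at ha ha' hb hb' ho ho'
  have hcases : (u₁ ++ t :: u₂).count y = 0 ∨ (u₁ ++ t :: u₂).count y = 1 ∨
      (u₁ ++ t :: u₂).count y = 3 := by
    by_cases hy : y ∈ u₁ ++ t :: u₂
    · exact Or.inr (hu y hy)
    · exact Or.inl (List.count_eq_zero_of_not_mem hy)
  simp only [List.count_append, List.count_cons_of_ne (Ne.symm hyt)] at hc hcases
  omega

theorem count_eq_three (hL : DetectsLinearLetters L) {p r B V : List ℕ} {y c : ℕ}
    (hyc : y ≠ c) (hc : c ∉ r)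
    (h : Unseparated L (p ++ r ++ y :: c :: B) (p ++ c :: V)) (hu : Reduced (p ++ r ++ y :: c :: B))
    (hv : Reduced (p ++ c :: V)) :
    (p ++ r ++ y :: c :: B).count y = 3 ∧ (p ++ r ++ y :: c :: B).count c = 3 := by
  constructor
  · refine (hu y (by simp)).resolve_left fun hy => ?_
    have hyV : (p ++ c :: V).count y = 1 := hL.count_eq_one h hy
    have hy' := hy
    simp only [List.count_append, List.count_cons_self, List.count_cons_of_ne hyc.symm] at hy hyV
    obtain ⟨V₁, V₂, rfl⟩ := List.append_of_mem (List.count_pos_iff.1 (by omega : 0 < V.count y))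
    have hcount := hL.count_prefix_eq (u₁ := p ++ r) (u₂ := c :: B) (v₁ := p ++ c :: V₁)
      (by simpa using h) hu (by simpa using hv) hy' c
    simp [List.count_eq_zero_of_not_mem hc] at hcount
  · refine (hu c (by simp)).resolve_left fun hc => ?_
    have hcount := hL.count_prefix_eq (u₁ := p ++ r ++ [y]) (v₁ := p) (by simpa using h)
      (by simpa using hu) hv (by simpa using hc) y
    simp only [List.count_append, List.count_singleton_self] at hcount
    omega

end DetectsLinearLetters

theorem Reduced.of_perm {u v : List ℕ} (h : u.Perm v) (hu : Reduced u) : Reduced v := by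
  intro x hx
  rw [← h.count_eq]
  exact hu x (h.mem_iff.2 hx)

theorem derivable_move_left {S : Set (Word × Word)} {L : List ℕ → Prop}
    (hSL : ∀ {u v}, Derivable S u v → Unseparated L u v) {p V : List ℕ} {c : ℕ}
    (hswap : ∀ r y B, c ∉ r → y ≠ c → Reduced (p ++ r ++ y :: c :: B) →
      Unseparated L (p ++ r ++ y :: c :: B) (p ++ c :: V) →
      Derivable S (p ++ r ++ y :: c :: B) (p ++ r ++ c :: y :: B)) (r : List ℕ) :
    ∀ B, c ∉ r → Reduced (p ++ (r ++ c :: B)) →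
      Unseparated L (p ++ (r ++ c :: B)) (p ++ c :: V) →
      Derivable S (p ++ (r ++ c :: B)) (p ++ c :: (r ++ B)) := by
  induction r using List.reverseRecOn with
  | nil => intro B _ _ _; exact Derivable.refl _
  | append_singleton r y ih =>
    intro B hc hu hI
    simp only [List.mem_append, List.mem_singleton, not_or] at hc
    have hu' : Reduced (p ++ r ++ y :: c :: B) := by simpa using hu
    have hI' : Unseparated L (p ++ r ++ y :: c :: B) (p ++ c :: V) := by simpa using hI
    have hyc := hswap r y B hc.1 (Ne.symm hc.2) hu' hI'
    have hperm : (p ++ r ++ y :: c :: B).Perm (p ++ (r ++ c :: y :: B)) := by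
      rw [List.append_assoc]
      exact ((List.Perm.swap _ _ _).append_left _).append_left _
    have hmove := ih (y :: B) hc.1 (hu'.of_perm hperm) (by simpa using (hSL hyc).symm.trans hI')
    simpa using hyc.trans (by simpa using hmove)

theorem derivCon_of_satisfies {S : Set (Word × Word)} {W : Set Word} {L : List ℕ → Prop}
    (hL : ∀ w, w ∈ W ↔ L w.toList) (hS : ∀ e ∈ S, Satisfies (SyntacticMonoid W) e)
    (hrep : HasRepetitionIdentities S)
    (hred : ∀ u v, Reduced u → Reduced v → Unseparated L u v → Derivable S u v) {u v : Word}
    (h : Satisfies (SyntacticMonoid W) (u, v)) : derivCon S u v := by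
  obtain ⟨u', huu', hu'⟩ := hrep.exists_reduced u.toList
  obtain ⟨v', hvv', hv'⟩ := hrep.exists_reduced v.toList
  have huv : Unseparated L u' v' := (huu'.unseparated hL hS).symm.trans
    ((unseparated_of_satisfies hL h).trans (hvv'.unseparated hL hS))
  exact huu'.trans ((hred u' v' hu' hv' huv).trans hvv'.symm)

/-- The substitution that replaces the letters listed in `m` as prescribed there and erases all
other letters. -/
def substOf : List (ℕ × List ℕ) → ℕ → List ℕ
  | [], _ => []
  | (x, X) :: m, k => if k = x then X else substOf m k

theorem flatMap_eq_replicate {g : ℕ → List ℕ} {y b : ℕ} {A : List ℕ} (hy : g y = [b])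
    (h : ∀ x ∈ A, x ≠ y → g x = []) : A.flatMap g = List.replicate (A.count y) b := by
  induction A with
  | nil => rfl
  | cons x A ih =>
    rw [List.flatMap_cons, ih fun z hz => h z (List.mem_cons_of_mem _ hz)]
    by_cases hx : x = y
    · rw [hx, hy, List.count_cons_self, List.replicate_succ, List.singleton_append]
    · rw [h x List.mem_cons_self hx, List.nil_append, List.count_cons_of_ne hx]

theorem Unseparated.replicate_count {L : List ℕ → Prop} {u v : List ℕ} (h : Unseparated L u v)
    (x c : ℕ) (p q : List ℕ) : L (p ++ List.replicate (u.count x) c ++ q) ↔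
      L (p ++ List.replicate (v.count x) c ++ q) := by
  have hmap (w : List ℕ) : w.flatMap (substOf [(x, [c])]) = List.replicate (w.count x) c :=
    flatMap_eq_replicate (by simp [substOf]) fun z _ hz => by simp [substOf, hz]
  simpa only [hmap] using h (substOf [(x, [c])]) p q

theorem Unseparated.replicate_count_linear {L : List ℕ → Prop} {u₁ u₂ v₁ v₂ : List ℕ} {l y : ℕ}
    (h : Unseparated L (u₁ ++ l :: u₂) (v₁ ++ l :: v₂)) (hyl : y ≠ l) (hu₁ : l ∉ u₁) (hu₂ : l ∉ u₂)
    (hv₁ : l ∉ v₁) (hv₂ : l ∉ v₂) (c : ℕ) (T p q : List ℕ) :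
    L (p ++ (List.replicate (u₁.count y) c ++ (T ++ List.replicate (u₂.count y) c)) ++ q) ↔
      L (p ++ (List.replicate (v₁.count y) c ++ (T ++ List.replicate (v₂.count y) c)) ++ q) := by
  have hmap (w : List ℕ) (hw : l ∉ w) :
      w.flatMap (substOf [(l, T), (y, [c])]) = List.replicate (w.count y) c :=
    flatMap_eq_replicate (by simp [substOf, hyl]) fun x hx hxy => by
      simp [substOf, hxy, ne_of_mem_of_not_mem hx hw]
  have hl : substOf [(l, T), (y, [c])] l = T := if_pos rfl
  simpa only [List.flatMap_append, List.flatMap_cons, hl, hmap, hu₁, hu₂, hv₁, hv₂,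
    not_false_eq_true] using h (substOf [(l, T), (y, [c])]) p q

/-! ### Completeness of the identities of `K` -/

section LangK

variable {a b t : ℕ}

theorem LangK.of_two_le {i j : ℕ} (hi : 2 ≤ i) (hj : 1 ≤ j) :
    LangK a b t (a :: t :: (List.replicate i b ++ List.replicate j a)) :=
  ⟨i - 2, j - 1, by rw [Nat.sub_add_cancel hi, Nat.sub_add_cancel hj]⟩

theorem LangK.count_eq_one (hat : a ≠ t) (hbt : b ≠ t) {w : List ℕ} (h : LangK a b t w) :
    w.count t = 1 := by
  obtain ⟨i, j, rfl⟩ := h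
  simp [List.count_replicate, hat, hbt]

theorem LangK.two_le_count {w : List ℕ} (h : LangK a b t w) : 2 ≤ w.count b := by
  obtain ⟨i, j, rfl⟩ := h
  simp only [List.count_cons, List.count_append, List.count_replicate_self]
  omega

theorem LangK.eq_one_of_replicate_append (hat : a ≠ t) {n : ℕ} {Y : List ℕ}
    (h : LangK a b t (List.replicate n a ++ t :: Y)) : n = 1 := by
  obtain ⟨i, j, h⟩ := h
  rcases n with _ | _ | n
  · exact absurd (List.cons.inj h).1.symm hat
  · rfl
  · exact absurd (List.cons.inj (List.cons.inj h).2).1 hat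

theorem LangK.not_mem_of_append_cons (hab : a ≠ b) (hat : a ≠ t) {X Y : List ℕ}
    (h : LangK a b t (X ++ a :: Y)) (hX : a ∈ X) : b ∉ Y := by
  obtain ⟨i, j, h⟩ := h
  rcases X with _ | ⟨x₁, _ | ⟨x₂, X⟩⟩
  · simp at hX
  · exact absurd (List.cons.inj (List.cons.inj h).2).1 hat
  have hpair : (X ++ a :: Y).Pairwise fun x y => x = a → y = a := by
    have hXY := (List.cons.inj (List.cons.inj h).2).2
    rw [List.append_eq] at hXY
    rw [hXY]
    simp [List.pairwise_append, List.pairwise_replicate, hab.symm]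
  intro hbY
  have := (List.pairwise_cons.1 (List.pairwise_append.1 hpair).2.1).1 b hbY rfl
  exact hab this.symm

theorem detectsLinearLetters_langK (hd : [a, b, t].Nodup) :
    DetectsLinearLetters (LangK a b t) := by
  obtain ⟨⟨hab, hat⟩, hbt⟩ : (a ≠ b ∧ a ≠ t) ∧ b ≠ t := by simpa using hd
  have hblocks {i j : ℕ} := LangK.of_two_le (a := a) (b := b) (t := t) (i := i) (j := j)
  constructor
  case count_eq_one =>
    intro u v x h hx
    have hv := (h.replicate_count x t [a] [b, b, a]).1 (by
      simpa [hx] using hblocks (i := 2) (j := 1) le_rfl le_rfl)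
    simpa [hat, hbt] using hv.count_eq_one hat hbt
  case mem =>
    intro u v x h hx
    have hv := (h.replicate_count x b [a, t, b] [a]).1 (by
      simpa [List.replicate_succ] using hblocks (i := u.count x + 1) (j := 1)
        (Nat.succ_le_succ (List.count_pos_iff.2 hx)) le_rfl)
    simpa [hab, hbt.symm] using hv.two_le_count
  case not_mem_after =>
    intro u₁ u₂ v₁ v₂ l y h hyl h₁ h₂ h₃ h₄ hy
    have hv := (h.replicate_count_linear hyl h₁ h₂ h₃ h₄ b [b, b, a] [a, t] []).1 (by
      simpa [List.replicate_add, List.count_eq_zero_of_not_mem hy] using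
        hblocks (i := u₁.count y + 2) (j := 1) (by omega) le_rfl)
    have hafter := LangK.not_mem_of_append_cons hab hat
      (X := [a, t] ++ List.replicate (v₁.count y) b ++ [b, b]) (by simpa using hv) (by simp)
    exact List.count_eq_zero.1 (by simpa using hafter)
  case not_mem_before =>
    intro u₁ u₂ v₁ v₂ l y h hyl h₁ h₂ h₃ h₄ hy hyv
    have hv := (h.replicate_count_linear hyl h₁ h₂ h₃ h₄ a [b, b, a] [a, t] []).1 (by
      simpa [List.replicate_succ, List.count_eq_zero_of_not_mem hy] using
        hblocks (i := 2) (j := u₂.count y + 1) le_rfl (by omega))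
    obtain ⟨n, hn⟩ := Nat.exists_eq_add_of_le' (List.count_pos_iff.2 hyv)
    rw [hn] at hv
    exact LangK.not_mem_of_append_cons hab hat (X := [a, t]) hv (by simp) (by simp)
  case count_before =>
    intro u₁ u₂ v₁ v₂ l y h hyl h₁ h₂ h₃ h₄ hy _
    have hv := (h.replicate_count_linear hyl h₁ h₂ h₃ h₄ a [t, b, b, a] [] []).1 (by
      simpa [hy, List.replicate_succ] using
        hblocks (i := 2) (j := u₂.count y + 1) le_rfl (by omega))
    exact LangK.eq_one_of_replicate_append hat (by simpa using hv)

end LangK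

section IdentitiesK

theorem hasRepetitionIdentities_identitiesK : HasRepetitionIdentities identitiesK :=
  ⟨by simp [identitiesK], by simp [identitiesK]⟩

theorem derivable_swap_of_mem_after {x y : ℕ} {B : List ℕ} (hx : x ∈ B) (hy : y ∈ B)
    (hxy : x ≠ y) (A : List ℕ) : Derivable identitiesK (A ++ x :: y :: B) (A ++ y :: x :: B) := by
  have swap (x y : ℕ) (B₁ B₂ B₃ : List ℕ) :
      Derivable identitiesK (A ++ x :: y :: (B₁ ++ x :: (B₂ ++ y :: B₃)))
        (A ++ y :: x :: (B₁ ++ x :: (B₂ ++ y :: B₃))) := by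
    have hmem : (letter 0 * letter 1 * letter 2 * letter 0 * letter 3 * letter 1,
        letter 1 * letter 0 * letter 2 * letter 0 * letter 3 * letter 1) ∈ identitiesK := by
      simp [identitiesK]
    simpa [subst4] using derivable_of_mem hmem (subst4 [x] [y] B₁ B₂) A B₃
  obtain ⟨B₁, B₂, rfl⟩ := List.append_of_mem hx
  rcases List.mem_append.1 hy with hy | hy
  · obtain ⟨B₃, B₄, rfl⟩ := List.append_of_mem hy
    simpa using (swap y x B₃ B₄ B₂).symm
  · obtain ⟨B₃, B₄, rfl⟩ := List.append_of_mem ((List.mem_cons.1 hy).resolve_left hxy.symm)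
    simpa using swap x y B₁ B₃ B₄

theorem derivable_swap_of_nonlinear {p q r s : List ℕ} {x y : ℕ}
    (hq : ∀ k ∈ q, 2 ≤ (p ++ x :: (q ++ y :: (r ++ x :: y :: s))).count k) :
    Derivable identitiesK (p ++ x :: (q ++ y :: (r ++ x :: y :: s)))
      (p ++ x :: (q ++ y :: (r ++ y :: x :: s))) := by
  have hmem : ((FreeMonoid.ofList p * letter x * FreeMonoid.ofList q * letter y *
      FreeMonoid.ofList r * letter x * letter y * FreeMonoid.ofList s,
      FreeMonoid.ofList p * letter x * FreeMonoid.ofList q * letter y *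
      FreeMonoid.ofList r * letter y * letter x * FreeMonoid.ofList s) : Word × Word) ∈
      identitiesK :=
    Or.inr ⟨FreeMonoid.ofList p, FreeMonoid.ofList q, FreeMonoid.ofList r,
      FreeMonoid.ofList s, x, y, fun k hk => by simpa using hq k hk, rfl⟩
  simpa using derivable_of_mem hmem (fun k => [k]) [] []

theorem derivable_swap_of_two_le_count {P₁ P₂ P₃ s : List ℕ} {x y : ℕ}
    (hx : 2 ≤ (P₁ ++ x :: (P₂ ++ y :: P₃)).count x) :
    Derivable identitiesK (P₁ ++ x :: (P₂ ++ y :: P₃) ++ x :: y :: s)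
      (P₁ ++ x :: (P₂ ++ y :: P₃) ++ y :: x :: s) := by
  have hmem : (letter 0 * letter 2 * letter 1 * letter 3 * letter 1 * letter 0 * letter 1,
      letter 0 * letter 2 * letter 1 * letter 3 * letter 0 * letter 1 ^ 2) ∈ identitiesK := by
    simp [identitiesK]
  have hrep := hasRepetitionIdentities_identitiesK
  set P := P₁ ++ x :: (P₂ ++ y :: P₃) with hP
  have xy_xxy : Derivable identitiesK (P ++ x :: y :: s) (P ++ x :: x :: y :: s) :=
    hrep.derivable_append_dup (by simp [hP]) _
  have xxy_xxyy : Derivable identitiesK (P ++ x :: x :: y :: s) (P ++ x :: x :: y :: y :: s) := by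
    simpa using hrep.derivable_append_dup (x := y) (A := P ++ [x, x]) (by simp [hP]) s
  have xyxy_xxyy : Derivable identitiesK (P ++ x :: y :: x :: y :: s)
      (P ++ x :: x :: y :: y :: s) := by
    simpa [subst4, hP, pow_two] using
      derivable_of_mem hmem (subst4 [x] [y] P₂ (P₃ ++ [x])) P₁ s
  have xyxy_xyyx : Derivable identitiesK (P ++ x :: y :: x :: y :: s)
      (P ++ x :: y :: y :: x :: s) := by
    simpa using
      derivable_swap_of_nonlinear (p := P) (q := []) (r := []) (s := s) (x := x) (y := y) (by simp)
  have xyx_xyyx : Derivable identitiesK (P ++ x :: y :: x :: s) (P ++ x :: y :: y :: x :: s) := by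
    simpa using hrep.derivable_append_dup (x := y) (A := P ++ [x]) (by simp [hP]) (x :: s)
  have yx_xyx : Derivable identitiesK (P ++ y :: x :: s) (P ++ x :: y :: x :: s) :=
    hrep.derivable_insert hx (by simp)
  exact xy_xxy.trans (xxy_xxyy.trans (xyxy_xxyy.symm.trans
    (xyxy_xyyx.trans (xyx_xyyx.symm.trans yx_xyx.symm))))

theorem derivable_swap_of_two_le_count_of_two_le_count {A B : List ℕ} {x y : ℕ} (hxy : x ≠ y)
    (hx : 2 ≤ A.count x) (hy : 2 ≤ A.count y) :
    Derivable identitiesK (A ++ x :: y :: B) (A ++ y :: x :: B) := by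
  obtain ⟨A₁, A₂, rfl, -⟩ :=
    List.eq_append_cons_of_mem (List.count_pos_iff.1 (Nat.lt_of_lt_of_le Nat.two_pos hx))
  have hyA : y ∈ A₁ ++ x :: A₂ := List.count_pos_iff.1 (Nat.lt_of_lt_of_le Nat.two_pos hy)
  rcases List.mem_append.1 hyA with hyA₁ | hyA₂
  · obtain ⟨A₃, A₄, rfl⟩ := List.append_of_mem hyA₁
    rw [List.append_assoc, List.cons_append] at hy
    simpa using (derivable_swap_of_two_le_count (s := B) hy).symm
  · obtain ⟨A₃, A₄, rfl⟩ := List.append_of_mem ((List.mem_cons.1 hyA₂).resolve_left hxy.symm)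
    exact derivable_swap_of_two_le_count hx

theorem derivable_swap_or_exists_linear {A r B : List ℕ} {x y : ℕ} (hxy : x ≠ y) (hx : x ∈ A)
    (hy : 2 ≤ A.count y) :
    Derivable identitiesK (A ++ r ++ x :: y :: B) (A ++ r ++ y :: x :: B) ∨
      ∃ l A₁ A₂ A₃, A = A₁ ++ x :: (A₂ ++ l :: A₃) ∧ (A ++ r ++ x :: y :: B).count l ≤ 1 ∧
        x ∉ A₁ ∧ y ∉ A₁ ∧ y ∉ A₂ := by
  obtain ⟨A₁, A₂, rfl, hxA₁⟩ := List.eq_append_cons_of_mem hx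
  by_cases hyA₁ : y ∈ A₁
  · obtain ⟨A₃, A₄, rfl⟩ := List.append_of_mem hyA₁
    left
    have := derivable_swap_of_two_le_count (P₁ := A₃) (P₂ := A₄) (P₃ := A₂ ++ r) (x := y) (y := x)
      (s := B) (by grind)
    simpa using this.symm
  have hyA₂ : y ∈ A₂ := by grind
  obtain ⟨A₃, A₄, rfl, hyA₃⟩ := List.eq_append_cons_of_mem hyA₂
  by_cases hlin : ∀ k ∈ A₃, 2 ≤ (A₁ ++ x :: (A₃ ++ y :: A₄) ++ r ++ x :: y :: B).count k
  · left
    simpa using derivable_swap_of_nonlinear (p := A₁) (q := A₃) (r := A₄ ++ r) (s := B) (x := x)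
      (y := y) (fun k hk => by simpa using hlin k hk)
  · push Not at hlin
    obtain ⟨l, hl, hcount⟩ := hlin
    obtain ⟨A₅, A₆, rfl⟩ := List.append_of_mem hl
    refine Or.inr ⟨l, A₁, A₅, A₆ ++ y :: A₄, by simp, by omega, hxA₁, hyA₁, ?_⟩
    exact fun h => hyA₃ (List.mem_append_left _ h)

end IdentitiesK

section LangK

variable {a b t : ℕ}

theorem LangK.not_mem_after_of_unseparated (hab : a ≠ b) (hat : a ≠ t) {U₁ U₂ V₁ V₂ : List ℕ}
    {c y : ℕ} (hyc : y ≠ c) (h : Unseparated (LangK a b t) (U₁ ++ U₂) (V₁ ++ c :: V₂))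
    (hcU₁ : c ∉ U₁) (hyU₂ : y ∉ U₂) (hcU₂ : c ∈ U₂) : y ∉ V₂ := by
  intro hyV₂
  set g := substOf [(y, [b]), (c, [a])] with hg
  have hgy : g y = [b] := by simp [hg, substOf]
  have hgc : g c = [a] := by simp [hg, substOf, hyc.symm]
  have hU₁ : U₁.flatMap g = List.replicate (U₁.count y) b :=
    flatMap_eq_replicate hgy fun x hx hxy => by
      simp [hg, substOf, hxy, ne_of_mem_of_not_mem hx hcU₁]
  have hU₂ : U₂.flatMap g = List.replicate (U₂.count c) a :=
    flatMap_eq_replicate hgc fun x hx hxc => by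
      simp [hg, substOf, hxc, ne_of_mem_of_not_mem hx hyU₂]
  have hU : LangK a b t ([a, t, b, b] ++ (U₁ ++ U₂).flatMap g ++ []) := by
    simpa [hU₁, hU₂, List.replicate_succ] using LangK.of_two_le (a := a) (b := b) (t := t)
      (i := U₁.count y + 2) (by omega) (List.count_pos_iff.2 hcU₂)
  have hV := (h g [a, t, b, b] []).1 hU
  rw [List.flatMap_append, List.flatMap_cons, hgc] at hV
  refine LangK.not_mem_of_append_cons hab hat (X := [a, t, b, b] ++ V₁.flatMap g)
    (by simpa using hV) (by simp) ?_
  exact List.mem_flatMap.2 ⟨y, hyV₂, by simp [hgy]⟩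

theorem LangK.not_mem_after_of_unseparated_linear (hab : a ≠ b) (hat : a ≠ t)
    {U₁ U₂ U₃ U₄ V₁ V₂ : List ℕ} {c l y : ℕ} (hyc : y ≠ c) (hly : l ≠ y) (hlc : l ≠ c)
    (h : Unseparated (LangK a b t) (U₁ ++ c :: (U₂ ++ l :: (U₃ ++ U₄))) (V₁ ++ c :: V₂))
    (hl : l ∉ U₁ ++ U₂ ++ U₃ ++ U₄) (hc : c ∉ U₁ ++ U₂ ++ U₃) (hyU₁₂ : y ∉ U₁ ++ U₂)
    (hyU₃ : y ∈ U₃) (hyU₄ : y ∉ U₄) (hcU₄ : c ∈ U₄) (hcV₁ : c ∈ V₁) : y ∉ V₂ := by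
  intro hyV₂
  set g := substOf [(y, [b]), (c, [a]), (l, [t, b])] with hg
  have hgy : g y = [b] := by simp [hg, substOf]
  have hgc : g c = [a] := by simp [hg, substOf, hyc.symm]
  have hgl : g l = [t, b] := by simp [hg, substOf, hly, hlc]
  simp only [List.mem_append, not_or] at hl hyU₁₂ hc
  have erased (U : List ℕ) (hyU : y ∉ U) (hcU : c ∉ U) (hlU : l ∉ U) : U.flatMap g = [] :=
    List.flatMap_eq_nil_iff.2 fun x hx => by
      simp [hg, substOf, ne_of_mem_of_not_mem hx hyU, ne_of_mem_of_not_mem hx hcU,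
        ne_of_mem_of_not_mem hx hlU]
  have hU₃ : U₃.flatMap g = List.replicate (U₃.count y) b :=
    flatMap_eq_replicate hgy fun x hx hxy => by
      simp [hg, substOf, hxy, ne_of_mem_of_not_mem hx hc.2, ne_of_mem_of_not_mem hx hl.1.2]
  have hU₄ : U₄.flatMap g = List.replicate (U₄.count c) a :=
    flatMap_eq_replicate hgc fun x hx hxc => by
      simp [hg, substOf, hxc, ne_of_mem_of_not_mem hx hyU₄, ne_of_mem_of_not_mem hx hl.2]
  have hU := LangK.of_two_le (a := a) (b := b) (t := t)
    (Nat.succ_le_succ (List.count_pos_iff.2 hyU₃)) (List.count_pos_iff.2 hcU₄)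
  have hV := (h g [] []).1 (by
    simpa [hgc, hgl, hU₃, hU₄, erased U₁ hyU₁₂.1 hc.1.1 hl.1.1.1,
      erased U₂ hyU₁₂.2 hc.1.2 hl.1.1.2, List.replicate_succ] using hU)
  rw [List.flatMap_append, List.flatMap_cons, hgc] at hV
  refine LangK.not_mem_of_append_cons hab hat (X := V₁.flatMap g) (by simpa using hV) ?_ ?_
  · exact List.mem_flatMap.2 ⟨c, hcV₁, by simp [hgc]⟩
  · exact List.mem_flatMap.2 ⟨y, hyV₂, by simp [hgy]⟩

theorem derivable_swap_of_mem_of_not_mem (hd : [a, b, t].Nodup) {p r B V : List ℕ} {c y : ℕ}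
    (hcr : c ∉ r) (hyc : y ≠ c) (hu : Reduced (p ++ r ++ y :: c :: B)) (hv : Reduced (p ++ c :: V))
    (h : Unseparated (LangK a b t) (p ++ r ++ y :: c :: B) (p ++ c :: V)) (hyB : y ∈ B)
    (hcB : c ∉ B) :
    Derivable identitiesK (p ++ r ++ y :: c :: B) (p ++ r ++ c :: y :: B) := by
  obtain ⟨⟨hab, hat⟩, -⟩ : (a ≠ b ∧ a ≠ t) ∧ b ≠ t := by simpa using hd
  have hdet := detectsLinearLetters_langK hd
  obtain ⟨hy, hc⟩ := hdet.count_eq_three hyc hcr h hu hv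
  have hyv := hdet.count_eq h hu hv y
  have hcv := hdet.count_eq h hu hv c
  have hcV : c ∉ V := by grind
  have hyp : y ∈ p := by
    by_contra hyp
    refine LangK.not_mem_after_of_unseparated hab hat hyc.symm (U₁ := p ++ [c]) (U₂ := V)
      (V₁ := p ++ r) (V₂ := c :: B) (by simpa using h.symm) (by simp [hyp, hyc]) hcV ?_
      List.mem_cons_self
    grind
  refine (derivable_swap_or_exists_linear hyc hyp (by grind)).resolve_right ?_
  rintro ⟨l, A₁, A₂, A₃, rfl, hl, hyA₁, hcA₁, hcA₂⟩
  have hl' := hdet.count_eq h hu hv l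
  refine LangK.not_mem_after_of_unseparated_linear hab hat (c := y) (y := c) (l := l) hyc.symm
    (by grind) (by grind) (U₁ := A₁) (U₂ := A₂) (U₃ := A₃ ++ [c]) (U₄ := V)
    (V₁ := A₁ ++ y :: (A₂ ++ l :: A₃) ++ r) (V₂ := c :: B) (by simpa using h.symm)
    ?_ ?_ (by simp [hcA₁, hcA₂]) (by simp) hcV ?_ (by simp) List.mem_cons_self
  all_goals grind

theorem derivable_swap_of_not_mem_of_mem (hd : [a, b, t].Nodup) {p r B V : List ℕ} {c y : ℕ}
    (hcr : c ∉ r) (hyc : y ≠ c) (hu : Reduced (p ++ r ++ y :: c :: B)) (hv : Reduced (p ++ c :: V))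
    (h : Unseparated (LangK a b t) (p ++ r ++ y :: c :: B) (p ++ c :: V)) (hyB : y ∉ B)
    (hcB : c ∈ B) :
    Derivable identitiesK (p ++ r ++ y :: c :: B) (p ++ r ++ c :: y :: B) := by
  obtain ⟨⟨hab, hat⟩, -⟩ : (a ≠ b ∧ a ≠ t) ∧ b ≠ t := by simpa using hd
  have hdet := detectsLinearLetters_langK hd
  obtain ⟨hy, hc⟩ := hdet.count_eq_three hyc hcr h hu hv
  have hyv := hdet.count_eq h hu hv y
  have hyV : y ∈ V := by grind
  have hyB' : y ∉ c :: B := by simp [hyc, hyB]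
  have hcp : c ∈ p := by
    by_contra hcp
    exact LangK.not_mem_after_of_unseparated hab hat hyc (U₁ := p ++ r ++ [y]) (U₂ := c :: B)
      (by simpa using h) (by simp [hcp, hcr, hyc.symm]) hyB' List.mem_cons_self hyV
  have hswap := derivable_swap_or_exists_linear (A := p ++ r) (r := []) (B := B) hyc.symm
    (List.mem_append_left r hcp) (by grind)
  rw [List.append_nil] at hswap
  refine (hswap.resolve_right ?_).symm
  rintro ⟨l, A₁, A₂, A₃, hA, hl, hcA₁, hyA₁, hyA₂⟩
  rw [hA] at h hl hy hc
  refine LangK.not_mem_after_of_unseparated_linear hab hat (c := c) (y := y) (l := l) hyc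
    (by grind) (by grind) (U₁ := A₁) (U₂ := A₂) (U₃ := A₃ ++ [y]) (U₄ := c :: B) (V₁ := p)
    (V₂ := V) (by simpa using h) ?_ ?_ (by simp [hyA₁, hyA₂]) (by simp) hyB' List.mem_cons_self
    hcp hyV
  all_goals grind

theorem derivable_swap_of_unseparated_langK (hd : [a, b, t].Nodup) {p r B V : List ℕ} {c y : ℕ}
    (hcr : c ∉ r) (hyc : y ≠ c) (hu : Reduced (p ++ r ++ y :: c :: B)) (hv : Reduced (p ++ c :: V))
    (h : Unseparated (LangK a b t) (p ++ r ++ y :: c :: B) (p ++ c :: V)) :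
    Derivable identitiesK (p ++ r ++ y :: c :: B) (p ++ r ++ c :: y :: B) := by
  obtain ⟨hy, hc⟩ := (detectsLinearLetters_langK hd).count_eq_three hyc hcr h hu hv
  by_cases hyB : y ∈ B <;> by_cases hcB : c ∈ B
  · exact derivable_swap_of_mem_after hyB hcB hyc _
  · exact derivable_swap_of_mem_of_not_mem hd hcr hyc hu hv h hyB hcB
  · exact derivable_swap_of_not_mem_of_mem hd hcr hyc hu hv h hyB hcB
  · exact derivable_swap_of_two_le_count_of_two_le_count hyc (by grind) (by grind)

theorem derivable_of_unseparated_langK (hd : [a, b, t].Nodup)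
    (hsound : ∀ {u v}, Derivable identitiesK u v → Unseparated (LangK a b t) u v) (v : List ℕ) :
    ∀ p u : List ℕ, Reduced (p ++ u) → Reduced (p ++ v) →
      Unseparated (LangK a b t) (p ++ u) (p ++ v) → Derivable identitiesK (p ++ u) (p ++ v) := by
  have hperm {p u v : List ℕ} (hu : Reduced (p ++ u)) (hv : Reduced (p ++ v))
      (h : Unseparated (LangK a b t) (p ++ u) (p ++ v)) : u.Perm v :=
    (List.perm_append_left_iff p).1
      (List.perm_iff_count.2 ((detectsLinearLetters_langK hd).count_eq h hu hv))
  induction v with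
  | nil =>
    intro p u hu hv h
    rw [(hperm hu hv h).eq_nil]
    exact Derivable.refl _
  | cons c V ih =>
    intro p u hu hv h
    have hcu : c ∈ u := (hperm hu hv h).mem_iff.2 List.mem_cons_self
    obtain ⟨r, B, rfl, hcr⟩ := List.eq_append_cons_of_mem hcu
    have hmove := derivable_move_left hsound (fun r y B hcr hyc hu h =>
      derivable_swap_of_unseparated_langK hd hcr hyc hu hv h) r B hcr hu h
    have hrest := ih (p ++ [c]) (r ++ B)
      (by simpa using hu.of_perm (List.Perm.append_left p List.perm_middle)) (by simpa using hv)
      (by simpa using (hsound hmove).symm.trans h)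
    exact hmove.trans (by simpa using hrest)

theorem varietyK_eq (hd : [a, b, t].Nodup) :
    varietyK.{w} = generatedVariety.{w} (MTau (tauOne ⊓ zetaCon)
        (conClass (tauOne ⊓ zetaCon) (letter a * letter t * letter b ^ 2 * letter a))) ∧
      generatedVariety.{w} (MTau (tauOne ⊓ zetaCon)
        (conClass (tauOne ⊓ zetaCon) (letter a * letter t * letter b ^ 2 * letter a))) =
      generatedVariety.{w}
        (SyntacticMonoid ({letter a} * {letter t} * {letter b} * plus b * plus a)) := by
  have hsound : ∀ e ∈ identitiesK, Satisfies (MTau (tauOne ⊓ zetaCon) (conClass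
      (tauOne ⊓ zetaCon) (letter a * letter t * letter b ^ 2 * letter a))) e :=
    fun e he => identitiesK_sound hd he
  have hL (w : Word) : w ∈ conClass (tauOne ⊓ zetaCon)
      (letter a * letter t * letter b ^ 2 * letter a) ↔ LangK a b t w.toList := by
    rw [conClass_languageK hd, mem_languageK_iff]
  have hsound' : ∀ e ∈ identitiesK, Satisfies (SyntacticMonoid (conClass
      (tauOne ⊓ zetaCon) (letter a * letter t * letter b ^ 2 * letter a))) e :=
    fun e he => (hsound e he).quotient_mono (reesCon_le_syntacticCon _ _)
  have hvar := varOf_eq_MTau_and_syntacticMonoid.{w} hsound fun u v =>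
    derivCon_of_satisfies hL hsound' hasRepetitionIdentities_identitiesK fun u v hu hv =>
      derivable_of_unseparated_langK hd (fun h => h.unseparated hL hsound') v [] u hu hv
  rw [← conClass_languageK hd]
  exact hvar

end LangK

/-! ### Completeness of the identities of `J` -/

section IdentitiesJ

theorem hasRepetitionIdentities_identitiesJ : HasRepetitionIdentities identitiesJ :=
  ⟨by simp [identitiesJ], by simp [identitiesJ]⟩

theorem derivable_swap_of_mem_before {x y : ℕ} {A : List ℕ} (hx : x ∈ A) (hy : y ∈ A)
    (hxy : x ≠ y) (B : List ℕ) : Derivable identitiesJ (A ++ x :: y :: B) (A ++ y :: x :: B) := by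
  have swap (x y : ℕ) (A₁ A₂ A₃ : List ℕ) :
      Derivable identitiesJ (A₁ ++ x :: (A₂ ++ y :: A₃) ++ x :: y :: B)
        (A₁ ++ x :: (A₂ ++ y :: A₃) ++ y :: x :: B) := by
    have hmem : (letter 0 * letter 2 * letter 1 * letter 3 * letter 0 * letter 1,
        letter 0 * letter 2 * letter 1 * letter 3 * letter 1 * letter 0) ∈ identitiesJ := by
      simp [identitiesJ]
    simpa [subst4] using derivable_of_mem hmem (subst4 [x] [y] A₂ A₃) A₁ B
  obtain ⟨A₁, A₂, rfl⟩ := List.append_of_mem hx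
  rcases List.mem_append.1 hy with hy | hy
  · obtain ⟨A₃, A₄, rfl⟩ := List.append_of_mem hy
    simpa using (swap y x A₃ A₄ A₂).symm
  · obtain ⟨A₃, A₄, rfl⟩ := List.append_of_mem ((List.mem_cons.1 hy).resolve_left hxy.symm)
    exact swap x y A₁ A₃ A₄

theorem derivable_swap_of_two_le_count_of_mem {x y : ℕ} {A B : List ℕ} (hx : 2 ≤ A.count x)
    (hy : y ∈ B) : Derivable identitiesJ (A ++ x :: y :: B) (A ++ y :: x :: B) := by
  have hmem : (letter 0 * letter 2 * letter 0 * letter 1 * letter 0 * letter 3 * letter 1,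
      letter 0 * letter 2 * letter 0 ^ 2 * letter 1 * letter 3 * letter 1) ∈ identitiesJ := by
    simp [identitiesJ]
  have xy_xxy : Derivable identitiesJ (A ++ x :: y :: B) (A ++ x :: x :: y :: B) :=
    hasRepetitionIdentities_identitiesJ.derivable_append_dup (List.count_pos_iff.1 (by omega)) _
  have xyx_xxy : Derivable identitiesJ (A ++ x :: y :: x :: B) (A ++ x :: x :: y :: B) := by
    obtain ⟨A₁, A₂, A₃, rfl, -, -⟩ := exists_split_first_two_of_two_le_count hx
    obtain ⟨B₁, B₂, rfl⟩ := List.append_of_mem hy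
    simpa [subst4, pow_two] using
      derivable_of_mem hmem (subst4 [x] [y] (A₂ ++ x :: A₃) B₁) A₁ B₂
  have yx_xyx : Derivable identitiesJ (A ++ y :: x :: B) (A ++ x :: y :: x :: B) :=
    hasRepetitionIdentities_identitiesJ.derivable_insert hx (by simp)
  exact xy_xxy.trans (xyx_xxy.symm.trans yx_xyx.symm)

theorem derivable_swap_of_adjacent_after (A B₁ B₂ : List ℕ) (x y : ℕ) :
    Derivable identitiesJ (A ++ x :: y :: (B₁ ++ x :: y :: B₂))
      (A ++ y :: x :: (B₁ ++ x :: y :: B₂)) := by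
  have hmem : (letter 0 * letter 1 * letter 2 * letter 0 * letter 1,
      letter 1 * letter 0 * letter 2 * letter 0 * letter 1) ∈ identitiesJ := by
    simp [identitiesJ]
  simpa [subst4] using derivable_of_mem hmem (subst4 [x] [y] B₁ []) A B₂

theorem derivable_move_right {x : ℕ} {B : List ℕ} (R : List ℕ) : ∀ A : List ℕ, 2 ≤ A.count x →
    (∀ z ∈ R, 2 ≤ (A ++ (R ++ B)).count z) →
    Derivable identitiesJ (A ++ x :: (R ++ B)) (A ++ (R ++ x :: B)) := by
  induction R with
  | nil => intro A _ _; exact Derivable.refl _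
  | cons z R ih =>
    intro A hx hR
    have hswap : Derivable identitiesJ (A ++ x :: z :: (R ++ B)) (A ++ z :: x :: (R ++ B)) := by
      by_cases hzx : z = x
      · rw [hzx]; exact Derivable.refl _
      by_cases hzA : z ∈ A
      · exact derivable_swap_of_mem_before (List.count_pos_iff.1 (by omega)) hzA (Ne.symm hzx) _
      · have hz := hR z List.mem_cons_self
        rw [List.count_append, List.count_eq_zero_of_not_mem hzA, List.cons_append,
          List.count_cons_self] at hz
        exact derivable_swap_of_two_le_count_of_mem hx (List.count_pos_iff.1 (by omega))
    have hmove := ih (A ++ [z]) (by rw [List.count_append]; omega)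
      (fun w hw => by simpa using hR w (List.mem_cons_of_mem _ hw))
    exact Derivable.trans (by simpa using hswap) (by simpa using hmove)

/-- A sufficient condition for the identities of `J` to allow the insertion of the letter `z`
between `Q` and `S`. -/
def Insertable (Q S : List ℕ) (z : ℕ) : Prop :=
  (2 ≤ Q.count z ∧ z ∈ S) ∨
    ∃ Q₁ R, Q = Q₁ ++ z :: R ∧ z ∈ Q₁ ∧ ∀ k ∈ R, 2 ≤ (Q ++ S).count k

theorem Insertable.derivable {Q S : List ℕ} {z : ℕ} (h : Insertable Q S z) :
    Derivable identitiesJ (Q ++ S) (Q ++ z :: S) := by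
  rcases h with ⟨hQ, hS⟩ | ⟨Q₁, R, rfl, hzQ₁, hR⟩
  · exact hasRepetitionIdentities_identitiesJ.derivable_insert hQ hS
  · have hdup := hasRepetitionIdentities_identitiesJ.derivable_append_dup hzQ₁ (R ++ S)
    have hcount : 2 ≤ (Q₁ ++ [z]).count z := by
      rw [List.count_append, List.count_singleton_self]
      exact Nat.succ_le_succ (List.count_pos_iff.2 hzQ₁)
    have hmove := derivable_move_right (x := z) (B := S) R (Q₁ ++ [z]) hcount
      (fun k hk => by simpa using hR k hk)
    exact Derivable.trans (by simpa using hdup) (by simpa using hmove)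

theorem derivable_insert_list {Q S : List ℕ} (E : List ℕ) (h : ∀ z ∈ E, Insertable Q S z) :
    Derivable identitiesJ (Q ++ S) (Q ++ (E ++ S)) := by
  induction E with
  | nil => exact Derivable.refl _
  | cons z E ih =>
    refine (ih fun w hw => h w (List.mem_cons_of_mem _ hw)).trans ?_
    apply Insertable.derivable
    rcases h z List.mem_cons_self with ⟨hQ, hS⟩ | ⟨Q₁, R, hQ, hzQ₁, hR⟩
    · exact Or.inl ⟨hQ, List.mem_append_right _ hS⟩
    · refine Or.inr ⟨Q₁, R, hQ, hzQ₁, fun k hk => (hR k hk).trans ?_⟩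
      simp only [List.count_append]
      omega

theorem insertable_of_mem {X r Y S : List ℕ} {z : ℕ} (hz : z ∈ r) (hcount : 2 ≤ (X ++ r).count z)
    (h : ∀ k ∈ r ++ Y, 2 ≤ (X ++ (r ++ Y) ++ S).count k) : Insertable (X ++ (r ++ Y)) S z := by
  right
  by_cases hX : z ∈ X
  · obtain ⟨r₁, r₂, rfl⟩ := List.append_of_mem hz
    refine ⟨X ++ r₁, r₂ ++ Y, by simp, by simp [hX], fun k hk => h k ?_⟩
    simp only [List.mem_append, List.mem_cons] at hk ⊢
    tauto
  · rw [List.count_append, List.count_eq_zero_of_not_mem hX, Nat.zero_add] at hcount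
    obtain ⟨r₁, r₂, r₃, rfl, -, -⟩ := exists_split_first_two_of_two_le_count hcount
    refine ⟨X ++ r₁ ++ z :: r₂, r₃ ++ Y, by simp, by simp, fun k hk => h k ?_⟩
    simp only [List.mem_append, List.mem_cons] at hk ⊢
    tauto

theorem exists_eq_flatten_ofFn_of_sublist {α : Type*} {l S : List α} (h : l.Sublist S) :
    ∃ (B : ℕ → List α) (R : List α),
      S = (List.ofFn fun i : Fin l.length => B i ++ [l.get i]).flatten ++ R := by
  induction h with
  | slnil => exact ⟨fun _ => [], [], rfl⟩
  | @cons l S x h ih =>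
    obtain ⟨B, R, rfl⟩ := ih
    cases l with
    | nil => exact ⟨fun _ => [], x :: R, by simp⟩
    | cons y l =>
      refine ⟨fun i => if i = 0 then x :: B 0 else B i, R, ?_⟩
      simp [List.ofFn_succ]
  | @cons_cons l S x h ih =>
    obtain ⟨B, R, rfl⟩ := ih
    refine ⟨fun i => if i = 0 then [] else B (i - 1), R, ?_⟩
    simp [List.ofFn_succ]

theorem exists_eq_ofFn_get_of_perm {α : Type*} {l r : List α} (h : r.Perm l) :
    ∃ ρ : Equiv.Perm (Fin l.length), r = List.ofFn fun i => l.get (ρ i) := by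
  classical
  let e : Fin r.length ≃ Fin l.length :=
    ⟨h.idxBij, h.symm.idxBij, h.idxBij_rightInverse_idxBij_symm, h.idxBij_leftInverse_idxBij_symm⟩
  refine ⟨(finCongr h.length_eq).symm.trans e, List.ext_get (by simp [h.length_eq]) ?_⟩
  intro n hn _
  rw [List.get_ofFn]
  exact (h.getElem_idxBij_eq_getElem ⟨n, hn⟩).symm

theorem prod_ofFn_letter {n : ℕ} (f : Fin n → ℕ) :
    (List.ofFn fun i => letter (f i)).prod = FreeMonoid.ofList (List.ofFn f) := by
  have hmap := FreeMonoid.lift_ofList letter (List.ofFn f)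
  rw [List.map_ofFn] at hmap
  exact hmap.symm.trans (DFunLike.congr_fun (FreeMonoid.lift_restrict (MonoidHom.id Word)) _)

/-- The substitution into `w_n(1, ρ)`, where `n` is the length of `l`, that sends `x` to `c`,
`z_{n+i}` and `t_{n+i}` to the `i`-th letter of `l` and to `B i`, and erases `z₁, t₁, …, zₙ, tₙ`. -/
def pullSubst (c : ℕ) (l : List ℕ) (B : ℕ → List ℕ) : Word →* Word :=
  FreeMonoid.lift fun k => if k = 0 then letter c else
    if k ≤ 2 * l.length then 1 else
      if k % 2 = 0 then FreeMonoid.ofList (B ((k - 2) / 2 - l.length)) else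
        letter (l.getD ((k - 1) / 2 - l.length) 0)

section PullSubst

variable (c : ℕ) (l : List ℕ) (B : ℕ → List ℕ)

theorem pullSubst_zero : pullSubst c l B (letter 0) = letter c := by
  simp [pullSubst]

theorem pullSubst_erased {k : ℕ} (hpos : 0 < k) (hk : k ≤ 2 * l.length) :
    pullSubst c l B (letter k) = 1 := by
  rw [pullSubst, FreeMonoid.lift_eval_of, if_neg (by omega), if_pos hk]

theorem pullSubst_z (i : Fin l.length) :
    pullSubst c l B (letter (2 * (l.length + i) + 1)) = letter (l.get i) := by
  have hi : (2 * (l.length + (i : ℕ)) + 1 - 1) / 2 - l.length = i := by omega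
  rw [pullSubst, FreeMonoid.lift_eval_of, if_neg (by omega), if_neg (by omega), if_neg (by omega),
    hi, List.getD_eq_getElem _ _ i.2, List.get_eq_getElem]

theorem pullSubst_t (i : Fin l.length) :
    pullSubst c l B (letter (2 * (l.length + i) + 2)) = FreeMonoid.ofList (B i) := by
  have hi : (2 * (l.length + (i : ℕ)) + 2 - 2) / 2 - l.length = i := by omega
  rw [pullSubst, FreeMonoid.lift_eval_of, if_neg (by omega), if_neg (by omega), if_pos (by omega),
    hi]

theorem pullSubst_prefix :
    pullSubst c l B (List.ofFn fun i : Fin l.length =>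
      letter (2 * i + 1) * letter (2 * i + 2)).prod = 1 := by
  rw [map_list_prod, List.map_ofFn]
  refine List.prod_eq_one fun x hx => ?_
  obtain ⟨i, rfl⟩ := List.mem_ofFn.1 hx
  rw [Function.comp_apply, map_mul, pullSubst_erased c l B (by omega) (by omega),
    pullSubst_erased c l B (by omega) (by omega), one_mul]

theorem pullSubst_middle (ρ : Equiv.Perm (Fin l.length)) :
    pullSubst c l B (List.ofFn fun i : Fin l.length =>
      letter (2 * ((1 : Equiv.Perm (Fin l.length)) i) + 1) *
        letter (2 * (l.length + ρ i) + 1)).prod =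
      FreeMonoid.ofList (List.ofFn fun i => l.get (ρ i)) := by
  rw [map_list_prod, List.map_ofFn, ← prod_ofFn_letter]
  congr 2
  funext i
  rw [Function.comp_apply, map_mul, pullSubst_z, pullSubst_erased c l B (by omega) (by omega),
    one_mul]

theorem pullSubst_suffix :
    pullSubst c l B (List.ofFn fun i : Fin l.length =>
      letter (2 * (l.length + i) + 2) * letter (2 * (l.length + i) + 1)).prod =
      FreeMonoid.ofList (List.ofFn fun i : Fin l.length => B i ++ [l.get i]).flatten := by
  rw [map_list_prod, List.map_ofFn, FreeMonoid.ofList_flatten, List.map_ofFn]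
  congr 2
  funext i
  rw [Function.comp_apply, map_mul, pullSubst_z, pullSubst_t]
  rfl

end PullSubst

theorem derivable_pull_of_subperm {r S : List ℕ} (h : r.Subperm S) (P : List ℕ) (c : ℕ) :
    Derivable identitiesJ (P ++ c :: (r ++ c :: S)) (P ++ c :: c :: (r ++ S)) := by
  obtain ⟨l, hlr, hlS⟩ := h
  obtain ⟨B, R, rfl⟩ := exists_eq_flatten_ofFn_of_sublist hlS
  obtain ⟨ρ, rfl⟩ := exists_eq_ofFn_get_of_perm hlr.symm
  have hmem : (jLeft l.length 1 ρ, jRight l.length 1 ρ) ∈ identitiesJ := Or.inr ⟨_, _, _, rfl⟩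
  have himage := derivCon_map hmem (pullSubst c l B)
  simp only [jLeft, jRight, map_mul, pullSubst_zero, pullSubst_prefix, pullSubst_middle,
    pullSubst_suffix, one_mul, pow_two] at himage
  have hcontext := (derivCon identitiesJ).mul ((derivCon identitiesJ).mul
    ((derivCon identitiesJ).refl (FreeMonoid.ofList P)) himage)
    ((derivCon identitiesJ).refl (FreeMonoid.ofList R))
  simp only [mul_assoc] at hcontext
  exact hcontext

theorem derivable_pull {P r S : List ℕ} {c : ℕ} (hc : c ∉ r)
    (h : ∀ k ∈ r, 2 ≤ (P ++ c :: (r ++ c :: S)).count k) :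
    Derivable identitiesJ (P ++ c :: (r ++ c :: S)) (P ++ c :: c :: (r ++ S)) := by
  set E := r.filter (fun z => 2 ≤ (P ++ r).count z) with hE
  have hmemE : ∀ z ∈ E, z ∈ r ∧ 2 ≤ (P ++ r).count z := fun z hz => by simpa [hE] using hz
  have insert_left : Derivable identitiesJ (P ++ c :: (r ++ c :: S))
      (P ++ c :: (r ++ c :: (E ++ S))) := by
    have hins (z : ℕ) (hz : z ∈ E) : Insertable ((P ++ [c]) ++ (r ++ [c])) S z :=
      insertable_of_mem (hmemE z hz).1 (by have := (hmemE z hz).2; grind) fun k hk => by grind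
    simpa using derivable_insert_list E hins
  have insert_right : Derivable identitiesJ (P ++ c :: c :: (r ++ S))
      (P ++ c :: c :: (r ++ (E ++ S))) := by
    have hins (z : ℕ) (hz : z ∈ E) : Insertable ((P ++ [c, c]) ++ (r ++ [])) S z :=
      insertable_of_mem (hmemE z hz).1 (by have := (hmemE z hz).2; grind) fun k hk => by
        have := h k (by simpa using hk)
        grind
    simpa using derivable_insert_list E hins
  refine insert_left.trans ((derivable_pull_of_subperm ?_ P c).trans insert_right.symm)
  rw [List.subperm_ext_iff]
  intro y hy
  by_cases hyE : 2 ≤ (P ++ r).count y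
  · rw [List.count_append, hE, List.count_filter (by simpa using hyE)]
    omega
  · have hcount := h y hy
    have hcy : c ≠ y := fun hcy => hc (hcy ▸ hy)
    simp only [List.count_append, List.count_cons_of_ne hcy] at hcount hyE ⊢
    omega

end IdentitiesJ

section LangJ

variable {a b t s : ℕ}

theorem LangJ.of_pos {i j : ℕ} (hi : 0 < i) (hj : 0 < j) :
    LangJ a b t s (a :: t :: b :: (List.replicate i a ++ s :: List.replicate j b)) :=
  ⟨i - 1, j - 1, by rw [Nat.sub_add_cancel hi, Nat.sub_add_cancel hj]⟩

theorem LangJ.count_eq_one (hd : [a, b, t, s].Nodup) {w : List ℕ} (h : LangJ a b t s w) :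
    w.count t = 1 := by
  obtain ⟨i, j, rfl⟩ := h
  simp only [List.nodup_cons, List.mem_cons, not_or] at hd
  simp [List.count_replicate, hd, Ne.symm hd.2.2.1.1]

theorem LangJ.two_le_count {w : List ℕ} (h : LangJ a b t s w) : 2 ≤ w.count a := by
  obtain ⟨i, j, rfl⟩ := h
  simp only [List.count_cons, List.count_append, List.count_replicate_self, beq_self_eq_true,
    if_true]
  omega

theorem LangJ.exists_split (hd : [a, b, t, s].Nodup) {X Y : List ℕ}
    (h : LangJ a b t s (X ++ s :: Y)) :
    ∃ i j, X = a :: t :: b :: List.replicate (i + 1) a ∧ Y = List.replicate (j + 1) b := by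
  obtain ⟨i, j, h⟩ := h
  obtain ⟨⟨-, -, has⟩, ⟨-, hbs⟩, hts⟩ :
      (a ≠ b ∧ a ≠ t ∧ a ≠ s) ∧ (b ≠ t ∧ b ≠ s) ∧ t ≠ s := by simpa using hd
  obtain ⟨hX, -, hY⟩ := (List.append_cons_inj_of_notMem
    (x₁ := a :: t :: b :: List.replicate (i + 1) a) (z₁ := List.replicate (j + 1) b)
    (by simp [has.symm, hts.symm, hbs.symm]) (by simp [hbs.symm])).1 h.symm
  exact ⟨i, j, hX.symm, hY.symm⟩

theorem LangJ.not_mem_around (hd : [a, b, t, s].Nodup) {X Y : List ℕ}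
    (h : LangJ a b t s (a :: t :: b :: X ++ s :: Y)) : b ∉ X ∧ a ∉ Y := by
  have hab : a ≠ b := by simp_all
  obtain ⟨i, j, hX, rfl⟩ := LangJ.exists_split hd h
  simp only [List.cons.injEq, true_and] at hX
  subst hX
  exact ⟨fun hb => hab (List.eq_of_mem_replicate hb).symm,
    fun ha => hab (List.eq_of_mem_replicate ha)⟩

theorem LangJ.eq_one_of_replicate_append (hat : a ≠ t) {n : ℕ} {Y : List ℕ}
    (h : LangJ a b t s (List.replicate n a ++ t :: Y)) : n = 1 := by
  obtain ⟨i, j, h⟩ := h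
  rcases n with _ | _ | n
  · exact absurd (List.cons.inj h).1.symm hat
  · rfl
  · exact absurd (List.cons.inj (List.cons.inj h).2).1 hat

theorem LangJ.mem_prefix (hab : a ≠ b) (hat : a ≠ t) {X Y : List ℕ}
    (h : LangJ a b t s (X ++ a :: Y)) (hX : a ∈ X) : b ∈ X := by
  obtain ⟨i, j, h⟩ := h
  rcases X with _ | ⟨x₁, _ | ⟨x₂, _ | ⟨x₃, X⟩⟩⟩
  · simp at hX
  · exact absurd (List.cons.inj (List.cons.inj h).2).1 hat
  · exact absurd (List.cons.inj (List.cons.inj (List.cons.inj h).2).2).1 hab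
  · have hx₃ : x₃ = b := (List.cons.inj (List.cons.inj (List.cons.inj h).2).2).1
    simp [hx₃]

theorem detectsLinearLetters_langJ (hd : [a, b, t, s].Nodup) :
    DetectsLinearLetters (LangJ a b t s) := by
  obtain ⟨⟨hab, hat, has⟩, ⟨hbt, -⟩, hts⟩ :
      (a ≠ b ∧ a ≠ t ∧ a ≠ s) ∧ (b ≠ t ∧ b ≠ s) ∧ t ≠ s := by simpa using hd
  have hblocks {i j : ℕ} := LangJ.of_pos (a := a) (b := b) (t := t) (s := s) (i := i) (j := j)
  constructor
  case count_eq_one =>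
    intro u v x h hx
    have hv := (h.replicate_count x t [a] [b, a, s, b]).1 (by
      simpa [hx] using hblocks (i := 1) (j := 1) one_pos one_pos)
    simpa [hat, hbt, hts.symm] using hv.count_eq_one hd
  case mem =>
    intro u v x h hx
    have hv := (h.replicate_count x a [a, t, b] [s, b]).1 (by
      simpa using hblocks (j := 1) (List.count_pos_iff.2 hx) one_pos)
    simpa [hab.symm, hat.symm, has.symm] using hv.two_le_count
  case not_mem_after =>
    intro u₁ u₂ v₁ v₂ l y h hyl h₁ h₂ h₃ h₄ hy hyv
    have hv := (h.replicate_count_linear hyl h₁ h₂ h₃ h₄ a [s, b] [a, t, b, a] []).1 (by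
      simpa [List.replicate_succ, List.count_eq_zero_of_not_mem hy] using
        hblocks (i := u₁.count y + 1) (j := 1) (Nat.succ_pos _) one_pos)
    refine (LangJ.not_mem_around hd (X := a :: List.replicate (v₁.count y) a)
      (Y := b :: List.replicate (v₂.count y) a) (by simpa using hv)).2 ?_
    simp [List.mem_replicate, (List.count_pos_iff.2 hyv).ne']
  case not_mem_before =>
    intro u₁ u₂ v₁ v₂ l y h hyl h₁ h₂ h₃ h₄ hy hyv
    have hv := (h.replicate_count_linear hyl h₁ h₂ h₃ h₄ b [s] [a, t, b, a] [b]).1 (by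
      simpa [List.replicate_succ', List.count_eq_zero_of_not_mem hy] using
        hblocks (i := 1) (j := u₂.count y + 1) one_pos (Nat.succ_pos _))
    refine (LangJ.not_mem_around hd (X := a :: List.replicate (v₁.count y) b)
      (Y := List.replicate (v₂.count y) b ++ [b]) (by simpa using hv)).1 ?_
    simp [List.mem_replicate, (List.count_pos_iff.2 hyv).ne']
  case count_before =>
    intro u₁ u₂ v₁ v₂ l y h hyl h₁ h₂ h₃ h₄ hy _
    have hv := (h.replicate_count_linear hyl h₁ h₂ h₃ h₄ a [t, b, a] [] [s, b]).1 (by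
      simpa [hy, List.replicate_succ] using
        hblocks (i := u₂.count y + 1) (j := 1) (Nat.succ_pos _) one_pos)
    exact LangJ.eq_one_of_replicate_append hat (by simpa using hv)

theorem LangJ.mem_before_of_unseparated (hd : [a, b, t, s].Nodup) {U₁ U₂ U₃ V₁ V₂ : List ℕ}
    {x y l : ℕ} (hxy : x ≠ y) (hlx : l ≠ x)
    (h : Unseparated (LangJ a b t s) (U₁ ++ y :: (U₂ ++ l :: U₃)) (V₁ ++ x :: V₂))
    (hl : l ∉ U₁ ++ y :: (U₂ ++ U₃)) (hx : x ∉ U₁ ++ U₃) (hy : y ∉ U₁ ++ U₂) (hxU₂ : x ∈ U₂)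
    (hyU₃ : y ∈ U₃) : y ∈ V₁ := by
  obtain ⟨⟨hab, hat, -⟩, ⟨hbt, hbs⟩, -⟩ :
      (a ≠ b ∧ a ≠ t ∧ a ≠ s) ∧ (b ≠ t ∧ b ≠ s) ∧ t ≠ s := by simpa using hd
  simp only [List.mem_append, List.mem_cons, not_or] at hl hx hy
  set g := substOf [(x, [a]), (y, [b]), (l, [s])] with hg
  have hgx : g x = [a] := by simp [hg, substOf]
  have hgy : g y = [b] := by simp [hg, substOf, hxy.symm]
  have hgl : g l = [s] := by simp [hg, substOf, hlx, hl.2.1]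
  have hU₁ : U₁.flatMap g = [] := List.flatMap_eq_nil_iff.2 fun z hz => by
    simp [hg, substOf, ne_of_mem_of_not_mem hz hx.1, ne_of_mem_of_not_mem hz hy.1,
      ne_of_mem_of_not_mem hz hl.1]
  have hU₂ : U₂.flatMap g = List.replicate (U₂.count x) a :=
    flatMap_eq_replicate hgx fun z hz hzx => by
      simp [hg, substOf, hzx, ne_of_mem_of_not_mem hz hy.2, ne_of_mem_of_not_mem hz hl.2.2.1]
  have hU₃ : U₃.flatMap g = List.replicate (U₃.count y) b :=
    flatMap_eq_replicate hgy fun z hz hzy => by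
      simp [hg, substOf, hzy, ne_of_mem_of_not_mem hz hx.2, ne_of_mem_of_not_mem hz hl.2.2.2]
  have hV := (h g [a, t] []).1 (by
    simpa [hgy, hgl, hU₁, hU₂, hU₃] using LangJ.of_pos (a := a) (b := b) (t := t) (s := s)
      (List.count_pos_iff.2 hxU₂) (List.count_pos_iff.2 hyU₃))
  rw [List.flatMap_append, List.flatMap_cons, hgx] at hV
  have hb := LangJ.mem_prefix hab hat (X := [a, t] ++ V₁.flatMap g) (by simpa using hV) (by simp)
  obtain ⟨z, hz, hbz⟩ : ∃ z ∈ V₁, b ∈ g z := by simpa [hab.symm, hbt] using hb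
  obtain rfl : z = y := by
    simp only [hg, substOf] at hbz
    grind
  exact hz

theorem LangJ.mem_before_of_unseparated_linear (hd : [a, b, t, s].Nodup)
    {U₁ U₂ U₃ U₄ V₁ V₂ : List ℕ} {x y k l : ℕ} (hxy : x ≠ y) (hkl : k ≠ l)
    (h : Unseparated (LangJ a b t s) (U₁ ++ k :: (U₂ ++ y :: (U₃ ++ l :: U₄))) (V₁ ++ x :: V₂))
    (hk : k ∉ x :: y :: (U₁ ++ U₂ ++ U₃ ++ U₄)) (hl : l ∉ x :: y :: (U₁ ++ U₂ ++ U₃ ++ U₄))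
    (hxU₁ : U₁.count x = 1) (hx : x ∉ U₂ ++ U₄) (hy : y ∉ U₁ ++ U₂ ++ U₃) (hxU₃ : x ∈ U₃)
    (hyU₄ : y ∈ U₄) (hxV₁ : x ∈ V₁) : y ∈ V₁ := by
  obtain ⟨⟨hab, hat, -⟩, ⟨hbt, -⟩, -⟩ :
      (a ≠ b ∧ a ≠ t ∧ a ≠ s) ∧ (b ≠ t ∧ b ≠ s) ∧ t ≠ s := by simpa using hd
  simp only [List.mem_append, List.mem_cons, not_or] at hl hx hy hk
  set g := substOf [(x, [a]), (y, [b]), (l, [s]), (k, [t])] with hg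
  have hgx : g x = [a] := by simp [hg, substOf]
  have hgy : g y = [b] := by simp [hg, substOf, hxy.symm]
  have hgl : g l = [s] := by simp [hg, substOf, hl.1, hl.2.1]
  have hgk : g k = [t] := by simp [hg, substOf, hk.1, hk.2.1, hkl]
  have hmap {z c : ℕ} {U : List ℕ} (hgz : g z = [c])
      (hU : ∀ w ∈ U, w ≠ z → w ≠ x ∧ w ≠ y) (hlU : l ∉ U) (hkU : k ∉ U) :
      U.flatMap g = List.replicate (U.count z) c :=
    flatMap_eq_replicate hgz fun w hw hwz => by
      simp [hg, substOf, hU w hw hwz, ne_of_mem_of_not_mem hw hlU, ne_of_mem_of_not_mem hw hkU]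
  have hU₁ : U₁.flatMap g = [a] := by
    rw [hmap hgx (by grind) hl.2.2.1.1.1 hk.2.2.1.1.1, hxU₁, List.replicate_one]
  have hU₂ : U₂.flatMap g = [] := by
    rw [hmap hgx (by grind) hl.2.2.1.1.2 hk.2.2.1.1.2, List.count_eq_zero_of_not_mem hx.1,
      List.replicate_zero]
  have hV := (h g [] []).1 (by
    simpa [hgx, hgy, hgl, hgk, hU₁, hU₂, hmap hgx (by grind) hl.2.2.1.2 hk.2.2.1.2,
      hmap hgy (by grind) hl.2.2.2 hk.2.2.2] using LangJ.of_pos (a := a) (b := b) (t := t)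
        (s := s) (List.count_pos_iff.2 hxU₃) (List.count_pos_iff.2 hyU₄))
  rw [List.flatMap_append, List.flatMap_cons, hgx] at hV
  have hb := LangJ.mem_prefix hab hat (X := V₁.flatMap g) (by simpa using hV)
    (List.mem_flatMap.2 ⟨x, hxV₁, by simp [hgx]⟩)
  obtain ⟨z, hz, hbz⟩ := List.mem_flatMap.1 hb
  obtain rfl : z = y := by
    simp only [hg, substOf] at hbz
    grind
  exact hz

end LangJ

/-- Each letter that occurs exactly once in `p` is separated by a linear letter from its first
occurrence in `q`: the invariant that makes the swaps in the sorting procedure for `J` derivable. -/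
def Spread (p q : List ℕ) : Prop :=
  ∀ y p₁ p₂ q₁ q₂, p = p₁ ++ y :: p₂ → q = q₁ ++ y :: q₂ → y ∉ p₁ ++ p₂ ++ q₁ →
    ∃ k ∈ p₂ ++ q₁, (p ++ q).count k = 1

theorem DetectsLinearLetters.count_lt_count_of_mem {L : List ℕ → Prop}
    (hL : DetectsLinearLetters L) {A B V₁ V₂ : List ℕ} {y c k : ℕ} (hky : k ≠ y)
    (hkc : k ≠ c) (h : Unseparated L (A ++ y :: c :: B) (V₁ ++ k :: V₂))
    (hu : Reduced (A ++ y :: c :: B)) (hv : Reduced (V₁ ++ k :: V₂))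
    (hk : (A ++ y :: c :: B).count k = 1) (hcA : c ∉ A) (hcV₁ : c ∈ V₁) :
    A.count y < V₁.count y := by
  have hkmem : k ∈ A ∨ k ∈ B := by grind
  rcases hkmem with hkA | hkB
  · obtain ⟨A₁, A₂, rfl⟩ := List.append_of_mem hkA
    have hc := hL.count_prefix_eq (u₁ := A₁) (u₂ := A₂ ++ y :: c :: B) (by simpa using h)
      (by simpa using hu) hv (by simpa using hk) c
    grind
  · obtain ⟨B₁, B₂, rfl⟩ := List.append_of_mem hkB
    have hy := hL.count_prefix_eq (u₁ := A ++ y :: c :: B₁) (u₂ := B₂) (by simpa using h)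
      (by simpa using hu) hv (by simpa using hk) y
    grind

section LangJ

variable {a b t s : ℕ}

theorem LangJ.mem_before_of_spread (hd : [a, b, t, s].Nodup) {p A B W₁ W₂ : List ℕ} {y c l : ℕ}
    (hpV : Spread p (c :: (W₁ ++ l :: W₂))) (hyc : y ≠ c) (hu : Reduced (A ++ y :: c :: B))
    (hv : Reduced (p ++ c :: (W₁ ++ l :: W₂)))
    (h : Unseparated (LangJ a b t s) (A ++ y :: c :: B) (p ++ c :: (W₁ ++ l :: W₂)))
    (hl : l ∉ y :: c :: (p ++ W₁ ++ W₂)) (hc : c ∉ p ++ W₁) (hcW₂ : c ∈ W₂) (hyW₁ : y ∈ W₁)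
    (hyW₂ : y ∉ W₂) (hyp : p.count y ≤ 1) (hyA : p.count y ≤ A.count y) : c ∈ A := by
  have hdet := detectsLinearLetters_langJ hd
  by_cases hyp₀ : y ∈ p
  · obtain ⟨p₁, p₂, rfl⟩ := List.append_of_mem hyp₀
    obtain ⟨X, Y, rfl, hyX⟩ := List.eq_append_cons_of_mem hyW₁
    have hy : y ∉ p₁ ++ p₂ ++ c :: X := by grind
    obtain ⟨k, hk, hk₁⟩ := hpV y p₁ p₂ (c :: X) (Y ++ l :: W₂) rfl (by simp) hy
    have hky : k ≠ y := by grind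
    have hku := (hdet.count_eq h hu hv k).trans hk₁
    by_contra hcA
    have hkp₂ : k ∈ p₂ := by
      by_contra hkp₂
      have hkc : k ≠ c := by grind
      obtain ⟨X₁, X₂, rfl⟩ := List.append_of_mem (show k ∈ X by grind)
      have hlt := hdet.count_lt_count_of_mem hky hkc (V₁ := p₁ ++ y :: p₂ ++ c :: X₁)
        (V₂ := X₂ ++ y :: Y ++ l :: W₂) (by simpa using h) hu (by simpa using hv) hku hcA (by simp)
      grind
    obtain ⟨p₃, p₄, rfl⟩ := List.append_of_mem hkp₂
    refine hcA (LangJ.mem_before_of_unseparated_linear hd (U₁ := p₁ ++ y :: p₃) (U₂ := p₄)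
      (U₃ := X ++ y :: Y) (U₄ := W₂) (V₁ := A) (V₂ := c :: B) (k := k) (l := l) hyc ?_
      (by simpa using h.symm) ?_ ?_ ?_ ?_ ?_ (by simp) hcW₂ ?_)
    all_goals grind
  · exact LangJ.mem_before_of_unseparated hd (V₂ := c :: B) hyc (by grind) h.symm
      (by grind) (by grind) (by grind) hyW₁ hcW₂

theorem LangJ.count_ne_one_of_separates_left (hd : [a, b, t, s].Nodup)
    {p r V D₁ D₂ : List ℕ} {y c l : ℕ} (hpV : Spread p (c :: V)) (hyc : y ≠ c)
    (hu : Reduced (p ++ r ++ y :: c :: (D₁ ++ l :: D₂))) (hv : Reduced (p ++ c :: V))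
    (h : Unseparated (LangJ a b t s) (p ++ r ++ y :: c :: (D₁ ++ l :: D₂)) (p ++ c :: V))
    (hc : c ∉ p ++ r ++ D₁) (hyD₂ : y ∉ D₂) (hy : (p ++ r).count y ≤ 1) :
    (p ++ r ++ y :: c :: (D₁ ++ l :: D₂)).count l ≠ 1 := by
  intro hl
  have hdet := detectsLinearLetters_langJ hd
  obtain ⟨hyu, hcu⟩ := hdet.count_eq_three hyc (by grind) h hu hv
  have hyv := hdet.count_eq h hu hv y
  have hcv := hdet.count_eq h hu hv c
  have hlv := hdet.count_eq h hu hv l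
  obtain ⟨W₁, W₂, rfl⟩ := List.append_of_mem (show l ∈ V by grind)
  have hprefix := hdet.count_prefix_eq (u₁ := p ++ r ++ y :: c :: D₁) (u₂ := D₂)
    (v₁ := p ++ c :: W₁) (v₂ := W₂) (by simpa using h) (by simpa using hu) (by simpa using hv)
    (by simpa using hl)
  have hyW₁ := hprefix y
  have hcW₁ := hprefix c
  have hcpr : c ∉ p ++ r := by grind
  refine hcpr (LangJ.mem_before_of_spread hd hpV hyc hu hv h ?_ ?_ ?_ ?_ ?_ ?_ ?_)
  all_goals grind

theorem LangJ.count_ne_one_of_separates_right (hd : [a, b, t, s].Nodup)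
    {p r V D₁ D₂ : List ℕ} {y c l : ℕ} (hpV : Spread p (c :: V)) (hyc : y ≠ c) (hcr : c ∉ r)
    (hu : Reduced (p ++ r ++ y :: c :: (D₁ ++ l :: D₂))) (hv : Reduced (p ++ c :: V))
    (h : Unseparated (LangJ a b t s) (p ++ r ++ y :: c :: (D₁ ++ l :: D₂)) (p ++ c :: V))
    (hy : y ∉ p ++ r ++ D₁) (hcD₂ : c ∉ D₂) (hcp : p.count c ≤ 1) :
    (p ++ r ++ y :: c :: (D₁ ++ l :: D₂)).count l ≠ 1 := by
  intro hl
  have hdet := detectsLinearLetters_langJ hd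
  obtain ⟨hyu, hcu⟩ := hdet.count_eq_three hyc hcr h hu hv
  have hyD₂ : y ∈ D₂ := by grind
  have hyp : y ∉ p := by grind
  by_cases hcp₀ : c ∈ p
  · obtain ⟨p₁, p₂, rfl⟩ := List.append_of_mem hcp₀
    obtain ⟨k, hk, hk₁⟩ := hpV c p₁ p₂ [] V rfl rfl (by grind)
    rw [List.append_nil] at hk
    have hku := (hdet.count_eq h hu hv k).trans hk₁
    obtain ⟨p₃, p₄, rfl⟩ := List.append_of_mem hk
    have hkl : k ≠ l := by grind
    have hkc : k ≠ c := by grind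
    have hky : k ≠ y := by grind
    have hlc : l ≠ c := by grind
    have hly : l ≠ y := by grind
    refine hyp (LangJ.mem_before_of_unseparated_linear hd (U₁ := p₁ ++ c :: p₃) (U₂ := p₄ ++ r)
      (U₃ := c :: D₁) (U₄ := D₂) (V₂ := V) (k := k) (l := l) hyc.symm ?_ (by simpa using h)
      ?_ ?_ ?_ ?_ ?_ (by simp) hyD₂ (by simp))
    all_goals grind
  · refine hyp (LangJ.mem_before_of_unseparated hd (U₁ := p ++ r) (U₂ := c :: D₁) (U₃ := D₂)
      (V₂ := V) (x := c) (l := l) hyc.symm ?_ (by simpa using h) ?_ ?_ ?_ (by simp) hyD₂)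
    all_goals grind

end LangJ

theorem exists_split_last_of_mem {x : ℕ} {l : List ℕ} (h : x ∈ l) :
    ∃ l₁ l₂, l = l₁ ++ x :: l₂ ∧ x ∉ l₂ := by
  obtain ⟨l₁, l₂, hl, hx⟩ := List.eq_append_cons_of_mem (List.mem_reverse.2 h)
  exact ⟨l₂.reverse, l₁.reverse, by simpa using congrArg List.reverse hl, by simpa using hx⟩

theorem derivable_swap_of_insertable {A B₁ B₂ : List ℕ} {x y : ℕ}
    (hxy : Insertable (A ++ x :: y :: B₁) (y :: B₂) x)
    (hyx : Insertable (A ++ y :: x :: B₁) (y :: B₂) x) :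
    Derivable identitiesJ (A ++ x :: y :: (B₁ ++ y :: B₂)) (A ++ y :: x :: (B₁ ++ y :: B₂)) := by
  have hinsert := hxy.derivable
  have herase := hyx.derivable.symm
  simp only [List.append_assoc, List.cons_append] at hinsert herase
  exact (hinsert.trans (derivable_swap_of_adjacent_after A B₁ B₂ x y)).trans herase

theorem derivable_swap_or_separated {A B₁ B₂ : List ℕ} {x y : ℕ} (hy : y ∉ B₁) (hxy : x ≠ y)
    (hx : (A ++ (B₁ ++ y :: B₂)).count x = 2) (hAB : 1 ≤ A.count x + B₁.count x) :
    Derivable identitiesJ (A ++ x :: y :: (B₁ ++ y :: B₂)) (A ++ y :: x :: (B₁ ++ y :: B₂)) ∨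
      ∃ l D₁ D₂, B₁ ++ y :: B₂ = D₁ ++ l :: D₂ ∧
        (A ++ x :: y :: (B₁ ++ y :: B₂)).count l = 1 ∧ x ∈ D₁ ∧ x ∉ D₂ ∧ y ∉ D₁ := by
  by_cases hxB₂ : x ∈ B₂
  · left
    refine derivable_swap_of_insertable (Or.inl ⟨?_, List.mem_cons_of_mem _ hxB₂⟩)
      (Or.inl ⟨?_, List.mem_cons_of_mem _ hxB₂⟩)
    all_goals grind
  by_cases hxB₁ : x ∈ B₁
  · obtain ⟨D₁, D₂, rfl, hxD₂⟩ := exists_split_last_of_mem hxB₁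
    by_cases hD₂ : ∀ k ∈ D₂, 2 ≤ (A ++ x :: y :: (D₁ ++ x :: D₂ ++ y :: B₂)).count k
    · left
      refine derivable_swap_of_insertable (Or.inr ⟨A ++ x :: y :: D₁, D₂, by simp, by simp, ?_⟩)
        (Or.inr ⟨A ++ y :: x :: D₁, D₂, by simp, by simp, ?_⟩)
      all_goals grind
    · right
      push Not at hD₂
      obtain ⟨l, hl, hl₂⟩ := hD₂
      obtain ⟨D₃, D₄, rfl⟩ := List.append_of_mem hl
      exact ⟨l, D₁ ++ x :: D₃, D₄ ++ y :: B₂, by simp, by grind, by simp, by grind, by grind⟩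
  · exact Or.inl (derivable_swap_of_two_le_count_of_mem (by grind) (by simp))

section LangJ

variable {a b t s : ℕ}

theorem derivable_swap_of_count_pos_left (hd : [a, b, t, s].Nodup)
    {p r V B₁ B₂ : List ℕ} {y c : ℕ} (hpV : Spread p (c :: V)) (hyc : y ≠ c)
    (hu : Reduced (p ++ r ++ y :: c :: (B₁ ++ c :: B₂))) (hv : Reduced (p ++ c :: V))
    (h : Unseparated (LangJ a b t s) (p ++ r ++ y :: c :: (B₁ ++ c :: B₂)) (p ++ c :: V))
    (hc : c ∉ p ++ r ++ B₁) (hy : 1 ≤ (p ++ r).count y + B₁.count y) :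
    Derivable identitiesJ (p ++ r ++ y :: c :: (B₁ ++ c :: B₂))
      (p ++ r ++ c :: y :: (B₁ ++ c :: B₂)) := by
  have hyu := ((detectsLinearLetters_langJ hd).count_eq_three hyc (by grind) h hu hv).1
  refine (derivable_swap_or_separated (by grind) hyc (by grind) hy).resolve_right ?_
  rintro ⟨l, D₁, D₂, hB, hl, hyD₁, hyD₂, hcD₁⟩
  rw [hB] at hu h hl hyu
  exact LangJ.count_ne_one_of_separates_left hd hpV hyc hu hv h (by grind) hyD₂ (by grind) hl

theorem derivable_swap_of_count_pos_right (hd : [a, b, t, s].Nodup)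
    {p r V B₁ B₂ : List ℕ} {y c : ℕ} (hpV : Spread p (c :: V)) (hyc : y ≠ c) (hcr : c ∉ r)
    (hu : Reduced (p ++ r ++ y :: c :: (B₁ ++ y :: B₂))) (hv : Reduced (p ++ c :: V))
    (h : Unseparated (LangJ a b t s) (p ++ r ++ y :: c :: (B₁ ++ y :: B₂)) (p ++ c :: V))
    (hy : y ∉ p ++ r ++ B₁) (hc : 1 ≤ (p ++ r).count c + B₁.count c) :
    Derivable identitiesJ (p ++ r ++ y :: c :: (B₁ ++ y :: B₂))
      (p ++ r ++ c :: y :: (B₁ ++ y :: B₂)) := by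
  have hcu := ((detectsLinearLetters_langJ hd).count_eq_three hyc hcr h hu hv).2
  refine ((derivable_swap_or_separated (by grind) hyc.symm (by grind) hc).resolve_right ?_).symm
  rintro ⟨l, D₁, D₂, hB, hl, hcD₁, hcD₂, hyD₁⟩
  rw [hB] at hu h hl hcu
  rw [((List.Perm.swap y c _).append_left (p ++ r)).count_eq] at hl
  exact LangJ.count_ne_one_of_separates_right hd hpV hyc hcr hu hv h (by grind) hcD₂ (by grind) hl

theorem derivable_swap_of_unseparated_langJ (hd : [a, b, t, s].Nodup) {p r B V : List ℕ}
    {y c : ℕ} (hpV : Spread p (c :: V)) (hcr : c ∉ r) (hyc : y ≠ c)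
    (hu : Reduced (p ++ r ++ y :: c :: B)) (hv : Reduced (p ++ c :: V))
    (h : Unseparated (LangJ a b t s) (p ++ r ++ y :: c :: B) (p ++ c :: V)) :
    Derivable identitiesJ (p ++ r ++ y :: c :: B) (p ++ r ++ c :: y :: B) := by
  obtain ⟨hyu, hcu⟩ := (detectsLinearLetters_langJ hd).count_eq_three hyc hcr h hu hv
  by_cases hyA : y ∈ p ++ r
  · by_cases hcA : c ∈ p ++ r
    · exact derivable_swap_of_mem_before hyA hcA hyc B
    · obtain ⟨B₁, B₂, rfl, hcB₁⟩ := List.eq_append_cons_of_mem (show c ∈ B by grind)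
      exact derivable_swap_of_count_pos_left hd hpV hyc hu hv h (by grind) (by grind)
  · obtain ⟨B₁, B₂, rfl, hyB₁⟩ := List.eq_append_cons_of_mem (show y ∈ B by grind)
    by_cases hcAB₁ : c ∈ p ++ r ++ B₁
    · exact derivable_swap_of_count_pos_right hd hpV hyc hcr hu hv h (by grind) (by grind)
    · obtain ⟨B₃, B₄, rfl, hcB₃⟩ := List.eq_append_cons_of_mem (show c ∈ B₂ by grind)
      have hswap := derivable_swap_of_count_pos_left hd (B₁ := B₁ ++ y :: B₃) (B₂ := B₄) hpV hyc
        (by simpa using hu) hv (by simpa using h) (by grind) (by grind)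
      simpa using hswap

end LangJ

theorem append_eq_append_cons_iff {α : Type*} {A B C D : List α} {y : α} :
    A ++ B = C ++ y :: D ↔
      (∃ E, A = C ++ y :: E ∧ D = E ++ B) ∨ ∃ E, C = A ++ E ∧ B = E ++ y :: D := by
  constructor
  · intro h
    rcases List.append_eq_append_iff.1 h with ⟨E, hC, hB⟩ | ⟨E, hA, hED⟩
    · exact Or.inr ⟨E, hC, hB⟩
    · rcases List.cons_eq_append_iff.1 hED with ⟨rfl, hB⟩ | ⟨E', rfl, hD⟩
      · exact Or.inr ⟨[], by simpa using hA.symm, hB⟩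
      · exact Or.inl ⟨E', hA, hD⟩
  · rintro (⟨E, rfl, rfl⟩ | ⟨E, rfl, rfl⟩) <;> simp

theorem Spread.pull {p q₁ q₂ : List ℕ} {c : ℕ} (h : Spread p (c :: (q₁ ++ c :: q₂))) :
    Spread (p ++ [c, c]) (q₁ ++ q₂) := by
  have hcount : ∀ k, (p ++ [c, c] ++ (q₁ ++ q₂)).count k =
      (p ++ c :: (q₁ ++ c :: q₂)).count k := by
    intro k
    simp only [List.count_append, List.count_cons, List.count_nil]
    omega
  intro y p₁ p₂ s₁ s₂ hp hs hy
  rcases append_eq_append_cons_iff.1 hp with ⟨p₄, rfl, rfl⟩ | ⟨E, rfl, hcc⟩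
  · rcases append_eq_append_cons_iff.1 hs with ⟨X, rfl, rfl⟩ | ⟨X, rfl, rfl⟩
    · obtain ⟨k, hk, hk₁⟩ := h y p₁ p₄ (c :: s₁) (X ++ c :: q₂) rfl (by simp) (by grind)
      exact ⟨k, by grind, (hcount k).trans hk₁⟩
    · obtain ⟨k, hk, hk₁⟩ := h y p₁ p₄ (c :: (q₁ ++ c :: X)) s₂ rfl (by simp) (by grind)
      exact ⟨k, by grind, (hcount k).trans hk₁⟩
  · grind

theorem Spread.snoc_or {p V : List ℕ} {c : ℕ} (h : Spread p (c :: V)) :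
    Spread (p ++ [c]) V ∨
      ∃ q₁ q₂, V = q₁ ++ c :: q₂ ∧ c ∉ q₁ ∧ ∀ k ∈ q₁, (p ++ c :: V).count k ≠ 1 := by
  by_cases hS : Spread (p ++ [c]) V
  · exact Or.inl hS
  right
  unfold Spread at hS
  push Not at hS
  obtain ⟨y, p₁, p₂, q₁, q₂, hp, rfl, hy, hk⟩ := hS
  rcases append_eq_append_cons_iff.1 hp with ⟨p₃, rfl, rfl⟩ | ⟨E, rfl, hc⟩
  · obtain ⟨k, hkmem, hk₁⟩ := h y p₁ p₃ (c :: q₁) q₂ rfl rfl (by grind)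
    exact absurd (by simpa using hk₁) (hk k (by grind))
  · obtain ⟨rfl, rfl, rfl⟩ : E = [] ∧ y = c ∧ p₂ = [] := by
      simpa [List.singleton_eq_append_iff] using hc
    exact ⟨q₁, q₂, rfl, by grind, fun k hkq => by simpa using hk k (by simpa using hkq)⟩

section LangJ

variable {a b t s : ℕ}

theorem LangJ.two_le_count_of_unseparated (hd : [a, b, t, s].Nodup)
    {p r₂ s₂ q₁ q₂ : List ℕ} {c : ℕ} (hu : Reduced (p ++ c :: (r₂ ++ c :: s₂)))
    (hv : Reduced (p ++ c :: (q₁ ++ c :: q₂)))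
    (h : Unseparated (LangJ a b t s) (p ++ c :: (r₂ ++ c :: s₂)) (p ++ c :: (q₁ ++ c :: q₂)))
    (hcr₂ : c ∉ r₂) (hq₁ : ∀ k ∈ q₁, (p ++ c :: (q₁ ++ c :: q₂)).count k ≠ 1) {k : ℕ}
    (hk : k ∈ r₂) : 2 ≤ (p ++ c :: (r₂ ++ c :: s₂)).count k := by
  have hdet := detectsLinearLetters_langJ hd
  by_contra hk₂
  have hku : (p ++ c :: (r₂ ++ c :: s₂)).count k = 1 := by grind
  have hkv := (hdet.count_eq h hu hv k).symm.trans hku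
  obtain ⟨r₃, r₄, rfl⟩ := List.append_of_mem hk
  obtain ⟨X, Y, rfl⟩ := List.append_of_mem (show k ∈ q₂ by grind)
  have hc := hdet.count_prefix_eq (u₁ := p ++ c :: r₃) (u₂ := r₄ ++ c :: s₂)
    (v₁ := p ++ c :: (q₁ ++ c :: X)) (v₂ := Y) (by simpa using h) (by simpa using hu)
    (by simpa using hv) (by simpa using hku) c
  grind

theorem derivable_of_unseparated_langJ (hd : [a, b, t, s].Nodup)
    (hsound : ∀ {u v}, Derivable identitiesJ u v → Unseparated (LangJ a b t s) u v)
    (p u v : List ℕ) (hpv : Spread p v) (hu : Reduced (p ++ u)) (hv : Reduced (p ++ v))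
    (h : Unseparated (LangJ a b t s) (p ++ u) (p ++ v)) :
    Derivable identitiesJ (p ++ u) (p ++ v) := by
  have hdet := detectsLinearLetters_langJ hd
  induction hn : v.length using Nat.strong_induction_on generalizing p u v with
  | _ n ih =>
  subst hn
  have hperm : u.Perm v :=
    (List.perm_append_left_iff p).1 (List.perm_iff_count.2 (hdet.count_eq h hu hv))
  rcases v with _ | ⟨c, V⟩
  · rw [hperm.eq_nil]
    exact Derivable.refl _
  obtain ⟨r, B, rfl, hcr⟩ := List.eq_append_cons_of_mem (hperm.mem_iff.2 List.mem_cons_self)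
  have hmove := derivable_move_left hsound (fun r y B hcr hyc hu h =>
    derivable_swap_of_unseparated_langJ hd hpv hcr hyc hu hv h) r B hcr hu h
  replace hu := hu.of_perm (List.Perm.append_left p List.perm_middle)
  replace h := (hsound hmove).symm.trans h
  refine hmove.trans ?_
  rcases hpv.snoc_or with hpV | ⟨q₁, q₂, rfl, hcq₁, hq₁⟩
  · simpa using ih V.length (by simp) (p ++ [c]) (r ++ B) V hpV (by simpa using hu)
      (by simpa using hv) (by simpa using h) rfl
  have hcu := hdet.count_eq h hu hv c
  obtain ⟨r₂, s₂, hrB, hcr₂⟩ := List.eq_append_cons_of_mem (show c ∈ r ++ B by grind)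
  rw [hrB] at hu h ⊢
  have hpull_u := derivable_pull (P := p) (S := s₂) hcr₂ fun k hk =>
    LangJ.two_le_count_of_unseparated hd hu hv h hcr₂ hq₁ hk
  have hpull_v := derivable_pull (P := p) (S := q₂) hcq₁ fun k hk => by
    have := hv k (by simp [hk])
    have := hq₁ k hk
    omega
  have hperm_pull (r s : List ℕ) : (p ++ c :: (r ++ c :: s)).Perm (p ++ c :: c :: (r ++ s)) :=
    (List.perm_middle.cons c).append_left p
  have hrest := ih (q₁ ++ q₂).length (by simp) (p ++ [c, c]) (r₂ ++ s₂) (q₁ ++ q₂) hpv.pull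
    (by simpa using hu.of_perm (hperm_pull r₂ s₂)) (by simpa using hv.of_perm (hperm_pull q₁ q₂))
    (by simpa using (hsound hpull_u).symm.trans (h.trans (hsound hpull_v))) rfl
  exact hpull_u.trans (Derivable.trans (by simpa using hrest) hpull_v.symm)

theorem varietyJ_eq (hd : [a, b, t, s].Nodup) :
    varietyJ.{w} = generatedVariety.{w} (MTau (tauOne ⊓ zetaCon)
        (conClass (tauOne ⊓ zetaCon)
          (letter a * letter t * letter b * letter a * letter s * letter b))) ∧
      generatedVariety.{w} (MTau (tauOne ⊓ zetaCon)
        (conClass (tauOne ⊓ zetaCon)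
          (letter a * letter t * letter b * letter a * letter s * letter b))) =
      generatedVariety.{w} (SyntacticMonoid
        ({letter a} * {letter t} * {letter b} * plus a * {letter s} * plus b)) := by
  have hsound : ∀ e ∈ identitiesJ, Satisfies (MTau (tauOne ⊓ zetaCon) (conClass
      (tauOne ⊓ zetaCon)
      (letter a * letter t * letter b * letter a * letter s * letter b))) e :=
    fun e he => identitiesJ_sound hd he
  have hL (w : Word) : w ∈ conClass (tauOne ⊓ zetaCon)
      (letter a * letter t * letter b * letter a * letter s * letter b) ↔
      LangJ a b t s w.toList := by
    rw [conClass_languageJ hd, mem_languageJ_iff]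
  have hsound' : ∀ e ∈ identitiesJ, Satisfies (SyntacticMonoid (conClass
      (tauOne ⊓ zetaCon)
      (letter a * letter t * letter b * letter a * letter s * letter b))) e :=
    fun e he => (hsound e he).quotient_mono (reesCon_le_syntacticCon _ _)
  have hvar := varOf_eq_MTau_and_syntacticMonoid.{w} hsound fun u v =>
    derivCon_of_satisfies hL hsound' hasRepetitionIdentities_identitiesJ fun u v hu hv =>
      derivable_of_unseparated_langJ hd (fun h => h.unseparated hL hsound') [] u v
        (fun y p₁ p₂ q₁ q₂ hp => by simp at hp) hu hv
  rw [← conClass_languageJ hd]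
  exact hvar

end LangJ

theorem mainTheorem7 (a b t s : ℕ) (hdistinct : [a, b, t, s].Nodup) :
    (generatedVariety.{w} (WithOne SemigroupA0) =
        generatedVariety.{w} (MTau tauOne (conClass tauOne (letter a * letter b))) ∧
      generatedVariety.{w} (MTau tauOne (conClass tauOne (letter a * letter b))) =
        generatedVariety.{w} (SyntacticMonoid (plus a * plus b))) ∧
    (generatedVariety.{w} (WithOne SemigroupA) =
        generatedVariety.{w} (MTau (tauOne ⊓ gammaCon)
          (conClass (tauOne ⊓ gammaCon) (letter a * letter b ^ 2 * letter t * letter a))) ∧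
      generatedVariety.{w} (MTau (tauOne ⊓ gammaCon)
          (conClass (tauOne ⊓ gammaCon) (letter a * letter b ^ 2 * letter t * letter a))) =
        generatedVariety.{w}
          (SyntacticMonoid (plus a * {letter b} * plus b * {letter t} * plus a))) ∧
    (varietyJ.{w} =
        generatedVariety.{w} (MTau (tauOne ⊓ zetaCon)
          (conClass (tauOne ⊓ zetaCon)
            (letter a * letter t * letter b * letter a * letter s * letter b))) ∧
      generatedVariety.{w} (MTau (tauOne ⊓ zetaCon)
          (conClass (tauOne ⊓ zetaCon)
            (letter a * letter t * letter b * letter a * letter s * letter b))) =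
        generatedVariety.{w}
          (SyntacticMonoid
            ({letter a} * {letter t} * {letter b} * plus a * {letter s} * plus b))) ∧
    (varietyK.{w} =
        generatedVariety.{w} (MTau (tauOne ⊓ zetaCon)
          (conClass (tauOne ⊓ zetaCon)
            (letter a * letter t * letter b ^ 2 * letter a))) ∧
      generatedVariety.{w} (MTau (tauOne ⊓ zetaCon)
          (conClass (tauOne ⊓ zetaCon)
            (letter a * letter t * letter b ^ 2 * letter a))) =
        generatedVariety.{w}
          (SyntacticMonoid
            ({letter a} * {letter t} * {letter b} * plus b * plus a))) := by
  have hab : a ≠ b := by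
    rintro rfl
    simp at hdistinct
  have habt : [a, b, t].Nodup := hdistinct.sublist (List.prefix_append [a, b, t] [s]).sublist
  exact ⟨generatedVariety_A0_eq hab, generatedVariety_A_eq habt, varietyJ_eq hdistinct,
    varietyK_eq habt⟩
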